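/- Let $\mathbb T=\mathbb R/2\pi\mathbb Z$. For $f\in L^2(\mathbb T\times\mathbb R)$ let $\hat f(k,\xi)$, $k\in\mathbb Z$, $\xi\in\mathbb R$, be its Fourier transform, $P_0f=f_0=\frac1{2\pi}\int_{\mathbb T}f\,dx$ and $f_{\neq}=f-f_0$. For $t\ge 0$ and $b\in\mathbb R$ let $\Lambda_t^b$ and $\langle\partial_x\rangle^{b}$ be the Fourier multipliers with symbols $(1+k^2+(\xi+tk)^2)^{b/2}$ and $(1+k^2)^{b/2}$, and let $\|f\|_{H^m}=\|\Lambda_0^mf\|_{L^2}$. For $\nu>0$ consider on $\mathbb T\times\mathbb R$ the quasi-linearized system $$ \begin{cases} \partial_t\omega^{\mathrm i}+y\partial_x\omega^{\mathrm i}-\nu\Delta\omega^{\mathrm i}+u^{\mathrm i}\cdot\nabla\omega^{\mathrm i}=\partial_x\theta^{\mathrm i},\\ \partial_t\theta^{\mathrm i}+y\partial_x\theta^{\mathrm i}+u_0^{\mathrm i,1}\partial_x\theta^{\mathrm i}-\nu\Delta\theta^{\mathrm i}=0,\\ \partial_tu_0^{\mathrm i,1}-\nu\partial_y^2u_0^{\mathrm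 i,1}=-P_0(u^{\mathrm i}_{\neq}\cdot\nabla u^{\mathrm i,1}_{\neq}),\\ u^{\mathrm i}=(u^{\mathrm i,1},u^{\mathrm i,2})=(-\partial_y\Delta^{-1}\omega^{\mathrm i},\ \partial_x\Delta^{-1}\omega^{\mathrm i}),\\ \omega^{\mathrm i}(0)=\omega_{\mathrm{in}},\quad \theta^{\mathrm i}(0)=\theta_{\mathrm{in}}. \end{cases} $$ A (real-valued) solution on $[0,T]$ is understood in the sense of distributions, with $\omega^{\mathrm i},\theta^{\mathrm i}\in C([0,T];H^m)$ and $u^{\mathrm i}\in C([0,T];L^2)$. **Proposition.** Let $m>2$ and $m_1\ge1$. There are constants $\epsilon_1>0$ and $C>0$, depending only on $m$ and $m_1$, such that the following holds for all $0<\epsilon_0\le\epsilon_1$, all $0<\nu\le1$ and all $T>0$. Let $(\omega^{\mathrm i},\theta^{\mathrm i})$ be a solution of the system on $[0,T]$ with $$\|\omega_{\mathrm{in}}\|_{H^m}\le\epsilon_0\nu^{1/3},\qquad \|\langle\partial_x\rangle^{m_1}\theta_{\mathrm{in}}\|_{H^m}\le\epsilon_0\nu^{2/3}.$$ Then for all $t\in[0,T]$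 with $t\le\nu^{-1/6}$, $$\|\Lambda_t^m\omega^{\mathrm i}(t)\|_{L^2}+\nu^{-1/3}\|\langle\partial_x\rangle^{m_1}\Lambda_t^m\theta^{\mathrm i}(t)\|_{L^2}\le C\epsilon_0\nu^{1/3}.$$ -/

import Mathlib

open MeasureTheory Set Filter Topology
open scoped ENNReal FourierTransform

noncomputable section

namespace Couette

instance fact_two_pi_pos : Fact (0 < 2 * Real.pi) := ⟨Real.two_pi_pos⟩

/-- The one-dimensional torus `𝕋 = ℝ / 2πℤ`. -/
abbrev Torus : Type := AddCircle (2 * Real.pi)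

/-- Real-valued `L²(𝕋 × ℝ)`, for the measure `dx dy` of total `x`-mass `2π`. -/
abbrev L2 : Type := Lp ℝ 2 (volume : Measure (Torus × ℝ))

/-- The `k`-th Fourier mode in `x`: `f_k(y) = (1/2π) ∫_𝕋 f(x,y) e^{-ikx} dx`. -/
def xMode (f : L2) (k : ℤ) (y : ℝ) : ℂ :=
  fourierCoeff (fun x : Torus => ((f (x, y) : ℝ) : ℂ)) k

theorem memLp_xMode (f : L2) (k : ℤ) : MemLp (xMode f k) 2 (volume : Measure ℝ) := by
  have hf : StronglyMeasurable (f : Torus × ℝ → ℝ) := Lp.stronglyMeasurable f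
  have hF : StronglyMeasurable
      (fun p : Torus × ℝ => (fourier (-k) p.1 : ℂ) • ((f p : ℝ) : ℂ)) :=
    ((fourier (-k)).continuous.comp continuous_fst).stronglyMeasurable.smul
      (Complex.continuous_ofReal.comp_stronglyMeasurable hf)
  have hmeas : StronglyMeasurable (xMode f k) :=
    hF.integral_prod_left' (μ := AddCircle.haarAddCircle)
  refine ⟨hmeas.aestronglyMeasurable, ?_⟩
  rw [eLpNorm_lt_top_iff_lintegral_rpow_enorm_lt_top (by norm_num) (by norm_num)]
  have hpt : ∀ y : ℝ, ‖xMode f k y‖ₑ ^ (2 : ℝ) ≤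
      ∫⁻ x : Torus, ‖f (x, y)‖ₑ ^ (2 : ℝ) ∂AddCircle.haarAddCircle := by
    intro y
    have h1 : ‖xMode f k y‖ₑ ≤ ∫⁻ x : Torus, ‖f (x, y)‖ₑ ∂AddCircle.haarAddCircle := by
      refine (enorm_integral_le_lintegral_enorm _).trans (le_of_eq ?_)
      refine lintegral_congr fun x => ?_
      have e1 : ‖(fourier (-k) x : ℂ)‖ₑ = 1 := by
        rw [← ofReal_norm, fourier_apply, Circle.norm_coe, ENNReal.ofReal_one]
      have e2 : ‖((f (x, y) : ℝ) : ℂ)‖ₑ = ‖f (x, y)‖ₑ := by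
        rw [← ofReal_norm, ← ofReal_norm, Complex.norm_real]
      rw [enorm_smul, e1, e2, one_mul]
    have hs : AEStronglyMeasurable (fun x : Torus => f (x, y))
        (AddCircle.haarAddCircle : Measure Torus) :=
      (hf.comp_measurable measurable_prodMk_right).aestronglyMeasurable
    have h2 := eLpNorm_le_eLpNorm_of_exponent_le (p := 1) (q := 2) (by norm_num) hs
    rw [eLpNorm_one_eq_lintegral_enorm,
      eLpNorm_eq_lintegral_rpow_enorm_toReal (by norm_num) (by norm_num)] at h2
    calc ‖xMode f k y‖ₑ ^ (2 : ℝ)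
        ≤ ((∫⁻ x : Torus, ‖f (x, y)‖ₑ ^ (2 : ℝ) ∂AddCircle.haarAddCircle) ^ (1 / 2 : ℝ))
            ^ (2 : ℝ) :=
          ENNReal.rpow_le_rpow (h1.trans (by simpa using h2)) (by norm_num)
      _ = _ := by rw [← ENNReal.rpow_mul]; norm_num
  have hL := Lp.memLp f
  have hfin := (eLpNorm_lt_top_iff_lintegral_rpow_enorm_lt_top (by norm_num) (by norm_num)).1
    hL.2
  have hm2 : AEMeasurable (fun p : Torus × ℝ => ‖f p‖ₑ ^ (2 : ℝ))
      ((volume : Measure Torus).prod (volume : Measure ℝ)) :=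
    (hf.enorm.pow_const _).aemeasurable
  simp only [ENNReal.toReal_ofNat] at hfin ⊢
  have hfin' : ∫⁻ p : Torus × ℝ, ‖f p‖ₑ ^ (2 : ℝ)
      ∂((volume : Measure Torus).prod (volume : Measure ℝ)) < ∞ := hfin
  rw [lintegral_prod_symm _ hm2] at hfin'
  refine lt_of_le_of_lt (lintegral_mono hpt) ?_
  have hv : ∀ y : ℝ, ∫⁻ x : Torus, ‖f (x, y)‖ₑ ^ (2 : ℝ) ∂AddCircle.haarAddCircle =
      (ENNReal.ofReal (2 * Real.pi))⁻¹ * ∫⁻ x : Torus, ‖f (x, y)‖ₑ ^ (2 : ℝ) := by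
    intro y
    rw [AddCircle.volume_eq_smul_haarAddCircle, lintegral_smul_measure, smul_eq_mul,
      ← mul_assoc, ENNReal.inv_mul_cancel (by simp [Real.pi_pos]) ENNReal.ofReal_ne_top, one_mul]
  simp_rw [hv]
  rw [lintegral_const_mul' _ _ (by simp [Real.pi_pos])]
  exact ENNReal.mul_lt_top (by simp [Real.pi_pos]) hfin'

/-- The Fourier transform on `𝕋 × ℝ`,
`f̂(k,ξ) = (1/2π) ∫_𝕋 ∫_ℝ f(x,y) e^{-ikx - iξy} dy dx`, in the sense of `L²`. Mathlib's `𝓕` has the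
kernel `e^{-2πi y ζ}`, hence the argument `ζ = ξ / 2π`. With this normalization
`‖f‖²_{L²} = ∑ₖ ∫ |f̂(k,ξ)|² dξ`. -/
def hat (f : L2) (k : ℤ) (ξ : ℝ) : ℂ :=
  (𝓕 ((memLp_xMode f k).toLp (xMode f k)) : Lp ℂ 2 (volume : Measure ℝ)) (ξ / (2 * Real.pi))

/-- `‖σ(D) f‖_{L²} = (∑ₖ ∫ |σ(k,ξ) f̂(k,ξ)|² dξ)^{1/2}`, with the value `∞` if the integral
diverges. -/
def multNorm (σ : ℤ → ℝ → ℝ) (f : L2) : ℝ≥0∞ :=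
  (∑' k : ℤ, ∫⁻ ξ : ℝ, (ENNReal.ofReal |σ k ξ| * ‖hat f k ξ‖ₑ) ^ 2) ^ (1 / 2 : ℝ)

/-- The symbol of `Λ_t^b`, where `Λ_t² = 1 - ∂_x² - (∂_y + t ∂_x)²`. -/
def lam (t b : ℝ) (k : ℤ) (ξ : ℝ) : ℝ :=
  (1 + (k : ℝ) ^ 2 + (ξ + t * k) ^ 2) ^ (b / 2)

/-- The symbol of `⟨∂_x⟩^b`. -/
def japX (b : ℝ) (k : ℤ) : ℝ := (1 + (k : ℝ) ^ 2) ^ (b / 2)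

/-- The norm of the Sobolev space `H^s(𝕋 × ℝ)`. -/
def sobolevNorm (s : ℝ) (f : L2) : ℝ≥0∞ := multNorm (lam 0 s) f

/-- `f ∈ C([0,T]; H^s)`. -/
def ContinuousInSobolev (s T : ℝ) (f : ℝ → L2) : Prop :=
  (∀ t ∈ Icc 0 T, sobolevNorm s (f t) < ∞) ∧
  ∀ t ∈ Icc 0 T, Tendsto (fun r => sobolevNorm s (f r - f t)) (𝓝[Icc 0 T] t) (𝓝 0)

/-- The zero mode `f_0(y) = (1/2π) ∫_𝕋 f(x,y) dx`. -/
def zeroMode (f : Torus × ℝ → ℝ) (y : ℝ) : ℝ := ∫ x : Torus, f (x, y) ∂AddCircle.haarAddCircle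

/-- The non-zero modes `f_≠ = f - f_0`. -/
def nonzeroModes (f : Torus × ℝ → ℝ) (p : Torus × ℝ) : ℝ := f p - zeroMode f p.2

/-- `u = ∇^⊥ Δ⁻¹ ω = (-∂_y Δ⁻¹ ω, ∂_x Δ⁻¹ ω)` with Fourier multipliers, where
`Δ⁻¹` has the symbol `-1 / (k² + ξ²)`. -/
def IsBiotSavart (ω u₁ u₂ : L2) : Prop :=
  ∀ k : ℤ, ∀ᵐ ξ : ℝ,
    hat u₁ k ξ = (Complex.I * ξ / ((k : ℂ) ^ 2 + (ξ : ℂ) ^ 2)) * hat ω k ξ ∧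
    hat u₂ k ξ = -(Complex.I * k / ((k : ℂ) ^ 2 + (ξ : ℂ) ^ 2)) * hat ω k ξ

/-- Test functions: smooth functions of `(t,x,y) ∈ ℝ × 𝕋 × ℝ`, compactly supported in `y`. -/
structure IsTest (φ : ℝ → Torus → ℝ → ℝ) : Prop where
  smooth : ContDiff ℝ ((⊤ : ℕ∞) : WithTop ℕ∞) (fun z : ℝ × ℝ × ℝ => φ z.1 (z.2.1 : Torus) z.2.2)
  compact : ∃ R : ℝ, ∀ t x y, R < |y| → φ t x y = 0

/-- `∂_t φ` -/
def dt (φ : ℝ → Torus → ℝ → ℝ) (t : ℝ) (x : Torus) (y : ℝ) : ℝ := deriv (fun s => φ s x y) t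

/-- `∂_x φ` -/
def dx (φ : ℝ → Torus → ℝ → ℝ) (t : ℝ) (x : Torus) (y : ℝ) : ℝ :=
  deriv (fun h : ℝ => φ t (x + (h : Torus)) y) 0

/-- `∂_y φ` -/
def dy (φ : ℝ → Torus → ℝ → ℝ) (t : ℝ) (x : Torus) (y : ℝ) : ℝ := deriv (fun s => φ t x s) y

/-- `Δ φ = ∂_x² φ + ∂_y² φ` -/
def lap (φ : ℝ → Torus → ℝ → ℝ) (t : ℝ) (x : Torus) (y : ℝ) : ℝ :=
  dx (dx φ) t x y + dy (dy φ) t x y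

/-- `(ω, θ)` with velocity `u = (u₁, u₂)` is a (weak) solution on `[0,T]`, with vorticity and
temperature in `C([0,T]; H^m)` and velocity in `C([0,T]; L²)`, of the quasi-linearized system
```
∂_t ω + y ∂_x ω - ν Δ ω + u · ∇ω = ∂_x θ,
∂_t θ + y ∂_x θ + u₀¹ ∂_x θ - ν Δ θ = 0,
∂_t u₀¹ - ν ∂_y² u₀¹ = - P₀ (u_≠ · ∇ u_≠¹),
u = ∇^⊥ Δ⁻¹ ω,   ω(0) = ω_in,   θ(0) = θ_in
```
on `𝕋 × ℝ`. Since `u` and `u_≠` are divergence free, `u · ∇ω = div (u ω)` and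
`P₀ (u_≠ · ∇ u_≠¹) = ∂_y P₀ (u_≠² u_≠¹)`; all derivatives are put on the test function. -/
structure IsSolution (m ν T : ℝ) (ω_in θ_in : L2) (ω θ u₁ u₂ : ℝ → L2) : Prop where
  cont_vorticity : ContinuousInSobolev m T ω
  cont_temperature : ContinuousInSobolev m T θ
  cont_velocity₁ : ContinuousOn u₁ (Icc 0 T)
  cont_velocity₂ : ContinuousOn u₂ (Icc 0 T)
  biotSavart : ∀ t ∈ Icc 0 T, IsBiotSavart (ω t) (u₁ t) (u₂ t)
  init_vorticity : ω 0 = ω_in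
  init_temperature : θ 0 = θ_in
  vorticity_eq : ∀ φ, IsTest φ → ∀ t ∈ Icc 0 T,
    (∫ p : Torus × ℝ, ω t p * φ t p.1 p.2) - (∫ p : Torus × ℝ, ω_in p * φ 0 p.1 p.2) =
      ∫ s in (0 : ℝ)..t, ∫ p : Torus × ℝ,
        (ω s p * (dt φ s p.1 p.2 + p.2 * dx φ s p.1 p.2 + ν * lap φ s p.1 p.2
            + u₁ s p * dx φ s p.1 p.2 + u₂ s p * dy φ s p.1 p.2)
          - θ s p * dx φ s p.1 p.2)
  temperature_eq : ∀ φ, IsTest φ → ∀ t ∈ Icc 0 T,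
    (∫ p : Torus × ℝ, θ t p * φ t p.1 p.2) - (∫ p : Torus × ℝ, θ_in p * φ 0 p.1 p.2) =
      ∫ s in (0 : ℝ)..t, ∫ p : Torus × ℝ,
        θ s p * (dt φ s p.1 p.2 + p.2 * dx φ s p.1 p.2
          + zeroMode (u₁ s) p.2 * dx φ s p.1 p.2 + ν * lap φ s p.1 p.2)
  zeroMode_eq : ∀ φ, IsTest φ → ∀ t ∈ Icc 0 T,
    (∫ p : Torus × ℝ, zeroMode (u₁ t) p.2 * φ t p.1 p.2)
        - (∫ p : Torus × ℝ, zeroMode (u₁ 0) p.2 * φ 0 p.1 p.2) =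
      ∫ s in (0 : ℝ)..t, ∫ p : Torus × ℝ,
        (zeroMode (u₁ s) p.2 * (dt φ s p.1 p.2 + ν * dy (dy φ) s p.1 p.2)
          + zeroMode (fun q => nonzeroModes (u₂ s) q * nonzeroModes (u₁ s) q) p.2
              * dy φ s p.1 p.2)

end Couette

end

/-!
Everything is done in frequency space `ℤ × ℝ`, in the frame moving with the Couette flow, where the
transport term `y∂ₓ` disappears and `‖Λ_t^m f‖` becomes the fixed weighted norm `hnorm m F =
‖⟨(k,ξ)⟩^m F‖_{L²}`. There the vorticity and the temperature are *profiles* (`IsProfile`): weak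
solutions of `∂ₜF + u · ∇F = νΔ_t F + h`, with `u = ∇^⊥ψ` and the sheared Laplacian `Δ_t`. To pass
from the distributional formulation to profiles, the equations are tested with the plane waves `Re
(e^{-ik(x - ty)} p̄(y))`, on which `∂ₜ + y∂ₓ` vanishes, and products are turned into convolutions
by Plancherel's theorem (`IsSolution.isProfile_vorticity`, `IsSolution.isProfile_temperature`).

The energy estimate `IsProfile.energy_le` drops the diffusion, which has a sign, and uses that the
transport term is antisymmetric: only the commutator of `u · ∇` with the weight remains, and for `m
> 2` the embedding `∫ ⟨z⟩ |F| ≤ C hnorm m F` bounds it by `C κ X² Z`, where `κ ⟨D⟩ f` with `hnorm m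
f ≤ Z` bounds the velocity gradient (`abs_re_transport_truncWeight_le`). The weight is truncated so
that all pairings make sense for solutions that are merely bounded in `H^m`; weak differentiability
against plane waves extends to the truncated energy by density (`hasDerivWithinAt_inner_of_dense`).

The velocity gradient in the moving frame is bounded by `⟨D⟩ω` up to the factor `κ = 2(1 + t)` lost
in inverting `Δ_t` on `k ≠ 0` (`len_sq_div_disp_le`); nothing is lost on the shear flow `k = 0`.
Hence the vorticity satisfies `X² ≤ X(0)² + 2tXY + C t(1 + t)X³`, where `Y` bounds `‖∂ₓθ‖`. The
temperature is transported by the shear flow only, so its modes in `x` decouple; each mode at most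
doubles its energy, which allows for the weight `⟨∂ₓ⟩^{m₁}`, and `m₁ ≥ 1` pays for the derivative
in `∂ₓθ`. Since `t(1 + t) ≤ 2ν^{-1/3}` for `t ≤ ν^{-1/6}`, the data of size `ε₀ν^{1/3}` and
`ε₀ν^{2/3}` make the right-hand side smaller than `16 (ε₀ν^{1/3})²` as long as `X ≤ 4ε₀ν^{1/3}`,
and the continuity method (`le_of_bootstrap`) closes the argument.
-/

open MeasureTheory Set Filter Topology
open scoped ENNReal FourierTransform

noncomputable section

namespace Couette

/-! ### The frequency space -/

/-- The frequency space `ℤ × ℝ` dual to `𝕋 × ℝ`. -/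
abbrev Freq : Type := ℤ × ℝ

/-- Counting measure times Lebesgue measure, a Haar measure on the group `ℤ × ℝ`. -/
abbrev freqMeasure : Measure Freq := (Measure.count : Measure ℤ).prod (volume : Measure ℝ)

instance freqMeasure_isNegInvariant : freqMeasure.IsNegInvariant := by
  refine ⟨?_⟩
  have h := (Measure.measurePreserving_neg (Measure.count : Measure ℤ)).prod
    (Measure.measurePreserving_neg (volume : Measure ℝ))
  exact h.map_eq

theorem lintegral_freqMeasure {f : Freq → ℝ≥0∞} (hf : Measurable f) :
    ∫⁻ z, f z ∂freqMeasure = ∑' k : ℤ, ∫⁻ ξ : ℝ, f (k, ξ) := by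
  rw [lintegral_prod _ hf.aemeasurable, lintegral_count]

/-- The `L²` norm of a nonnegative function. -/
def l2 {α : Type*} [MeasurableSpace α] (μ : Measure α) (f : α → ℝ≥0∞) : ℝ≥0∞ :=
  (∫⁻ z, f z ^ 2 ∂μ) ^ (1 / 2 : ℝ)

section

variable {α : Type*} [MeasurableSpace α] {μ : Measure α}

theorem l2_sq (f : α → ℝ≥0∞) : l2 μ f ^ 2 = ∫⁻ z, f z ^ 2 ∂μ := by
  rw [l2, ← ENNReal.rpow_natCast, ← ENNReal.rpow_mul]; norm_num

theorem l2_mono_ae {f g : α → ℝ≥0∞} (h : ∀ᵐ z ∂μ, f z ≤ g z) : l2 μ f ≤ l2 μ g := by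
  unfold l2
  refine ENNReal.rpow_le_rpow (lintegral_mono_ae ?_) (by norm_num)
  filter_upwards [h] with z hz
  gcongr

theorem l2_mono {f g : α → ℝ≥0∞} (h : ∀ z, f z ≤ g z) : l2 μ f ≤ l2 μ g :=
  l2_mono_ae (Eventually.of_forall h)

theorem l2_congr_ae {f g : α → ℝ≥0∞} (h : ∀ᵐ z ∂μ, f z = g z) : l2 μ f = l2 μ g :=
  le_antisymm (l2_mono_ae (h.mono fun _ h => h.le)) (l2_mono_ae (h.mono fun _ h => h.ge))

theorem l2_const_mul {c : ℝ≥0∞} (hc : c ≠ ∞) (f : α → ℝ≥0∞) :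
    l2 μ (fun z => c * f z) = c * l2 μ f := by
  unfold l2
  simp_rw [mul_pow]
  rw [lintegral_const_mul' _ _ (ENNReal.pow_ne_top hc),
    ENNReal.mul_rpow_of_nonneg _ _ (by norm_num), ← ENNReal.rpow_natCast, ← ENNReal.rpow_mul]
  norm_num

theorem l2_add_le {f g : α → ℝ≥0∞} (hf : AEMeasurable f μ) (hg : AEMeasurable g μ) :
    l2 μ (fun z => f z + g z) ≤ l2 μ f + l2 μ g := by
  have := ENNReal.lintegral_Lp_add_le (μ := μ) (p := 2) hf hg (by norm_num)
  simpa [l2] using this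

theorem l2_comp {f : α → ℝ≥0∞} (hf : Measurable f) {e : α → α} (he : MeasurePreserving e μ μ) :
    l2 μ (fun z => f (e z)) = l2 μ f := by
  unfold l2
  rw [he.lintegral_comp (hf.pow_const 2)]

theorem lintegral_mul_le_l2 {f g : α → ℝ≥0∞} (hf : AEMeasurable f μ) (hg : AEMeasurable g μ) :
    ∫⁻ z, f z * g z ∂μ ≤ l2 μ f * l2 μ g := by
  have := ENNReal.lintegral_mul_le_Lp_mul_Lq μ (p := 2) (q := 2)
    ⟨by norm_num, by norm_num, by norm_num⟩ hf hg
  simpa [l2] using this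

theorem l2_enorm_eq_eLpNorm {E : Type*} [NormedAddCommGroup E] (F : α → E) :
    l2 μ (fun z => ‖F z‖ₑ) = eLpNorm F 2 μ := by
  rw [eLpNorm_eq_lintegral_rpow_enorm_toReal (by norm_num) (by norm_num)]
  simp [l2]

end

/-! ### Trilinear convolution estimates -/

section

variable {G : Type*} [AddCommGroup G] [MeasurableSpace G] [MeasurableAdd₂ G]
  {μ : Measure G} [SFinite μ] [μ.IsAddLeftInvariant]

/-- Young's inequality `L¹ * L² ⊂ L²` in trilinear form. -/
theorem lintegral_trilinear_le_fst {f g h : G → ℝ≥0∞} (hf : Measurable f) (hg : Measurable g)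
    (hh : Measurable h) :
    ∫⁻ z : G × G, f (z.1 + z.2) * g z.1 * h z.2 ∂μ.prod μ ≤
      (∫⁻ z, g z ∂μ) * (l2 μ f * l2 μ h) := by
  rw [lintegral_prod _ (by fun_prop), ← lintegral_mul_const _ hg]
  refine lintegral_mono fun z => ?_
  calc ∫⁻ w, f (z + w) * g z * h w ∂μ
      = g z * ∫⁻ w, f (z + w) * h w ∂μ := by
        rw [← lintegral_const_mul _ (by fun_prop)]
        exact lintegral_congr fun w => by ring
    _ ≤ g z * (l2 μ f * l2 μ h) := by
        gcongr
        refine (lintegral_mul_le_l2 (by fun_prop) hh.aemeasurable).trans_eq ?_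
        rw [l2_comp hf (measurePreserving_add_left μ z)]

theorem lintegral_trilinear_le_snd {f g h : G → ℝ≥0∞} (hf : Measurable f) (hg : Measurable g)
    (hh : Measurable h) :
    ∫⁻ z : G × G, f (z.1 + z.2) * g z.1 * h z.2 ∂μ.prod μ ≤
      (∫⁻ z, h z ∂μ) * (l2 μ f * l2 μ g) := by
  rw [← lintegral_prod_swap]
  refine le_trans (le_of_eq (lintegral_congr fun z => ?_)) (lintegral_trilinear_le_fst hf hh hg)
  simp only [Prod.fst_swap, Prod.snd_swap, add_comm z.2 z.1]
  ring

variable [MeasurableNeg G] [μ.IsNegInvariant]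

/-- The involution `(z, w) ↦ (-z, z + w)`, which exchanges the output `z + w` of a convolution with
the input `w` and reflects the other input. -/
theorem measurePreserving_exchange :
    MeasurePreserving (fun z : G × G => (-z.1, z.1 + z.2)) (μ.prod μ) (μ.prod μ) :=
  ((Measure.measurePreserving_neg μ).prod (MeasurePreserving.id μ)).comp
    (measurePreserving_prod_add μ μ)

theorem lintegral_trilinear_le_out {f g h : G → ℝ≥0∞} (hf : Measurable f) (hg : Measurable g)
    (hh : Measurable h) :
    ∫⁻ z : G × G, f (z.1 + z.2) * g z.1 * h z.2 ∂μ.prod μ ≤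
      (∫⁻ z, f z ∂μ) * (l2 μ g * l2 μ h) := by
  have hm : Measurable fun z : G × G => f (z.1 + z.2) * g z.1 * h z.2 := by fun_prop
  rw [← measurePreserving_exchange.lintegral_comp hm]
  have := lintegral_trilinear_le_snd (μ := μ) hh (g := fun z => g (-z)) (by fun_prop) hf
  refine le_trans (le_of_eq (lintegral_congr fun z => ?_)) (this.trans_eq ?_)
  · simp only [neg_add_cancel_left]; ring
  · rw [l2_comp hg (Measure.measurePreserving_neg μ), mul_comm (l2 μ h)]

end

/-! ### Weights -/

/-- The Japanese bracket `⟨z⟩ = (1 + k² + ξ²)^{1/2}` of a frequency `z = (k, ξ)`. -/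
def jap (z : Freq) : ℝ := √(1 + (z.1 : ℝ) ^ 2 + z.2 ^ 2)

/-- The Euclidean length of a frequency. -/
def len (z : Freq) : ℝ := √((z.1 : ℝ) ^ 2 + z.2 ^ 2)

/-- The cross product `z ∧ w`, the symbol of `∇^⊥ · ∇`. -/
def cross (z w : Freq) : ℝ := w.1 * z.2 - z.1 * w.2

theorem jap_sq (z : Freq) : jap z ^ 2 = 1 + (z.1 : ℝ) ^ 2 + z.2 ^ 2 :=
  Real.sq_sqrt (by positivity)

theorem len_sq (z : Freq) : len z ^ 2 = (z.1 : ℝ) ^ 2 + z.2 ^ 2 := Real.sq_sqrt (by positivity)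

theorem one_le_jap (z : Freq) : 1 ≤ jap z :=
  Real.one_le_sqrt.2 (by nlinarith [sq_nonneg (z.1 : ℝ), sq_nonneg z.2])

theorem jap_pos (z : Freq) : 0 < jap z := zero_lt_one.trans_le (one_le_jap z)

theorem len_nonneg (z : Freq) : 0 ≤ len z := Real.sqrt_nonneg _

theorem len_le_jap (z : Freq) : len z ≤ jap z := Real.sqrt_le_sqrt (by linarith)

theorem len_neg (z : Freq) : len (-z) = len z := by simp [len]

theorem abs_cross_le (z w : Freq) : |cross z w| ≤ len z * len w := by
  refine abs_le_of_sq_le_sq ?_ (mul_nonneg (len_nonneg _) (len_nonneg _))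
  rw [mul_pow, len_sq, len_sq, cross]
  nlinarith [sq_nonneg ((z.1 : ℝ) * w.1 + z.2 * w.2)]

theorem cross_add_right (z w : Freq) : cross z (z + w) = cross z w := by
  simp [cross]; ring

theorem cross_neg_left (z w : Freq) : cross (-z) w = -cross z w := by
  simp [cross]; ring

theorem jap_add_le (z w : Freq) : jap (z + w) ≤ len z + jap w := by
  refine abs_le_of_sq_le_sq' ?_ (add_nonneg (len_nonneg _) (jap_pos _).le) |>.2
  have h : (z.1 : ℝ) * w.1 + z.2 * w.2 ≤ len z * jap w := by
    refine (le_abs_self _).trans (abs_le_of_sq_le_sq ?_ (mul_nonneg (len_nonneg _) (jap_pos _).le))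
    rw [mul_pow, len_sq, jap_sq]
    nlinarith [sq_nonneg ((z.1 : ℝ) * w.2 - z.2 * w.1), sq_nonneg (z.1 : ℝ), sq_nonneg z.2]
  have e : (len z + jap w) ^ 2 = len z ^ 2 + jap w ^ 2 + 2 * (len z * jap w) := by ring
  rw [e, jap_sq, len_sq, jap_sq]
  simp only [Prod.fst_add, Prod.snd_add, Int.cast_add]
  nlinarith

theorem abs_jap_add_sub_le (z w : Freq) : |jap (z + w) - jap w| ≤ len z := by
  rw [abs_le]
  have h := jap_add_le (-z) (z + w)
  rw [neg_add_cancel_left, len_neg] at h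
  constructor <;> linarith [jap_add_le z w]

theorem measurable_int_cast_fst : Measurable fun z : Freq => (z.1 : ℝ) :=
  (measurable_from_top (f := fun n : ℤ => (n : ℝ))).comp measurable_fst

@[fun_prop]
theorem measurable_jap : Measurable jap := by
  unfold jap
  have := measurable_int_cast_fst
  fun_prop

@[fun_prop]
theorem measurable_len : Measurable len := by
  unfold len
  have := measurable_int_cast_fst
  fun_prop

@[fun_prop]
theorem measurable_cross : Measurable fun z : Freq × Freq => cross z.1 z.2 := by
  unfold cross
  have h := measurable_int_cast_fst
  have h1 : Measurable fun z : Freq × Freq => (z.1.1 : ℝ) := h.comp measurable_fst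
  have h2 : Measurable fun z : Freq × Freq => (z.2.1 : ℝ) := h.comp measurable_snd
  fun_prop

/-- The weighted norm `‖⟨z⟩^m F‖_{L²}` of a function on frequency space. -/
def hnorm (m : ℝ) (F : Freq → ℂ) : ℝ≥0∞ :=
  l2 freqMeasure fun z => ENNReal.ofReal (jap z ^ m) * ‖F z‖ₑ

theorem hnorm_mono_exp {m m' : ℝ} (h : m ≤ m') (F : Freq → ℂ) : hnorm m F ≤ hnorm m' F :=
  l2_mono fun z => by
    gcongr
    exact one_le_jap z

theorem lintegral_jap_lt_top {r : ℝ} (hr : 2 < r) :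
    ∫⁻ z, ENNReal.ofReal (jap z ^ (-r)) ∂freqMeasure < ∞ := by
  -- `⟨(k, ξ)⟩² ≥ ⟨k⟩ ⟨ξ⟩` splits the integral into a sum over `k` and an integral over `ξ`.
  have hpt : ∀ (k : ℤ) (ξ : ℝ), jap (k, ξ) ^ (-r) ≤
      (1 + (k : ℝ) ^ 2) ^ (-(r / 2) / 2) * (1 + ‖ξ‖ ^ 2) ^ (-(r / 2) / 2) := by
    intro k ξ
    have e : jap (k, ξ) ^ (-r) = (jap (k, ξ) ^ 2 * jap (k, ξ) ^ 2) ^ (-(r / 2) / 2) := by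
      rw [← pow_add, ← Real.rpow_natCast, ← Real.rpow_mul (jap_pos _).le]
      congr 1
      push_cast
      ring
    rw [e, ← Real.mul_rpow (by positivity) (by positivity)]
    refine Real.rpow_le_rpow_of_nonpos (by positivity) ?_ (by linarith)
    rw [jap_sq, Real.norm_eq_abs, sq_abs]
    exact mul_le_mul (by nlinarith [sq_nonneg ξ]) (by nlinarith [sq_nonneg (k : ℝ)])
      (by positivity) (by positivity)
  have hξ : ∫⁻ ξ : ℝ, ENNReal.ofReal ((1 + ‖ξ‖ ^ 2) ^ (-(r / 2) / 2)) < ∞ := by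
    have hi : Integrable (fun ξ : ℝ => (1 + ‖ξ‖ ^ 2) ^ (-(r / 2) / 2)) :=
      integrable_rpow_neg_one_add_norm_sq (by simp; linarith)
    exact hi.lintegral_lt_top
  have hk : Summable fun k : ℤ => (1 + (k : ℝ) ^ 2) ^ (-(r / 2) / 2) := by
    have hs := Real.summable_abs_int_rpow (b := r / 2) (by linarith)
    refine Summable.of_norm_bounded_eventually hs ?_
    filter_upwards [eventually_cofinite_ne 0] with k hk
    have hpos : 0 < |(k : ℝ)| := by positivity
    rw [Real.norm_of_nonneg (by positivity)]
    have e : |(k : ℝ)| ^ (-(r / 2)) = (|(k : ℝ)| ^ 2) ^ (-(r / 2) / 2) := by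
      rw [← Real.rpow_natCast, ← Real.rpow_mul hpos.le]
      congr 1
      push_cast
      ring
    rw [e]
    refine Real.rpow_le_rpow_of_nonpos (by positivity) ?_ (by linarith)
    rw [sq_abs]; linarith
  rw [lintegral_freqMeasure (by fun_prop)]
  calc ∑' k : ℤ, ∫⁻ ξ : ℝ, ENNReal.ofReal (jap (k, ξ) ^ (-r))
      ≤ ∑' k : ℤ, ENNReal.ofReal ((1 + (k : ℝ) ^ 2) ^ (-(r / 2) / 2)) *
          ∫⁻ ξ : ℝ, ENNReal.ofReal ((1 + ‖ξ‖ ^ 2) ^ (-(r / 2) / 2)) := by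
        refine ENNReal.tsum_le_tsum fun k => ?_
        rw [← lintegral_const_mul' _ _ ENNReal.ofReal_ne_top]
        refine lintegral_mono fun ξ => ?_
        rw [← ENNReal.ofReal_mul (by positivity)]
        exact ENNReal.ofReal_le_ofReal (hpt k ξ)
    _ < ∞ := by
        rw [ENNReal.tsum_mul_right]
        refine ENNReal.mul_lt_top ?_ hξ
        rw [← ENNReal.ofReal_tsum_of_nonneg (fun k => by positivity) hk]
        exact ENNReal.ofReal_lt_top

/-- The norm of the embedding of `{F : ⟨z⟩^m F ∈ L²}` into `{F : ⟨z⟩ F ∈ L¹}`. -/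
def embConst (m : ℝ) : ℝ≥0∞ := l2 freqMeasure fun z => ENNReal.ofReal (jap z ^ (1 - m))

theorem embConst_lt_top {m : ℝ} (hm : 2 < m) : embConst m < ∞ := by
  unfold embConst l2
  refine ENNReal.rpow_lt_top_of_nonneg (by norm_num) (ne_of_lt ?_)
  have := lintegral_jap_lt_top (r := 2 * m - 2) (by linarith)
  refine lt_of_le_of_lt (le_of_eq (lintegral_congr fun z => ?_)) this
  rw [← ENNReal.ofReal_pow (Real.rpow_nonneg (jap_pos z).le _), ← Real.rpow_natCast,
    ← Real.rpow_mul (jap_pos z).le]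
  congr 2
  push_cast
  ring

/-- For `m > 2` the right-hand side is finite on `H^m`: the Fourier transform is integrable, with
one derivative to spare. -/
theorem lintegral_jap_mul_le (m : ℝ) {F : Freq → ℂ} (hF : Measurable F) :
    ∫⁻ z, ENNReal.ofReal (jap z) * ‖F z‖ₑ ∂freqMeasure ≤ embConst m * hnorm m F := by
  refine le_trans (le_of_eq (lintegral_congr fun z => ?_))
    (lintegral_mul_le_l2 (f := fun z => ENNReal.ofReal (jap z ^ (1 - m)))
      (g := fun z => ENNReal.ofReal (jap z ^ m) * ‖F z‖ₑ) (Measurable.aemeasurable (by fun_prop))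
      (Measurable.aemeasurable (by fun_prop)))
  rw [← mul_assoc, ← ENNReal.ofReal_mul (Real.rpow_nonneg (jap_pos z).le _),
    ← Real.rpow_add (jap_pos z)]
  simp

/-! ### The trilinear form of the transport term -/

/-- The truncated weight `min(⟨z⟩, N)^{2m}`. -/
def truncWeight (m N : ℝ) (z : Freq) : ℝ := min (jap z) N ^ (2 * m)

@[fun_prop]
theorem measurable_truncWeight (m N : ℝ) : Measurable (truncWeight m N) := by
  unfold truncWeight; fun_prop

theorem truncWeight_nonneg (m : ℝ) {N : ℝ} (hN : 0 < N) (z : Freq) : 0 ≤ truncWeight m N z :=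
  Real.rpow_nonneg (le_min (jap_pos z).le hN.le) _

theorem truncWeight_le_jap {m N : ℝ} (hm : 0 ≤ m) (hN : 0 < N) (z : Freq) :
    truncWeight m N z ≤ jap z ^ (2 * m) :=
  Real.rpow_le_rpow (le_min (jap_pos z).le hN.le) (min_le_left _ _) (by linarith)

theorem abs_truncWeight_le {m N : ℝ} (hm : 0 ≤ m) (hN : 0 < N) (z : Freq) :
    |truncWeight m N z| ≤ N ^ (2 * m) := by
  rw [abs_of_nonneg (truncWeight_nonneg m hN z)]
  exact Real.rpow_le_rpow (le_min (jap_pos z).le hN.le) (min_le_right _ _) (by linarith)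

theorem sub_rpow_min_le {A B N p : ℝ} (hB : 1 ≤ B) (hBA : B ≤ A) (hN : 0 < N) (hp : 1 ≤ p) :
    |min A N ^ p - min B N ^ p| ≤ p * A ^ (p - 1) * (A - B) := by
  have hA : 0 < A := by linarith
  have hB0 : 0 < B := by linarith
  have h1 : A ^ p - B ^ p ≤ p * A ^ (p - 1) * (A - B) := by
    have h := one_add_mul_self_le_rpow_one_add (s := B / A - 1) (p := p)
      (by have : 0 ≤ B / A := by positivity
          linarith) hp
    have e : 1 + (B / A - 1) = B / A := by ring
    rw [e, Real.div_rpow hB0.le hA.le, le_div_iff₀ (by positivity)] at h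
    have e2 : A ^ p = A ^ (p - 1) * A := by
      rw [← Real.rpow_add_one hA.ne']; simp
    have e3 : (1 + p * (B / A - 1)) * A ^ p = A ^ p - p * A ^ (p - 1) * (A - B) := by
      rw [e2]; field_simp; ring
    linarith
  refine le_trans ?_ h1
  have hmono : B ^ p ≤ A ^ p := Real.rpow_le_rpow hB0.le hBA (by linarith)
  rw [abs_of_nonneg]
  · rcases le_total A N with hAN | hAN
    · rw [min_eq_left hAN, min_eq_left (hBA.trans hAN)]
    · rcases le_total B N with hBN | hBN
      · rw [min_eq_right hAN, min_eq_left hBN]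
        have := Real.rpow_le_rpow hN.le hAN (by linarith : 0 ≤ p)
        linarith
      · rw [min_eq_right hAN, min_eq_right hBN]
        linarith
  · rw [sub_nonneg]
    exact Real.rpow_le_rpow (le_min hB0.le hN.le) (min_le_min_right _ hBA) (by linarith)

theorem rpow_sub_one_le {A B L m : ℝ} (hB : 0 ≤ B) (hL : 0 ≤ L) (hA : 0 ≤ A) (h : A ≤ B + L)
    (hm : 1 ≤ m) : A ^ (m - 1) ≤ 2 ^ (m - 1) * (B ^ (m - 1) + L ^ (m - 1)) := by
  have h1 : A ≤ 2 * max B L := by linarith [le_max_left B L, le_max_right B L]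
  have hM : 0 ≤ max B L := le_max_of_le_left hB
  calc A ^ (m - 1) ≤ (2 * max B L) ^ (m - 1) := Real.rpow_le_rpow hA h1 (by linarith)
    _ = 2 ^ (m - 1) * max B L ^ (m - 1) := Real.mul_rpow (by norm_num) hM
    _ ≤ _ := by
      gcongr
      rcases max_choice B L with e | e <;> rw [e]
      · linarith [Real.rpow_nonneg hL (m - 1)]
      · linarith [Real.rpow_nonneg hB (m - 1)]

theorem weight_difference_aux {A B L N m : ℝ} (hB : 1 ≤ B) (hBA : B ≤ A) (hL : A - B ≤ L)
    (hN : 0 < N) (hm : 1 ≤ m) :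
    |min A N ^ (2 * m) - min B N ^ (2 * m)| * B ≤
      2 * m * 2 ^ (m - 1) * (L * (A ^ m * B ^ m) + L ^ m * (A ^ m * B)) := by
  have hA : 0 < A := by linarith
  have hB0 : 0 < B := by linarith
  have hL0 : 0 ≤ L := by linarith
  have h1 := sub_rpow_min_le (p := 2 * m) hB hBA hN (by linarith)
  have h2 := rpow_sub_one_le hB0.le hL0 hA.le (by linarith) hm
  have e1 : A ^ (2 * m - 1) = A ^ m * A ^ (m - 1) := by
    rw [← Real.rpow_add hA]; congr 1; ring
  have e2 : B ^ m = B ^ (m - 1) * B := by rw [← Real.rpow_add_one hB0.ne']; simp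
  have e3 : L ^ m = L ^ (m - 1) * L := by
    rcases hm.eq_or_lt with rfl | hm'
    · simp
    · rw [← Real.rpow_add_one' hL0 (by linarith)]; simp
  calc |min A N ^ (2 * m) - min B N ^ (2 * m)| * B
      ≤ 2 * m * (A ^ m * A ^ (m - 1)) * (A - B) * B := by
        rw [← e1]; gcongr
    _ ≤ 2 * m * (A ^ m * (2 ^ (m - 1) * (B ^ (m - 1) + L ^ (m - 1)))) * L * B := by
        have : 0 ≤ A - B := by linarith
        gcongr
    _ = _ := by rw [e2, e3]; ring

/-- The commutator estimate at the level of symbols: the difference of the weights at `z + w` and at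
`w` gains a factor `|z|`, with all remaining derivatives on two of the three factors. -/
theorem abs_truncWeight_sub_mul_cross_le {m N : ℝ} (hm : 1 ≤ m) (hN : 0 < N) (z w : Freq) :
    |truncWeight m N (z + w) - truncWeight m N w| * |cross z w| ≤
      2 * m * 2 ^ (m - 1) * (len z ^ 2 * (jap (z + w) ^ m * jap w ^ m)
        + len z ^ (m + 1) * (jap (z + w) ^ m * jap w)
        + len z ^ (m + 1) * (jap (z + w) * jap w ^ m)) := by
  have hL := len_nonneg z
  have hd := abs_le.1 (abs_jap_add_sub_le z w)
  have e : len z ^ (m + 1) = len z * len z ^ m := by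
    rw [Real.rpow_add_one' hL (by linarith), mul_comm]
  have hc : 0 ≤ 2 * m * 2 ^ (m - 1) := by positivity
  have pA := (jap_pos (z + w)).le
  have pB := (jap_pos w).le
  have qA := Real.rpow_nonneg pA m
  have qB := Real.rpow_nonneg pB m
  have qL := Real.rpow_nonneg hL m
  unfold truncWeight
  rw [e]
  rcases le_total (jap w) (jap (z + w)) with h | h
  · have h1 := weight_difference_aux (one_le_jap w) h hd.2 hN hm
    have hc1 : |cross z w| ≤ len z * jap w :=
      (abs_cross_le z w).trans (by gcongr; exact len_le_jap w)
    calc _ ≤ |min (jap (z + w)) N ^ (2 * m) - min (jap w) N ^ (2 * m)| * (len z * jap w) := by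
          gcongr
      _ = len z * (|min (jap (z + w)) N ^ (2 * m) - min (jap w) N ^ (2 * m)| * jap w) := by ring
      _ ≤ _ := mul_le_mul_of_nonneg_left h1 hL
      _ ≤ _ := by
        rw [mul_left_comm]
        refine mul_le_mul_of_nonneg_left ?_ hc
        have : 0 ≤ len z * len z ^ m * (jap (z + w) * jap w ^ m) := by positivity
        nlinarith
  · have h1 := weight_difference_aux (one_le_jap (z + w)) h (L := len z) (by linarith) hN hm
    have hc1 : |cross z w| ≤ len z * jap (z + w) := by
      rw [← cross_add_right]
      exact (abs_cross_le z _).trans (by gcongr; exact len_le_jap _)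
    rw [abs_sub_comm]
    calc _ ≤ |min (jap w) N ^ (2 * m) - min (jap (z + w)) N ^ (2 * m)|
            * (len z * jap (z + w)) := by gcongr
      _ = len z * (|min (jap w) N ^ (2 * m) - min (jap (z + w)) N ^ (2 * m)|
            * jap (z + w)) := by ring
      _ ≤ _ := mul_le_mul_of_nonneg_left h1 hL
      _ ≤ _ := by
        rw [mul_left_comm]
        refine mul_le_mul_of_nonneg_left ?_ hc
        have : 0 ≤ len z * len z ^ m * (jap (z + w) ^ m * jap w) := by positivity
        nlinarith

/-- The integrand of the transport term `⟨g, ∇^⊥ψ · ∇F⟩`, where `a` is the Fourier transform of the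
stream function up to sign. -/
def transportIntegrand (g a F : Freq → ℂ) (p : Freq × Freq) : ℂ :=
  (starRingEnd ℂ) (g (p.1 + p.2)) * cross p.1 p.2 * a p.1 * F p.2

theorem measurable_transportIntegrand {g a F : Freq → ℂ} (hg : Measurable g) (ha : Measurable a)
    (hF : Measurable F) : Measurable (transportIntegrand g a F) := by
  have h1 : Measurable fun p : Freq × Freq => g (p.1 + p.2) := by fun_prop
  have h2 : Measurable fun p : Freq × Freq => (starRingEnd ℂ) (g (p.1 + p.2)) :=
    Complex.continuous_conj.measurable.comp h1
  have h3 : Measurable fun p : Freq × Freq => (cross p.1 p.2 : ℂ) :=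
    Complex.measurable_ofReal.comp measurable_cross
  unfold transportIntegrand
  fun_prop

theorem enorm_ofReal_complex (x : ℝ) : ‖(x : ℂ)‖ₑ = ENNReal.ofReal |x| := by
  rw [← ofReal_norm, Complex.norm_real, Real.norm_eq_abs]

theorem enorm_conj (z : ℂ) : ‖(starRingEnd ℂ) z‖ₑ = ‖z‖ₑ := by
  rw [← ofReal_norm, ← ofReal_norm, Complex.norm_conj]

theorem lintegral_enorm_transportIntegrand_le {g a F : Freq → ℂ} (hg : Measurable g)
    (ha : Measurable a) (hF : Measurable F) :
    ∫⁻ p, ‖transportIntegrand g a F p‖ₑ ∂freqMeasure.prod freqMeasure ≤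
      (∫⁻ z, ENNReal.ofReal (len z) * ‖a z‖ₑ ∂freqMeasure) * (hnorm 0 g * hnorm 1 F) := by
  have e : hnorm 0 g = l2 freqMeasure fun z => ‖g z‖ₑ := by simp [hnorm]
  have e' : hnorm 1 F = l2 freqMeasure fun z => ENNReal.ofReal (jap z) * ‖F z‖ₑ := by simp [hnorm]
  rw [e, e']
  refine le_trans (lintegral_mono fun p => ?_)
    (lintegral_trilinear_le_fst (f := fun z => ‖g z‖ₑ)
      (g := fun z => ENNReal.ofReal (len z) * ‖a z‖ₑ)
      (h := fun z => ENNReal.ofReal (jap z) * ‖F z‖ₑ) (by fun_prop) (by fun_prop) (by fun_prop))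
  rw [transportIntegrand, enorm_mul, enorm_mul, enorm_mul, enorm_conj, enorm_ofReal_complex]
  calc _ ≤ ‖g (p.1 + p.2)‖ₑ * ENNReal.ofReal (len p.1 * jap p.2) * ‖a p.1‖ₑ * ‖F p.2‖ₑ := by
        gcongr
        exact (abs_cross_le _ _).trans (by gcongr; exacts [len_nonneg _, len_le_jap _])
    _ = _ := by
        rw [ENNReal.ofReal_mul (len_nonneg _)]
        ring

theorem integrable_transportIntegrand {g a F : Freq → ℂ} (hg : Measurable g) (ha : Measurable a)
    (hF : Measurable F) (hg' : hnorm 0 g < ∞) (hF' : hnorm 1 F < ∞)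
    (ha' : ∫⁻ z, ENNReal.ofReal (len z) * ‖a z‖ₑ ∂freqMeasure < ∞) :
    Integrable (transportIntegrand g a F) (freqMeasure.prod freqMeasure) :=
  ⟨(measurable_transportIntegrand hg ha hF).aestronglyMeasurable,
    (lintegral_enorm_transportIntegrand_le hg ha hF).trans_lt
      (ENNReal.mul_lt_top ha' (ENNReal.mul_lt_top hg' hF'))⟩

/-- The transport term `⟨g, ∇^⊥ψ · ∇F⟩`. -/
def transport (g a F : Freq → ℂ) : ℂ :=
  ∫ p, transportIntegrand g a F p ∂freqMeasure.prod freqMeasure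

/-- Multiplication by a real weight. -/
def wmul (W : Freq → ℝ) (F : Freq → ℂ) (z : Freq) : ℂ := W z * F z

theorem hnorm_wmul_le {W : Freq → ℝ} {c : ℝ} (hWc : ∀ z, |W z| ≤ c) (m : ℝ) (F : Freq → ℂ) :
    hnorm m (wmul W F) ≤ ENNReal.ofReal c * hnorm m F := by
  unfold hnorm
  rw [← l2_const_mul ENNReal.ofReal_ne_top]
  refine l2_mono fun z => ?_
  rw [wmul, enorm_mul, enorm_ofReal_complex, mul_left_comm]
  gcongr
  exact hWc z

/-- Since the velocity is real and divergence free, only the difference of the weights enters the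
real part of the transport term. -/
theorem two_mul_re_transport_wmul {W : Freq → ℝ} {c : ℝ} {a F : Freq → ℂ} (hW : Measurable W)
    (hWc : ∀ z, |W z| ≤ c) (ha : Measurable a) (hF : Measurable F) (hF' : hnorm 1 F < ∞)
    (ha' : ∫⁻ z, ENNReal.ofReal (len z) * ‖a z‖ₑ ∂freqMeasure < ∞)
    (hreal : ∀ᵐ z ∂freqMeasure, a (-z) = (starRingEnd ℂ) (a z)) :
    2 * (transport (wmul W F) a F).re =
      (∫ p : Freq × Freq, ((W (p.1 + p.2) - W p.2 : ℝ) : ℂ) * transportIntegrand F a F p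
        ∂freqMeasure.prod freqMeasure).re := by
  have hF0 : hnorm 0 F < ∞ := (hnorm_mono_exp zero_le_one F).trans_lt hF'
  have hI := integrable_transportIntegrand hF ha hF hF0 hF' ha'
  have h1 : ∀ p, transportIntegrand (wmul W F) a F p =
      (W (p.1 + p.2) : ℂ) * transportIntegrand F a F p := by
    intro p
    simp only [transportIntegrand, wmul, map_mul, Complex.conj_ofReal]
    ring
  have hbd : ∀ (V : Freq × Freq → ℝ), Measurable V → (∀ p, |V p| ≤ c) →
      Integrable (fun p => (V p : ℂ) * transportIntegrand F a F p)
        (freqMeasure.prod freqMeasure) := by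
    intro V hV hVc
    refine hI.bdd_mul (c := c) (Complex.measurable_ofReal.comp hV).aestronglyMeasurable ?_
    filter_upwards with p
    rw [Complex.norm_real]
    exact hVc p
  have hI1 := hbd (fun p => W (p.1 + p.2)) (by fun_prop) (fun p => hWc _)
  have hI2 := hbd (fun p => W p.2) (by fun_prop) (fun p => hWc _)
  have hflip : transport (wmul W F) a F =
      -(starRingEnd ℂ) (∫ p : Freq × Freq, (W p.2 : ℂ) * transportIntegrand F a F p
        ∂freqMeasure.prod freqMeasure) := by
    have hme : MeasurableEmbedding fun z : Freq × Freq => (-z.1, z.1 + z.2) := by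
      have hm : Measurable fun z : Freq × Freq => (-z.1, z.1 + z.2) := by fun_prop
      refine MeasurableEquiv.measurableEmbedding
        { toFun := fun z : Freq × Freq => (-z.1, z.1 + z.2)
          invFun := fun z : Freq × Freq => (-z.1, z.1 + z.2)
          left_inv := fun z => by ext <;> simp
          right_inv := fun z => by ext <;> simp
          measurable_toFun := hm
          measurable_invFun := hm }
    rw [transport, ← (measurePreserving_exchange (μ := freqMeasure)).integral_comp hme,
      ← integral_conj,
      ← integral_neg]
    refine integral_congr_ae ?_
    have hr : ∀ᵐ p : Freq × Freq ∂freqMeasure.prod freqMeasure,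
        a (-p.1) = (starRingEnd ℂ) (a p.1) := Measure.quasiMeasurePreserving_fst.ae hreal
    filter_upwards [hr] with p hp
    simp only [transportIntegrand, wmul, neg_add_cancel_left, cross_neg_left, cross_add_right, hp,
      map_mul, Complex.conj_ofReal, Complex.conj_conj, Complex.ofReal_neg]
    ring
  have hre := congrArg Complex.re hflip
  rw [Complex.neg_re, Complex.conj_re] at hre
  have hre' : (transport (wmul W F) a F).re =
      (∫ p : Freq × Freq, (W (p.1 + p.2) : ℂ) * transportIntegrand F a F p
        ∂freqMeasure.prod freqMeasure).re := by
    rw [transport]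
    simp_rw [h1]
  simp_rw [Complex.ofReal_sub, sub_mul]
  rw [integral_sub hI1 hI2, Complex.sub_re]
  linarith

/-- The constant in the commutator estimate. -/
def commConst (m : ℝ) : ℝ := 2 * m * 2 ^ (m - 1) * (3 * (embConst m).toReal)

/-- The energy estimate for the transport term. The hypothesis `ha` says that the velocity gradient
`∇∇^⊥ψ` is bounded by `κ ⟨D⟩ f`. -/
theorem abs_re_transport_truncWeight_le {m N κ : ℝ} (hm : 2 < m) (hN : 0 < N) (hκ : 0 ≤ κ)
    {a f F : Freq → ℂ} (ha : Measurable a) (hf : Measurable f) (hF : Measurable F)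
    (hf' : hnorm m f < ∞) (hF' : hnorm m F < ∞)
    (ha' : ∫⁻ z, ENNReal.ofReal (len z) * ‖a z‖ₑ ∂freqMeasure < ∞)
    (hreal : ∀ᵐ z ∂freqMeasure, a (-z) = (starRingEnd ℂ) (a z))
    (hbound : ∀ z, len z ^ 2 * ‖a z‖ ≤ κ * (jap z * ‖f z‖)) :
    2 * |(transport (wmul (truncWeight m N) F) a F).re| ≤
      commConst m * κ * ((hnorm m f).toReal * (hnorm m F).toReal ^ 2) := by
  have hF1 : hnorm 1 F < ∞ := (hnorm_mono_exp (by linarith) F).trans_lt hF'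
  have h2 := two_mul_re_transport_wmul (measurable_truncWeight m N)
    (abs_truncWeight_le (by linarith) hN) ha hF hF1 ha' hreal
  set D : ℝ := 2 * m * 2 ^ (m - 1) with hD
  have hD0 : 0 ≤ D := by positivity
  -- `P m G z` is the weighted amplitude `⟨z⟩^m |G(z)|`.
  let P : ℝ → (Freq → ℂ) → Freq → ℝ≥0∞ := fun r G z => ENNReal.ofReal (jap z ^ r) * ‖G z‖ₑ
  have hP : ∀ r {G}, Measurable G → Measurable (P r G) := fun r G hG => by
    simp only [P]; fun_prop
  have hP1 : ∀ {G}, Measurable G → ∫⁻ z, P 1 G z ∂freqMeasure ≤ embConst m * hnorm m G := by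
    intro G hG
    simpa [P] using lintegral_jap_mul_le m hG
  have hpt : ∀ p : Freq × Freq,
      ‖((truncWeight m N (p.1 + p.2) - truncWeight m N p.2 : ℝ) : ℂ)
          * transportIntegrand F a F p‖ₑ ≤
        ENNReal.ofReal (D * κ) * (P m F (p.1 + p.2) * P 1 f p.1 * P m F p.2
          + P m F (p.1 + p.2) * P m f p.1 * P 1 F p.2
          + P 1 F (p.1 + p.2) * P m f p.1 * P m F p.2) := by
    intro p
    obtain ⟨z, w⟩ := p
    have hPof : ∀ r G y, P r G y = ENNReal.ofReal (jap y ^ r * ‖G y‖) := by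
      intro r G y
      simp only [P]
      rw [ENNReal.ofReal_mul (Real.rpow_nonneg (jap_pos y).le r), ofReal_norm]
    have pz := (jap_pos z).le
    have pw := (jap_pos w).le
    have ps := (jap_pos (z + w)).le
    have nn : ∀ (r : ℝ) (G : Freq → ℂ) (y : Freq), 0 ≤ jap y ^ r * ‖G y‖ := fun r G y =>
      mul_nonneg (Real.rpow_nonneg (jap_pos y).le r) (norm_nonneg _)
    simp only [hPof]
    rw [← ENNReal.ofReal_mul (nn _ _ _), ← ENNReal.ofReal_mul (by positivity),
      ← ENNReal.ofReal_mul (nn _ _ _), ← ENNReal.ofReal_mul (by positivity),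
      ← ENNReal.ofReal_mul (nn _ _ _), ← ENNReal.ofReal_mul (by positivity),
      ← ENNReal.ofReal_add (by positivity) (by positivity),
      ← ENNReal.ofReal_add (by positivity) (by positivity),
      ← ENNReal.ofReal_mul (by positivity), ← ofReal_norm]
    refine ENNReal.ofReal_le_ofReal ?_
    have hc := abs_truncWeight_sub_mul_cross_le (m := m) (by linarith) hN z w
    rw [← hD] at hc
    have hb1 := hbound z
    have hb2 : len z ^ (m + 1) * ‖a z‖ ≤ κ * (jap z ^ m * ‖f z‖) := by
      have e1 : len z ^ (m + 1) = len z ^ (m - 1) * len z ^ 2 := by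
        rw [← Real.rpow_natCast, ← Real.rpow_add' (len_nonneg z) (by push_cast; linarith)]
        congr 1
        push_cast
        ring
      have e2 : jap z ^ m = jap z ^ (m - 1) * jap z := by
        rw [← Real.rpow_add_one (jap_pos z).ne']; simp
      calc len z ^ (m + 1) * ‖a z‖ = len z ^ (m - 1) * (len z ^ 2 * ‖a z‖) := by rw [e1]; ring
        _ ≤ jap z ^ (m - 1) * (κ * (jap z * ‖f z‖)) := by
          refine mul_le_mul (Real.rpow_le_rpow (len_nonneg z) (len_le_jap z) (by linarith)) hb1
            (by positivity) (Real.rpow_nonneg pz _)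
        _ = _ := by rw [e2]; ring
    rw [norm_mul, Complex.norm_real, Real.norm_eq_abs]
    simp only [transportIntegrand, norm_mul, Complex.norm_conj, Complex.norm_real,
      Real.norm_eq_abs, Real.rpow_one]
    calc _ = (|truncWeight m N (z + w) - truncWeight m N w| * |cross z w|)
            * (‖F (z + w)‖ * ‖a z‖ * ‖F w‖) := by ring
      _ ≤ _ := mul_le_mul_of_nonneg_right hc (by positivity)
      _ = D * ((len z ^ 2 * ‖a z‖) * (jap (z + w) ^ m * ‖F (z + w)‖ * (jap w ^ m * ‖F w‖))
            + (len z ^ (m + 1) * ‖a z‖) * (jap (z + w) ^ m * ‖F (z + w)‖ * (jap w * ‖F w‖))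
            + (len z ^ (m + 1) * ‖a z‖) * (jap (z + w) * ‖F (z + w)‖ * (jap w ^ m * ‖F w‖))) := by
          ring
      _ ≤ D * ((κ * (jap z * ‖f z‖)) * (jap (z + w) ^ m * ‖F (z + w)‖ * (jap w ^ m * ‖F w‖))
            + (κ * (jap z ^ m * ‖f z‖)) * (jap (z + w) ^ m * ‖F (z + w)‖ * (jap w * ‖F w‖))
            + (κ * (jap z ^ m * ‖f z‖))
              * (jap (z + w) * ‖F (z + w)‖ * (jap w ^ m * ‖F w‖))) := by
          gcongr
      _ = _ := by ring
  have hlin : ∫⁻ p : Freq × Freq, ‖((truncWeight m N (p.1 + p.2) - truncWeight m N p.2 : ℝ) : ℂ)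
          * transportIntegrand F a F p‖ₑ ∂freqMeasure.prod freqMeasure ≤
      ENNReal.ofReal (D * κ) * (3 * (embConst m * hnorm m f * (hnorm m F * hnorm m F))) := by
    have m1 := hP 1 hF
    have m2 := hP m hF
    have m3 := hP 1 hf
    have m4 := hP m hf
    refine (lintegral_mono hpt).trans ?_
    rw [lintegral_const_mul _ (by fun_prop), lintegral_add_left (by fun_prop),
      lintegral_add_left (by fun_prop)]
    gcongr
    have t1 := lintegral_trilinear_le_fst (μ := freqMeasure) m2 m3 m2
    have t2 := lintegral_trilinear_le_snd (μ := freqMeasure) m2 m4 m1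
    have t3 := lintegral_trilinear_le_out (μ := freqMeasure) m1 m4 m2
    have eF : l2 freqMeasure (P m F) = hnorm m F := rfl
    have ef : l2 freqMeasure (P m f) = hnorm m f := rfl
    rw [eF] at t1 t2 t3
    rw [ef] at t2 t3
    have u1 : (∫⁻ z, P 1 f z ∂freqMeasure) * (hnorm m F * hnorm m F) ≤
        embConst m * hnorm m f * (hnorm m F * hnorm m F) := by gcongr; exact hP1 hf
    have u2 : (∫⁻ z, P 1 F z ∂freqMeasure) * (hnorm m F * hnorm m f) ≤
        embConst m * hnorm m f * (hnorm m F * hnorm m F) := by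
      calc _ ≤ (embConst m * hnorm m F) * (hnorm m F * hnorm m f) := by gcongr; exact hP1 hF
        _ = _ := by ring
    have u3 : (∫⁻ z, P 1 F z ∂freqMeasure) * (hnorm m f * hnorm m F) ≤
        embConst m * hnorm m f * (hnorm m F * hnorm m F) := by
      rw [mul_comm (hnorm m f)]; exact u2
    calc _ ≤ _ := add_le_add (add_le_add (t1.trans u1) (t2.trans u2)) (t3.trans u3)
      _ = _ := by ring
  have hfin : ENNReal.ofReal (D * κ) * (3 * (embConst m * hnorm m f * (hnorm m F * hnorm m F)))
      ≠ ∞ := by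
    have := embConst_lt_top hm
    finiteness
  calc 2 * |(transport (wmul (truncWeight m N) F) a F).re|
      = |2 * (transport (wmul (truncWeight m N) F) a F).re| := by rw [abs_mul]; simp
    _ ≤ _ := by
      rw [h2]
      refine (Complex.abs_re_le_norm _).trans ?_
      refine (norm_integral_le_lintegral_norm _).trans ?_
      simp_rw [ofReal_norm]
      refine (ENNReal.toReal_mono hfin hlin).trans_eq ?_
      simp only [ENNReal.toReal_mul]
      rw [ENNReal.toReal_ofReal (by positivity), commConst, ENNReal.toReal_ofNat]
      ring

/-! ### The Fourier transform on the line -/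

/-- Smooth compactly supported complex-valued functions on the line. -/
structure IsBump (p : ℝ → ℂ) : Prop where
  contDiff : ContDiff ℝ ((⊤ : ℕ∞) : WithTop ℕ∞) p
  hasCompactSupport : HasCompactSupport p

namespace IsBump

variable {p q : ℝ → ℂ}

theorem continuous (hp : IsBump p) : Continuous p := hp.contDiff.continuous

theorem differentiable (hp : IsBump p) : Differentiable ℝ p :=
  hp.contDiff.differentiable (by simp)

/-- A bump function as a Schwartz function. -/
def toSchwartz (hp : IsBump p) : SchwartzMap ℝ ℂ :=
  hp.hasCompactSupport.toSchwartzMap hp.contDiff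

theorem coe_toSchwartz (hp : IsBump p) : ⇑hp.toSchwartz = p := rfl

theorem integrable (hp : IsBump p) : Integrable p :=
  hp.continuous.integrable_of_hasCompactSupport hp.hasCompactSupport

theorem memLp (hp : IsBump p) (r : ℝ≥0∞) : MemLp p r :=
  hp.continuous.memLp_of_hasCompactSupport hp.hasCompactSupport

theorem integrable_fourier (hp : IsBump p) : Integrable (𝓕 p) := by
  have := (𝓕 hp.toSchwartz).integrable (μ := volume)
  rwa [SchwartzMap.fourier_coe, coe_toSchwartz] at this

theorem memLp_fourier (hp : IsBump p) : MemLp (𝓕 p) 2 := by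
  have := (𝓕 hp.toSchwartz).memLp 2 (μ := volume)
  rwa [SchwartzMap.fourier_coe, coe_toSchwartz] at this

theorem continuous_fourier (hp : IsBump p) : Continuous (𝓕 p) := by
  have := (𝓕 hp.toSchwartz).continuous
  rwa [SchwartzMap.fourier_coe, coe_toSchwartz] at this

theorem deriv (hp : IsBump p) : IsBump (deriv p) :=
  ⟨by
    have := hp.contDiff
    rw [show ((⊤ : ℕ∞) : WithTop ℕ∞) = ((⊤ : ℕ∞) : WithTop ℕ∞) + 1 by rfl,
      contDiff_succ_iff_deriv] at this
    exact this.2.2, hp.hasCompactSupport.deriv⟩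

theorem smooth_mul (hp : IsBump p) (hq : ContDiff ℝ ((⊤ : ℕ∞) : WithTop ℕ∞) q) :
    IsBump (fun y => q y * p y) :=
  ⟨hq.mul hp.contDiff, hp.hasCompactSupport.mul_left⟩

theorem const_mul (hp : IsBump p) (c : ℂ) : IsBump (fun y => c * p y) :=
  hp.smooth_mul contDiff_const

theorem add (hp : IsBump p) (hq : IsBump q) : IsBump (fun y => p y + q y) :=
  ⟨hp.contDiff.add hq.contDiff, hp.hasCompactSupport.add hq.hasCompactSupport⟩

theorem conj (hp : IsBump p) : IsBump (fun y => (starRingEnd ℂ) (p y)) :=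
  ⟨Complex.conjCLE.contDiff.comp hp.contDiff,
    hp.hasCompactSupport.comp_left (g := starRingEnd ℂ) (map_zero _)⟩

theorem fourier_deriv (hp : IsBump p) (ξ : ℝ) :
    𝓕 (_root_.deriv p) ξ = 2 * Real.pi * Complex.I * ξ * 𝓕 p ξ := by
  rw [Real.fourier_deriv hp.integrable hp.differentiable hp.deriv.integrable]
  simp

end IsBump

theorem isBump_ofReal {g : ℝ → ℝ} (hg : ContDiff ℝ ((⊤ : ℕ∞) : WithTop ℕ∞) g)
    (hg' : HasCompactSupport g) : IsBump (fun y => (g y : ℂ)) :=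
  ⟨Complex.ofRealCLM.contDiff.comp hg, hg'.comp_left (g := fun x : ℝ => (x : ℂ)) (by simp)⟩

theorem fourier_conj (f : ℝ → ℂ) (ξ : ℝ) :
    𝓕 (fun y => (starRingEnd ℂ) (f y)) ξ = (starRingEnd ℂ) (𝓕 f (-ξ)) := by
  rw [Real.fourier_real_eq, Real.fourier_real_eq, ← integral_conj]
  congr 1
  ext y
  simp only [Circle.smul_def, smul_eq_mul, map_mul, mul_neg, neg_neg]
  rw [← Circle.coe_inv_eq_conj, ← AddChar.map_neg_eq_inv]

/-- Modulation by `e^{-icy}` shifts the Fourier transform. -/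
theorem fourier_modulate (f : ℝ → ℂ) (c ξ : ℝ) :
    𝓕 (fun y : ℝ => Complex.exp (-(c * y * Complex.I)) * f y) ξ = 𝓕 f (ξ + c / (2 * Real.pi)) := by
  rw [Real.fourier_real_eq_integral_exp_smul, Real.fourier_real_eq_integral_exp_smul]
  congr 1
  ext y
  rw [smul_eq_mul, smul_eq_mul, ← mul_assoc, ← Complex.exp_add]
  congr 2
  push_cast
  have : (Real.pi : ℂ) ≠ 0 := by exact_mod_cast Real.pi_ne_zero
  field_simp
  ring

theorem inner_toLp {α : Type*} [MeasurableSpace α] {μ : Measure α} {p : α → ℂ} (hp : MemLp p 2 μ)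
    (f : Lp ℂ 2 μ) : inner ℂ (hp.toLp p) f = ∫ y, (starRingEnd ℂ) (p y) * f y ∂μ := by
  rw [L2.inner_def]
  refine integral_congr_ae ?_
  filter_upwards [hp.coeFn_toLp] with y hy
  rw [hy, RCLike.inner_apply, mul_comm]

/-- On `L¹ ∩ L²` the `L²` Fourier transform is given by the Fourier integral. -/
theorem fourier_toLp_ae {f : ℝ → ℂ} (h1 : Integrable f) (h2 : MemLp f 2) :
    (𝓕 (h2.toLp f) : Lp ℂ 2 (volume : Measure ℝ)) =ᵐ[volume] 𝓕 f := by
  set v : Lp ℂ 2 (volume : Measure ℝ) := 𝓕 (h2.toLp f) with hv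
  have hc : Continuous (𝓕 f) :=
    VectorFourier.fourierIntegral_continuous Real.continuous_fourierChar
      (by exact continuous_inner) h1
  have hvl : LocallyIntegrable v := (Lp.memLp v).locallyIntegrable (by norm_num)
  have key : ∀ᵐ ξ, v ξ - 𝓕 f ξ = 0 := by
    refine ae_eq_zero_of_integral_contDiff_smul_eq_zero (hvl.sub hc.locallyIntegrable) ?_
    intro g hg hg'
    have hp := isBump_ofReal hg hg'
    set p : ℝ → ℂ := fun y => (g y : ℂ) with hpdef
    have hconj : ∀ y, (starRingEnd ℂ) (p y) = p y := fun y => Complex.conj_ofReal _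
    have i1 : Integrable (fun ξ => g ξ • v ξ) := by
      have := hvl.integrable_smul_left_of_hasCompactSupport hg.continuous hg'
      exact this
    have i2 : Integrable (fun ξ => g ξ • 𝓕 f ξ) :=
      hc.locallyIntegrable.integrable_smul_left_of_hasCompactSupport hg.continuous hg'
    have e1 : ∫ ξ, g ξ • 𝓕 f ξ = ∫ y, 𝓕 p y * f y := by
      have := VectorFourier.integral_fourierIntegral_smul_eq_flip (μ := volume) (ν := volume)
        (L := innerₗ ℝ) (f := p) (g := f) Real.continuous_fourierChar
        (by exact continuous_inner) hp.integrable h1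
      rw [flip_innerₗ] at this
      exact this.symm
    have e2 : ∫ ξ, g ξ • v ξ = ∫ y, 𝓕 p y * f y := by
      have h3 : inner ℂ ((hp.memLp 2).toLp p) v = ∫ ξ, g ξ • v ξ := by
        rw [inner_toLp]
        refine integral_congr_ae (Eventually.of_forall fun ξ => ?_)
        simp only [hconj]
        rfl
      have h4 : (hp.memLp 2).toLp p = 𝓕 (𝓕⁻ (hp.toSchwartz.toLp 2)) := by
        rw [FourierTransform.fourier_fourierInv_eq]
        rfl
      rw [← h3, h4, hv, Lp.inner_fourier_eq, SchwartzMap.toLp_fourierInv_eq, L2.inner_def]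
      refine integral_congr_ae ?_
      filter_upwards [h2.coeFn_toLp, SchwartzMap.coeFn_toLp (𝓕⁻ hp.toSchwartz) 2] with y hy1 hy2
      rw [hy1, hy2, SchwartzMap.fourierInv_coe, RCLike.inner_apply, mul_comm, hp.coe_toSchwartz,
        Real.fourierInv_eq_fourier_neg]
      congr 1
      rw [← fourier_conj]
      simp_rw [hconj]
    simp_rw [smul_sub]
    rw [integral_sub i1 i2, e1, e2, sub_self]
  filter_upwards [key] with ξ h
  exact sub_eq_zero.1 h

/-- Plancherel's formula against an `L¹ ∩ L²` function. -/
theorem integral_conj_mul_eq_fourier {p : ℝ → ℂ} (h1 : Integrable p) (h2 : MemLp p 2)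
    (f : Lp ℂ 2 (volume : Measure ℝ)) :
    ∫ y, (starRingEnd ℂ) (p y) * f y = ∫ ξ, (starRingEnd ℂ) (𝓕 p ξ) * (𝓕 f) ξ := by
  rw [← inner_toLp h2, ← Lp.inner_fourier_eq, L2.inner_def]
  refine integral_congr_ae ?_
  filter_upwards [fourier_toLp_ae h1 h2] with ξ h
  rw [h, RCLike.inner_apply, mul_comm]

theorem ae_eq_zero_of_integral_bump {f : ℝ → ℂ} (hf : LocallyIntegrable f)
    (h : ∀ p : ℝ → ℂ, IsBump p → (∫ y, (starRingEnd ℂ) (p y) * f y).re = 0) :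
    ∀ᵐ y, f y = 0 := by
  refine ae_eq_zero_of_integral_contDiff_smul_eq_zero hf fun g hg hg' => ?_
  have hp := isBump_ofReal hg hg'
  have h1 := h _ hp
  have h2 := h _ (hp.const_mul Complex.I)
  simp only [map_mul, Complex.conj_ofReal, Complex.conj_I, mul_assoc] at h1 h2
  rw [integral_const_mul] at h2
  simp only [Complex.real_smul]
  apply Complex.ext
  · exact h1
  · simpa using h2

theorem memLp_conj {α : Type*} [MeasurableSpace α] {μ : Measure α} {f : α → ℂ} {r : ℝ≥0∞}
    (hf : MemLp f r μ) : MemLp (fun y => (starRingEnd ℂ) (f y)) r μ :=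
  hf.congr_norm (Complex.continuous_conj.comp_aestronglyMeasurable hf.1)
    (Eventually.of_forall fun _ => (Complex.norm_conj _).symm)

theorem integral_comp_two_pi_mul (f : ℝ → ℂ) :
    ∫ ξ, f (ξ / (2 * Real.pi)) = (2 * Real.pi : ℝ) * ∫ ξ, f ξ := by
  rw [Measure.integral_comp_div, abs_of_pos Real.two_pi_pos, Complex.real_smul]

/-- A function in `L²` is determined by its pairings with Fourier transforms of bump functions. -/
theorem ae_eq_zero_of_integral_fourier_bump {v : ℝ → ℂ} (hv : MemLp v 2)
    (h : ∀ p : ℝ → ℂ, IsBump p → (∫ ξ, (starRingEnd ℂ) (𝓕 p ξ) * v ξ).re = 0) :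
    ∀ᵐ ξ, v ξ = 0 := by
  set w : Lp ℂ 2 (volume : Measure ℝ) := 𝓕⁻ (hv.toLp v) with hw
  have hw0 : ∀ᵐ y, w y = 0 := by
    refine ae_eq_zero_of_integral_bump ((Lp.memLp w).locallyIntegrable (by norm_num)) fun p hp => ?_
    rw [integral_conj_mul_eq_fourier hp.integrable (hp.memLp 2), hw,
      FourierTransform.fourier_fourierInv_eq, ← h p hp]
    congr 1
    refine integral_congr_ae ?_
    filter_upwards [hv.coeFn_toLp] with ξ hξ
    rw [hξ]
  have hz : w = 0 := by
    rw [Lp.eq_zero_iff_ae_eq_zero]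
    exact hw0
  have h0 : hv.toLp v = 0 := by
    have h1 : (𝓕 w : Lp ℂ 2 (volume : Measure ℝ)) = hv.toLp v :=
      FourierTransform.fourier_fourierInv_eq _
    rw [← h1, hz]
    exact map_zero (Lp.fourierTransformₗᵢ ℝ ℂ)
  have := hv.coeFn_toLp
  rw [h0] at this
  filter_upwards [this, Lp.coeFn_zero ℂ 2 (volume : Measure ℝ)] with ξ h1 h2
  rw [← h1, h2]
  rfl

theorem fourier_L2_conj {f : ℝ → ℂ} (hf : MemLp f 2) :
    ∀ᵐ ξ, (𝓕 ((memLp_conj hf).toLp _) : Lp ℂ 2 (volume : Measure ℝ)) ξ =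
      (starRingEnd ℂ) ((𝓕 (hf.toLp f) : Lp ℂ 2 (volume : Measure ℝ)) (-ξ)) := by
  set u : Lp ℂ 2 (volume : Measure ℝ) := 𝓕 ((memLp_conj hf).toLp _) with hu
  set w : Lp ℂ 2 (volume : Measure ℝ) := 𝓕 (hf.toLp f) with hw
  have hw' : MemLp (fun ξ => (starRingEnd ℂ) (w (-ξ))) 2 :=
    memLp_conj ((Lp.memLp w).comp_measurePreserving (Measure.measurePreserving_neg volume))
  have := ae_eq_zero_of_integral_fourier_bump ((Lp.memLp u).sub hw') fun p hp => ?_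
  · filter_upwards [this] with ξ h
    exact sub_eq_zero.1 h
  · simp only [Pi.sub_apply, mul_sub]
    rw [integral_sub]
    · rw [hu, ← integral_conj_mul_eq_fourier hp.integrable (hp.memLp 2)]
      have e1 : ∫ y, (starRingEnd ℂ) (p y) *
          ((memLp_conj hf).toLp _ : Lp ℂ 2 (volume : Measure ℝ)) y
          = (starRingEnd ℂ) (∫ y, (starRingEnd ℂ) ((starRingEnd ℂ) (p y)) * (hf.toLp f) y) := by
        rw [← integral_conj]
        refine integral_congr_ae ?_
        filter_upwards [(memLp_conj hf).coeFn_toLp, hf.coeFn_toLp] with y h1 h2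
        rw [h1, h2]
        simp
      rw [e1, integral_conj_mul_eq_fourier hp.conj.integrable (hp.conj.memLp 2), ← hw,
        ← integral_conj, ← integral_neg_eq_self, sub_eq_zero.2, Complex.zero_re]
      refine integral_congr_ae (Eventually.of_forall fun ξ => ?_)
      simp only [fourier_conj, neg_neg, map_mul, Complex.conj_conj]
    · exact (memLp_conj hp.memLp_fourier).integrable_mul (Lp.memLp u)
    · exact (memLp_conj hp.memLp_fourier).integrable_mul hw'

/-- The Fourier transform of a product, paired with a bump function. -/
theorem integral_mul_conj_bump {p : ℝ → ℂ} (hp : IsBump p) (f h : Lp ℂ 2 (volume : Measure ℝ)) :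
    Integrable (fun z : ℝ × ℝ => (starRingEnd ℂ) (𝓕 p (z.1 + z.2)) * (𝓕 f) z.1 * (𝓕 h) z.2) ∧
    ∫ y, f y * h y * (starRingEnd ℂ) (p y) =
      ∫ z : ℝ × ℝ, (starRingEnd ℂ) (𝓕 p (z.1 + z.2)) * (𝓕 f) z.1 * (𝓕 h) z.2 := by
  have mf : Measurable (𝓕 f : Lp ℂ 2 (volume : Measure ℝ)) := (Lp.stronglyMeasurable _).measurable
  have mh : Measurable (𝓕 h : Lp ℂ 2 (volume : Measure ℝ)) := (Lp.stronglyMeasurable _).measurable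
  have mp : Measurable (𝓕 p) := hp.continuous_fourier.measurable
  have hint : Integrable
      (fun z : ℝ × ℝ => (starRingEnd ℂ) (𝓕 p (z.1 + z.2)) * (𝓕 f) z.1 * (𝓕 h) z.2) := by
    refine ⟨?_, ?_⟩
    · have : Measurable fun z : ℝ × ℝ => (starRingEnd ℂ) (𝓕 p (z.1 + z.2)) :=
        Complex.continuous_conj.measurable.comp (mp.comp (by fun_prop))
      exact Measurable.aestronglyMeasurable (by fun_prop)
    · rw [HasFiniteIntegral]
      simp_rw [enorm_mul, enorm_conj]
      refine lt_of_le_of_lt (lintegral_trilinear_le_out (μ := (volume : Measure ℝ))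
        (f := fun x => ‖𝓕 p x‖ₑ) (g := fun x => ‖(𝓕 f) x‖ₑ) (h := fun x => ‖(𝓕 h) x‖ₑ)
        (by fun_prop) (by fun_prop) (by fun_prop)) ?_
      rw [l2_enorm_eq_eLpNorm, l2_enorm_eq_eLpNorm]
      exact ENNReal.mul_lt_top hp.integrable_fourier.2
        (ENNReal.mul_lt_top (Lp.eLpNorm_lt_top _) (Lp.eLpNorm_lt_top _))
  refine ⟨hint, ?_⟩
  -- `conj h * p` is both integrable and square integrable.
  set w : ℝ → ℂ := fun y => (starRingEnd ℂ) (h y) * p y with hw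
  have w1 : Integrable w := (memLp_conj (Lp.memLp h)).integrable_mul (hp.memLp 2)
  have w2 : MemLp w 2 := (hp.memLp ∞).mul (memLp_conj (Lp.memLp h)) (p := 2)
  have hwF : ∀ η, (starRingEnd ℂ) (𝓕 w η) = ∫ ξ, (starRingEnd ℂ) (𝓕 p (η + ξ)) * (𝓕 h) ξ := by
    intro η
    set c : ℝ := 2 * Real.pi * η with hc
    have hq : IsBump (fun y : ℝ => Complex.exp (-(c * y * Complex.I)) * p y) := by
      refine hp.smooth_mul (q := fun y : ℝ => Complex.exp (-(c * y * Complex.I))) ?_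
      have : ContDiff ℝ ((⊤ : ℕ∞) : WithTop ℕ∞) (fun y : ℝ => (y : ℂ)) :=
        Complex.ofRealCLM.contDiff
      fun_prop
    have hcη : c / (2 * Real.pi) = η := by
      rw [hc]; field_simp
    have := integral_conj_mul_eq_fourier hq.integrable (hq.memLp 2) h
    simp_rw [fourier_modulate, hcη] at this
    rw [Real.fourier_real_eq_integral_exp_smul, ← integral_conj]
    simp_rw [add_comm η]
    rw [← this]
    refine integral_congr_ae (Eventually.of_forall fun y => ?_)
    simp only [hw, smul_eq_mul, map_mul, Complex.conj_conj]
    have e : Complex.exp (((-2 * Real.pi * y * η : ℝ) : ℂ) * Complex.I)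
        = Complex.exp (-(c * y * Complex.I)) := by
      congr 1; rw [hc]; push_cast; ring
    rw [e]
    ring
  calc ∫ y, f y * h y * (starRingEnd ℂ) (p y)
      = ∫ y, (starRingEnd ℂ) (w y) * f y := by
        refine integral_congr_ae (Eventually.of_forall fun y => ?_)
        simp only [hw, map_mul, Complex.conj_conj]
        ring
    _ = ∫ η, (starRingEnd ℂ) (𝓕 w η) * (𝓕 f) η := integral_conj_mul_eq_fourier w1 w2 f
    _ = _ := by
        rw [Measure.volume_eq_prod, integral_prod _ hint]
        refine integral_congr_ae (Eventually.of_forall fun η => ?_)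
        simp only [hwF]
        rw [← integral_mul_const]
        refine integral_congr_ae (Eventually.of_forall fun ξ => ?_)
        ring

/-! ### Weak differentiability in Hilbert space -/

section

variable {H : Type*} [NormedAddCommGroup H] [InnerProductSpace ℝ H]

/-- If `⟨g, u(t)⟩` is differentiable for `g` in a total set `S`, with derivatives given by uniformly
bounded functionals `Λ t`, then `u` is Lipschitz and the same holds for all `g`. -/
theorem hasDerivWithinAt_inner_of_dense {T B : ℝ} (hB0 : 0 ≤ B) {u : ℝ → H} {Λ : ℝ → H → ℝ}
    {S : Set H}
    (hadd : ∀ s ∈ Icc 0 T, ∀ g g', Λ s (g + g') = Λ s g + Λ s g')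
    (hsmul : ∀ s ∈ Icc 0 T, ∀ (c : ℝ) g, Λ s (c • g) = c * Λ s g)
    (hB : ∀ s ∈ Icc 0 T, ∀ g, |Λ s g| ≤ B * ‖g‖)
    (hS : (Submodule.span ℝ S).topologicalClosure = ⊤)
    (hd : ∀ g ∈ S, ∀ s ∈ Icc 0 T,
      HasDerivWithinAt (fun r => inner ℝ g (u r)) (Λ s g) (Icc 0 T) s) :
    (∀ s ∈ Icc 0 T, ∀ t ∈ Icc 0 T, ‖u t - u s‖ ≤ B * |t - s|) ∧
    ∀ g, ∀ s ∈ Icc 0 T, HasDerivWithinAt (fun r => inner ℝ g (u r)) (Λ s g) (Icc 0 T) s := by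
  have hspan : ∀ g ∈ Submodule.span ℝ S, ∀ s ∈ Icc 0 T,
      HasDerivWithinAt (fun r => inner ℝ g (u r)) (Λ s g) (Icc 0 T) s := by
    intro g hg
    induction hg using Submodule.span_induction with
    | mem g hg => exact hd g hg
    | zero =>
      intro s hs
      have : Λ s 0 = 0 := by simpa using hsmul s hs 0 0
      simpa [this] using hasDerivWithinAt_const s (Icc 0 T) (0 : ℝ)
    | add g g' _ _ h h' =>
      intro s hs
      simp_rw [inner_add_left]
      rw [hadd s hs]
      exact (h s hs).add (h' s hs)
    | smul c g _ h =>
      intro s hs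
      simp_rw [real_inner_smul_left]
      rw [hsmul s hs]
      exact (h s hs).const_mul c
  have hdense : Dense (Submodule.span ℝ S : Set H) :=
    Submodule.dense_iff_topologicalClosure_eq_top.2 hS
  have hlip : ∀ s ∈ Icc 0 T, ∀ t ∈ Icc 0 T, ∀ g, |inner ℝ g (u t - u s)| ≤ B * ‖g‖ * |t - s| := by
    intro s hs t ht g
    have hclosed : IsClosed {g : H | |inner ℝ g (u t - u s)| ≤ B * ‖g‖ * |t - s|} :=
      isClosed_le (by fun_prop) (by fun_prop)
    refine hdense.induction (P := fun g => |inner ℝ g (u t - u s)| ≤ B * ‖g‖ * |t - s|)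
      (fun g hg => ?_) hclosed g
    have := (convex_Icc 0 T).norm_image_sub_le_of_norm_hasDerivWithin_le
      (f := fun r => inner ℝ g (u r)) (C := B * ‖g‖) (hspan g hg)
      (fun r hr => hB r hr g) hs ht
    simpa [inner_sub_right] using this
  have hlip' : ∀ s ∈ Icc 0 T, ∀ t ∈ Icc 0 T, ‖u t - u s‖ ≤ B * |t - s| := by
    intro s hs t ht
    have h := hlip s hs t ht (u t - u s)
    rw [real_inner_self_eq_norm_sq, abs_of_nonneg (by positivity)] at h
    rcases (norm_nonneg (u t - u s)).eq_or_lt with h0 | h0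
    · rw [← h0]
      positivity
    · have : ‖u t - u s‖ * ‖u t - u s‖ ≤ (B * |t - s|) * ‖u t - u s‖ := by nlinarith
      exact le_of_mul_le_mul_right this h0
  refine ⟨hlip', fun g s hs => ?_⟩
  rw [hasDerivWithinAt_iff_isLittleO, Asymptotics.isLittleO_iff]
  intro c hc
  have hc' : 0 < c / (2 * (2 * B + 1)) := by positivity
  obtain ⟨g', hg', hgg'⟩ := Metric.dense_iff.1 hdense g _ hc'
  have hg'd : ‖g - g'‖ < c / (2 * (2 * B + 1)) := by
    rw [← dist_eq_norm, dist_comm]; exact hg'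
  have h' := (hasDerivWithinAt_iff_isLittleO.1 (hspan g' hgg' s hs))
  rw [Asymptotics.isLittleO_iff] at h'
  filter_upwards [h' (half_pos hc), self_mem_nhdsWithin] with r hr hrI
  have e : inner ℝ g (u r) - inner ℝ g (u s) - (r - s) • Λ s g =
      (inner ℝ g' (u r) - inner ℝ g' (u s) - (r - s) • Λ s g') +
      (inner ℝ (g - g') (u r - u s) - (r - s) * Λ s (g - g')) := by
    have h1 : Λ s g = Λ s g' + Λ s (g - g') := by rw [← hadd s hs]; simp
    rw [h1]
    simp only [inner_sub_left, inner_sub_right, smul_eq_mul]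
    ring
  have b1 : |inner ℝ (g - g') (u r - u s)| ≤ ‖g - g'‖ * (B * |r - s|) :=
    (abs_real_inner_le_norm _ _).trans (by gcongr; exact hlip' s hs r hrI)
  have b2 : |(r - s) * Λ s (g - g')| ≤ |r - s| * (B * ‖g - g'‖) := by
    rw [abs_mul]; gcongr; exact hB s hs _
  have b3 : ‖g - g'‖ * (2 * B + 1) ≤ c / 2 := by
    rw [lt_div_iff₀ (by positivity)] at hg'd
    linarith
  rw [e]
  refine (norm_add_le _ _).trans ?_
  have b4 : ‖inner ℝ (g - g') (u r - u s) - (r - s) * Λ s (g - g')‖ ≤ c / 2 * |r - s| := by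
    rw [Real.norm_eq_abs]
    refine (abs_sub _ _).trans ?_
    calc _ ≤ ‖g - g'‖ * (B * |r - s|) + |r - s| * (B * ‖g - g'‖) := add_le_add b1 b2
      _ = ‖g - g'‖ * (2 * B) * |r - s| := by ring
      _ ≤ ‖g - g'‖ * (2 * B + 1) * |r - s| := by gcongr; linarith
      _ ≤ _ := by gcongr
  rw [Real.norm_eq_abs (r - s)] at hr ⊢
  linarith

/-- The energy identity: if `v = A u` for a bounded symmetric operator `A`, then
`d/dt ⟨v, u⟩ = 2 ⟨v, u'⟩`. -/
theorem hasDerivWithinAt_inner_self {T B c : ℝ} {u v : ℝ → H} {Λ : ℝ → H → ℝ}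
    (hlip : ∀ s ∈ Icc 0 T, ∀ t ∈ Icc 0 T, ‖u t - u s‖ ≤ B * |t - s|)
    (hd : ∀ g, ∀ s ∈ Icc 0 T, HasDerivWithinAt (fun r => inner ℝ g (u r)) (Λ s g) (Icc 0 T) s)
    (hsymm : ∀ r s, inner ℝ (v r) (u s) = inner ℝ (u r) (v s))
    (hbd : ∀ r s, ‖v r - v s‖ ≤ c * ‖u r - u s‖) :
    ∀ s ∈ Icc 0 T,
      HasDerivWithinAt (fun r => inner ℝ (v r) (u r)) (2 * Λ s (v s)) (Icc 0 T) s := by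
  intro s hs
  have hq : HasDerivWithinAt (fun r => inner ℝ (v r - v s) (u r - u s)) 0 (Icc 0 T) s := by
    rw [hasDerivWithinAt_iff_isLittleO]
    have : (fun r => (r - s) ^ 2) =o[𝓝[Icc 0 T] s] fun r => r - s := by
      have h1 : (fun r => r - s) =o[𝓝[Icc 0 T] s] fun _ => (1 : ℝ) := by
        rw [Asymptotics.isLittleO_one_iff]
        have : Tendsto (fun r => r - s) (𝓝 s) (𝓝 (s - s)) := tendsto_id.sub_const s
        rw [sub_self] at this
        exact this.mono_left nhdsWithin_le_nhds
      simpa [sq] using h1.mul_isBigO (Asymptotics.isBigO_refl (fun r => r - s) _)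
    refine Asymptotics.IsBigO.trans_isLittleO (Asymptotics.IsBigO.of_bound (|c| * B ^ 2) ?_) this
    filter_upwards [self_mem_nhdsWithin] with r hr
    have h1 := hlip s hs r hr
    simp only [sub_self, inner_zero_right, smul_zero, sub_zero]
    rw [Real.norm_eq_abs, Real.norm_eq_abs, abs_pow]
    calc |inner ℝ (v r - v s) (u r - u s)| ≤ ‖v r - v s‖ * ‖u r - u s‖ :=
          abs_real_inner_le_norm _ _
      _ ≤ (|c| * ‖u r - u s‖) * ‖u r - u s‖ := by
          gcongr
          exact (hbd r s).trans (by gcongr; exact le_abs_self c)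
      _ ≤ (|c| * (B * |r - s|)) * (B * |r - s|) := by
          have : 0 ≤ B * |r - s| := (norm_nonneg _).trans h1
          gcongr
      _ = _ := by ring
  have h2 := ((hd (v s) s hs).const_mul 2).add hq
  rw [add_zero] at h2
  have h3 := h2.sub_const (inner ℝ (v s) (u s))
  refine h3.congr_of_mem (fun r _ => ?_) hs
  have e1 := hsymm r s
  have e2 := real_inner_comm (u r) (v s)
  simp only [Pi.add_apply, inner_sub_left, inner_sub_right]
  linarith

end

/-! ### Test functions in frequency space -/

/-- The Fourier transform of `e^{ikx} p(y)`. -/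
def testFn (k : ℤ) (p : ℝ → ℂ) (z : Freq) : ℂ :=
  if z.1 = k then 𝓕 p (z.2 / (2 * Real.pi)) else 0

theorem freqMeasure_restrict_fiber (k : ℤ) :
    freqMeasure.restrict ({k} ×ˢ univ) = (volume : Measure ℝ).map (Prod.mk k) := by
  rw [← Measure.prod_restrict, Measure.restrict_univ, Measure.restrict_singleton]
  simp [Measure.dirac_prod]

theorem measurable_testFn (k : ℤ) {p : ℝ → ℂ} (hp : IsBump p) : Measurable (testFn k p) := by
  refine Measurable.ite (measurable_fst (measurableSet_singleton k)) ?_ measurable_const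
  exact hp.continuous_fourier.measurable.comp (by fun_prop)

theorem integral_fiber (k : ℤ) {f : Freq → ℂ} (hf : ∀ z, z.1 ≠ k → f z = 0) :
    ∫ z, f z ∂freqMeasure = ∫ ξ, f (k, ξ) := by
  rw [← setIntegral_eq_integral_of_forall_compl_eq_zero (s := {k} ×ˢ univ),
    freqMeasure_restrict_fiber, (measurableEmbedding_prodMk_left k).integral_map]
  intro z hz
  exact hf z (by simpa using hz)

theorem lintegral_fiber (k : ℤ) {f : Freq → ℝ≥0∞} (hf : ∀ z, z.1 ≠ k → f z = 0) :
    ∫⁻ z, f z ∂freqMeasure = ∫⁻ ξ, f (k, ξ) := by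
  rw [← setLIntegral_eq_of_support_subset (s := {k} ×ˢ univ),
    freqMeasure_restrict_fiber, (measurableEmbedding_prodMk_left k).lintegral_map]
  intro z hz
  by_contra h
  exact hz (hf z (by simpa using h))

theorem memLp_fiber {F : Freq → ℂ} {r : ℝ≥0∞} (hF : MemLp F r freqMeasure) (k : ℤ) :
    MemLp (fun ξ => F (k, ξ)) r := by
  have h := hF.restrict ({k} ×ˢ univ)
  rw [freqMeasure_restrict_fiber] at h
  exact ((measurableEmbedding_prodMk_left k).memLp_map_measure_iff).1 h

theorem ae_of_ae_fiber {P : Freq → Prop} (h : ∀ k : ℤ, ∀ᵐ ξ : ℝ, P (k, ξ)) :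
    ∀ᵐ z ∂freqMeasure, P z := by
  have h1 : ∀ k : ℤ, ∀ᵐ z ∂freqMeasure, z.1 = k → P z := by
    intro k
    have : ∀ᵐ z ∂(volume : Measure ℝ).map (Prod.mk k), P z :=
      (measurableEmbedding_prodMk_left k).ae_map_iff.2 (h k)
    rw [← freqMeasure_restrict_fiber,
      ae_restrict_iff' (measurableSet_singleton k |>.prod .univ)] at this
    filter_upwards [this] with z hz hk
    exact hz (by simpa using hk)
  filter_upwards [ae_all_iff.2 h1] with z hz
  exact hz z.1 rfl

theorem memLp_comp_div {f : ℝ → ℂ} {r : ℝ≥0∞} (hf : MemLp f r) :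
    MemLp (fun ξ => f (ξ / (2 * Real.pi))) r := by
  have hc : (2 * Real.pi)⁻¹ ≠ 0 := by positivity
  have h1 : MemLp f r ((volume : Measure ℝ).map fun ξ => (2 * Real.pi)⁻¹ * ξ) := by
    rw [Real.map_volume_mul_left hc]
    exact hf.smul_measure ENNReal.ofReal_ne_top
  have := h1.comp_of_map (by fun_prop)
  refine this.ae_eq (Eventually.of_forall fun ξ => ?_)
  simp [div_eq_inv_mul]

theorem memLp_comp_mul {f : ℝ → ℂ} {r : ℝ≥0∞} (hf : MemLp f r) :
    MemLp (fun ξ => f (2 * Real.pi * ξ)) r := by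
  have h1 : MemLp f r ((volume : Measure ℝ).map fun ξ => 2 * Real.pi * ξ) := by
    rw [Real.map_volume_mul_left (by positivity)]
    exact hf.smul_measure ENNReal.ofReal_ne_top
  exact h1.comp_of_map (by fun_prop)

theorem hnorm_zero_eq_eLpNorm (F : Freq → ℂ) : hnorm 0 F = eLpNorm F 2 freqMeasure := by
  rw [← l2_enorm_eq_eLpNorm]; simp [hnorm]

theorem memLp_testFn (k : ℤ) {p : ℝ → ℂ} (hp : IsBump p) : MemLp (testFn k p) 2 freqMeasure := by
  refine ⟨(measurable_testFn k hp).aestronglyMeasurable, ?_⟩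
  rw [← l2_enorm_eq_eLpNorm, l2, lintegral_fiber k (fun z hz => by simp [testFn, hz])]
  have h := (memLp_comp_div hp.memLp_fourier).2
  rw [← l2_enorm_eq_eLpNorm, l2] at h
  simpa [testFn] using h

theorem integral_conj_testFn_mul (k : ℤ) (p : ℝ → ℂ) (F : Freq → ℂ) :
    ∫ z, (starRingEnd ℂ) (testFn k p z) * F z ∂freqMeasure =
      ∫ ξ, (starRingEnd ℂ) (𝓕 p (ξ / (2 * Real.pi))) * F (k, ξ) := by
  rw [integral_fiber k (fun z hz => by simp [testFn, hz])]
  simp [testFn]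

theorem real_inner_toLp {α : Type*} [MeasurableSpace α] {μ : Measure α} {g f : α → ℂ}
    (hg : MemLp g 2 μ) (hf : MemLp f 2 μ) :
    inner ℝ (hg.toLp g) (hf.toLp f) = (∫ z, (starRingEnd ℂ) (g z) * f z ∂μ).re := by
  have hi : Integrable (fun z => (starRingEnd ℂ) (g z) * f z) μ := (memLp_conj hg).integrable_mul hf
  rw [L2.inner_def]
  have e : (∫ z, (starRingEnd ℂ) (g z) * f z ∂μ).re
      = ∫ z, ((starRingEnd ℂ) (g z) * f z).re ∂μ := (integral_re hi).symm
  rw [e]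
  refine integral_congr_ae ?_
  filter_upwards [hg.coeFn_toLp, hf.coeFn_toLp] with z h1 h2
  rw [h1, h2, Complex.inner, mul_comm]

/-- The test functions in `L²(ℤ × ℝ)`. -/
def testSet : Set (Lp ℂ 2 freqMeasure) :=
  {g | ∃ (k : ℤ) (p : ℝ → ℂ) (hp : IsBump p), g = (memLp_testFn k hp).toLp _}

theorem span_testSet_topologicalClosure : (Submodule.span ℝ testSet).topologicalClosure = ⊤ := by
  rw [Submodule.topologicalClosure_eq_top_iff, Submodule.eq_bot_iff]
  intro u hu
  rw [Submodule.mem_orthogonal] at hu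
  have key : ∀ k : ℤ, ∀ᵐ ξ : ℝ, u (k, ξ) = 0 := by
    intro k
    have hL := memLp_fiber (Lp.memLp u) k
    have h0 := ae_eq_zero_of_integral_fourier_bump (memLp_comp_mul hL) fun p hp => ?_
    · have hq : Measure.QuasiMeasurePreserving (fun ξ : ℝ => (2 * Real.pi)⁻¹ * ξ) :=
        ⟨by fun_prop, by
          rw [Real.map_volume_mul_left (by positivity)]
          exact Measure.smul_absolutelyContinuous⟩
      filter_upwards [hq.ae h0] with ξ hξ
      rwa [mul_inv_cancel_left₀ (by positivity)] at hξ
    · have h1 := hu _ (Submodule.subset_span ⟨k, p, hp, rfl⟩)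
      have hu' : (Lp.memLp u).toLp u = u := Lp.toLp_coeFn u _
      rw [← hu', real_inner_toLp, integral_conj_testFn_mul] at h1
      have h2 := integral_comp_two_pi_mul
        (fun ξ => (starRingEnd ℂ) (𝓕 p ξ) * u (k, 2 * Real.pi * ξ))
      have e : ∀ ξ : ℝ, 2 * Real.pi * (ξ / (2 * Real.pi)) = ξ := fun ξ => by field_simp
      simp only [e] at h2
      rw [h2, Complex.re_ofReal_mul] at h1
      exact (mul_eq_zero.1 h1).resolve_left (by positivity)
  rw [Lp.eq_zero_iff_ae_eq_zero]
  exact ae_of_ae_fiber key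

/-! ### Transport-diffusion equations in frequency space -/

/-- The passage between the fixed frame and the frame `x ↦ x - sy`, in frequency space. -/
def shear (s : ℝ) (z : Freq) : Freq := (z.1, z.2 - s * z.1)

/-- The symbol of `-Δ` in the frame moving with the Couette flow. -/
def disp (s : ℝ) (z : Freq) : ℝ := (z.1 : ℝ) ^ 2 + (z.2 - s * z.1) ^ 2

theorem disp_nonneg (s : ℝ) (z : Freq) : 0 ≤ disp s z := by unfold disp; positivity

@[fun_prop]
theorem measurable_disp (s : ℝ) : Measurable (disp s) := by
  unfold disp
  have := measurable_int_cast_fst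
  fun_prop

theorem jap_shear_le (s : ℝ) (z : Freq) : jap (shear s z) ≤ (1 + |s|) * jap z := by
  refine abs_le_of_sq_le_sq' ?_ (mul_nonneg (by positivity) (jap_pos z).le) |>.2
  rw [mul_pow, jap_sq, jap_sq]
  simp only [shear]
  have h1 : -(2 * s * (z.1 * z.2)) ≤ |s| * ((z.1 : ℝ) ^ 2 + z.2 ^ 2) := by
    have h2 : -(2 * s * (z.1 * z.2)) ≤ |s| * (2 * |(z.1 : ℝ) * z.2|) := by
      refine (neg_le_abs _).trans (le_of_eq ?_)
      rw [abs_mul, abs_mul, abs_two]; ring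
    refine h2.trans (mul_le_mul_of_nonneg_left ?_ (abs_nonneg s))
    rw [abs_mul]
    nlinarith [sq_abs (z.1 : ℝ), sq_abs z.2, sq_nonneg (|(z.1 : ℝ)| - |z.2|)]
  have h3 : s ^ 2 = |s| ^ 2 := (sq_abs s).symm
  have := abs_nonneg s
  nlinarith [sq_nonneg (z.1 : ℝ), sq_nonneg z.2, mul_nonneg this (sq_nonneg (z.1 : ℝ)),
    mul_nonneg this (sq_nonneg z.2), mul_nonneg (sq_nonneg |s|) (sq_nonneg z.2)]

theorem disp_le (s : ℝ) (z : Freq) : disp s z ≤ (1 + |s|) ^ 2 * jap z ^ 2 := by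
  have h := pow_le_pow_left₀ (jap_pos _).le (jap_shear_le s z) 2
  rw [mul_pow, jap_sq] at h
  unfold disp
  simp only [shear] at h
  linarith

/-- The right-hand side, tested against `g`, of the equation `∂ₜF + u · ∇F = νΔF + h` in the moving
frame; `-a` is the Fourier transform of the stream function of `u`. -/
def weakRhs (ν s : ℝ) (h a F g : Freq → ℂ) : ℝ :=
  (∫ z, (starRingEnd ℂ) (g z) * (h z - (ν * disp s z : ℝ) * F z) ∂freqMeasure).re
    + (2 * Real.pi)⁻¹ * (transport g a F).re

/-- `F` is a weak solution on `[0, T]` of `∂ₜF + u · ∇F = νΔF + h` in the moving frame, with bounds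
that make every term square integrable. -/
structure IsProfile (ν T R : ℝ) (F h a : ℝ → Freq → ℂ) : Prop where
  measurable_sol : ∀ s, Measurable (F s)
  measurable_force : ∀ s, Measurable (h s)
  measurable_stream : ∀ s, Measurable (a s)
  memLp_sol : ∀ s, MemLp (F s) 2 freqMeasure
  sol_le : ∀ s ∈ Icc 0 T, hnorm 2 (F s) ≤ ENNReal.ofReal R
  force_le : ∀ s ∈ Icc 0 T, hnorm 0 (h s) ≤ ENNReal.ofReal R
  velocity_le : ∀ s ∈ Icc 0 T,
    ∫⁻ z, ENNReal.ofReal (len z) * ‖a s z‖ₑ ∂freqMeasure ≤ ENNReal.ofReal R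
  stream_real : ∀ s ∈ Icc 0 T, ∀ᵐ z ∂freqMeasure, a s (-z) = (starRingEnd ℂ) (a s z)
  weak_eq : ∀ (k : ℤ) (p : ℝ → ℂ), IsBump p → ∀ s ∈ Icc 0 T,
    HasDerivWithinAt
      (fun r => (∫ z, (starRingEnd ℂ) (testFn k p z) * F r z ∂freqMeasure).re)
      (weakRhs ν s (h s) (a s) (F s) (testFn k p)) (Icc 0 T) s

theorem memLp_of_hnorm {F : Freq → ℂ} (hF : Measurable F) (h : hnorm 0 F < ∞) :
    MemLp F 2 freqMeasure :=
  ⟨hF.aestronglyMeasurable, by rwa [← hnorm_zero_eq_eLpNorm]⟩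

theorem memLp_disp_mul {s : ℝ} {F : Freq → ℂ} (hF : Measurable F) (h : hnorm 2 F < ∞) (ν : ℝ) :
    MemLp (fun z => (ν * disp s z : ℝ) * F z) 2 freqMeasure := by
  have hm : Measurable fun z => ((ν * disp s z : ℝ) : ℂ) * F z := by
    have : Measurable fun z => ((ν * disp s z : ℝ) : ℂ) :=
      Complex.measurable_ofReal.comp (by fun_prop)
    fun_prop
  refine memLp_of_hnorm hm (lt_of_le_of_lt (l2_mono fun z => ?_) (lt_of_le_of_lt
    (l2_const_mul (ENNReal.ofReal_ne_top (r := |ν| * (1 + |s|) ^ 2)) _).le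
    (ENNReal.mul_lt_top ENNReal.ofReal_lt_top h)))
  rw [Real.rpow_zero, ENNReal.ofReal_one, one_mul, enorm_mul, enorm_ofReal_complex, ← mul_assoc,
    ← ENNReal.ofReal_mul (by positivity)]
  gcongr
  rw [abs_mul, mul_assoc, abs_of_nonneg (disp_nonneg s z), Real.rpow_two]
  gcongr
  exact disp_le s z

theorem transport_congr_ae {g g' a F : Freq → ℂ} (h : g =ᵐ[freqMeasure] g') :
    transport g a F = transport g' a F := by
  refine integral_congr_ae ?_
  have hq : Measure.QuasiMeasurePreserving (fun p : Freq × Freq => p.1 + p.2)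
      (freqMeasure.prod freqMeasure) freqMeasure :=
    Measure.quasiMeasurePreserving_snd.comp
      (measurePreserving_prod_add freqMeasure freqMeasure).quasiMeasurePreserving
  filter_upwards [hq.ae h] with p hp
  simp only [transportIntegrand, hp]

theorem weakRhs_congr_ae {ν s : ℝ} {h a F g g' : Freq → ℂ} (hg : g =ᵐ[freqMeasure] g') :
    weakRhs ν s h a F g = weakRhs ν s h a F g' := by
  unfold weakRhs
  rw [transport_congr_ae hg]
  congr 2
  refine integral_congr_ae ?_
  filter_upwards [hg] with z hz
  rw [hz]

namespace IsProfile

variable {ν T R : ℝ} {F h a : ℝ → Freq → ℂ}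

theorem hnorm_sol_lt_top (H : IsProfile ν T R F h a) {s : ℝ} (hs : s ∈ Icc 0 T) :
    hnorm 2 (F s) < ∞ :=
  (H.sol_le s hs).trans_lt ENNReal.ofReal_lt_top

theorem memLp_force (H : IsProfile ν T R F h a) {s : ℝ} (hs : s ∈ Icc 0 T) :
    MemLp (h s) 2 freqMeasure :=
  memLp_of_hnorm (H.measurable_force s) ((H.force_le s hs).trans_lt ENNReal.ofReal_lt_top)

theorem memLp_rhs (H : IsProfile ν T R F h a) {s : ℝ} (hs : s ∈ Icc 0 T) :
    MemLp (fun z => h s z - (ν * disp s z : ℝ) * F s z) 2 freqMeasure :=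
  (H.memLp_force hs).sub (memLp_disp_mul (H.measurable_sol s) (H.hnorm_sol_lt_top hs) ν)

theorem integrable_transport (H : IsProfile ν T R F h a) {s : ℝ} (hs : s ∈ Icc 0 T)
    {g : Freq → ℂ} (hg : Measurable g) (hg' : MemLp g 2 freqMeasure) :
    Integrable (transportIntegrand g (a s) (F s)) (freqMeasure.prod freqMeasure) :=
  integrable_transportIntegrand hg (H.measurable_stream s) (H.measurable_sol s)
    (by rw [hnorm_zero_eq_eLpNorm]; exact hg'.2)
    ((hnorm_mono_exp (by norm_num) _).trans_lt (H.hnorm_sol_lt_top hs))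
    ((H.velocity_le s hs).trans_lt ENNReal.ofReal_lt_top)

theorem weakRhs_add (H : IsProfile ν T R F h a) {s : ℝ} (hs : s ∈ Icc 0 T) {g g' : Freq → ℂ}
    (hg : Measurable g) (hg' : Measurable g') (hL : MemLp g 2 freqMeasure)
    (hL' : MemLp g' 2 freqMeasure) :
    weakRhs ν s (h s) (a s) (F s) (fun z => g z + g' z) =
      weakRhs ν s (h s) (a s) (F s) g + weakRhs ν s (h s) (a s) (F s) g' := by
  have i1 := (memLp_conj hL).integrable_mul (H.memLp_rhs hs)
  have i2 := (memLp_conj hL').integrable_mul (H.memLp_rhs hs)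
  have j1 := H.integrable_transport hs hg hL
  have j2 := H.integrable_transport hs hg' hL'
  have e1 := integral_add i1 i2
  have e2 := integral_add j1 j2
  have f1 : transport (fun z => g z + g' z) (a s) (F s) =
      transport g (a s) (F s) + transport g' (a s) (F s) := by
    rw [transport, transport, transport, ← e2]
    refine integral_congr_ae (Eventually.of_forall fun p => ?_)
    simp only [transportIntegrand, map_add]
    ring
  have f2 : ∫ z, (starRingEnd ℂ) (g z + g' z) * (h s z - (ν * disp s z : ℝ) * F s z) ∂freqMeasure =
      (∫ z, (starRingEnd ℂ) (g z) * (h s z - (ν * disp s z : ℝ) * F s z) ∂freqMeasure) +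
      ∫ z, (starRingEnd ℂ) (g' z) * (h s z - (ν * disp s z : ℝ) * F s z) ∂freqMeasure := by
    refine Eq.trans ?_ e1
    refine integral_congr_ae (Eventually.of_forall fun z => ?_)
    simp only [map_add, Pi.mul_apply]
    ring
  rw [weakRhs, weakRhs, weakRhs, f1, f2, Complex.add_re, Complex.add_re]
  ring

theorem weakRhs_smul (c : ℝ) (s : ℝ) (g : Freq → ℂ) :
    weakRhs ν s (h s) (a s) (F s) (fun z => c • g z) = c * weakRhs ν s (h s) (a s) (F s) g := by
  have f1 : transport (fun z => c • g z) (a s) (F s) = c * transport g (a s) (F s) := by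
    rw [transport, transport, ← integral_const_mul]
    refine integral_congr_ae (Eventually.of_forall fun p => ?_)
    simp only [transportIntegrand, Complex.real_smul, map_mul, Complex.conj_ofReal]
    ring
  have f2 : ∫ z, (starRingEnd ℂ) (c • g z) * (h s z - (ν * disp s z : ℝ) * F s z) ∂freqMeasure =
      c * ∫ z, (starRingEnd ℂ) (g z) * (h s z - (ν * disp s z : ℝ) * F s z) ∂freqMeasure := by
    rw [← integral_const_mul]
    refine integral_congr_ae (Eventually.of_forall fun z => ?_)
    simp only [Complex.real_smul, map_mul, Complex.conj_ofReal]
    ring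
  rw [weakRhs, weakRhs, f1, f2, Complex.re_ofReal_mul, Complex.re_ofReal_mul]
  ring

theorem abs_weakRhs_le (H : IsProfile ν T R F h a) (hν : 0 ≤ ν) (hR : 0 ≤ R) {s : ℝ}
    (hs : s ∈ Icc 0 T) {g : Freq → ℂ} (hg : Measurable g) (hL : MemLp g 2 freqMeasure) :
    |weakRhs ν s (h s) (a s) (F s) g| ≤
      (R + ν * (1 + T) ^ 2 * R + R * R) * (eLpNorm g 2 freqMeasure).toReal := by
  have hT : 0 ≤ T := hs.1.trans hs.2
  have eg : l2 freqMeasure (fun z => ‖g z‖ₑ) = eLpNorm g 2 freqMeasure := l2_enorm_eq_eLpNorm g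
  have hgt : eLpNorm g 2 freqMeasure ≠ ∞ := hL.2.ne
  have mh := H.measurable_force s
  have mF := H.measurable_sol s
  -- the forcing and diffusion terms
  have b1 : ‖∫ z, (starRingEnd ℂ) (g z) * (h s z - (ν * disp s z : ℝ) * F s z) ∂freqMeasure‖ ≤
      (R + ν * (1 + T) ^ 2 * R) * (eLpNorm g 2 freqMeasure).toReal := by
    refine (norm_integral_le_lintegral_norm _).trans ?_
    have hb : ∫⁻ z, ENNReal.ofReal
        ‖(starRingEnd ℂ) (g z) * (h s z - (ν * disp s z : ℝ) * F s z)‖ ∂freqMeasure ≤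
        ENNReal.ofReal (R + ν * (1 + T) ^ 2 * R) * eLpNorm g 2 freqMeasure := by
      have hpt : ∀ z, ENNReal.ofReal
          ‖(starRingEnd ℂ) (g z) * (h s z - (ν * disp s z : ℝ) * F s z)‖ ≤
          ‖g z‖ₑ * (‖h s z‖ₑ + ENNReal.ofReal (ν * (1 + T) ^ 2) *
            (ENNReal.ofReal (jap z ^ (2 : ℝ)) * ‖F s z‖ₑ)) := by
        intro z
        rw [ofReal_norm, enorm_mul, enorm_conj]
        gcongr
        refine enorm_sub_le.trans ?_
        gcongr
        rw [enorm_mul, enorm_ofReal_complex, ← mul_assoc, ← ENNReal.ofReal_mul (by positivity)]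
        gcongr
        rw [abs_mul, abs_of_nonneg hν, abs_of_nonneg (disp_nonneg s z), mul_assoc, Real.rpow_two]
        gcongr
        refine (disp_le s z).trans ?_
        gcongr
        rw [abs_of_nonneg hs.1]
        exact hs.2
      refine (lintegral_mono hpt).trans ?_
      refine (lintegral_mul_le_l2 (Measurable.aemeasurable (by fun_prop))
        (Measurable.aemeasurable (by fun_prop))).trans ?_
      rw [eg, mul_comm]
      gcongr
      refine (l2_add_le (Measurable.aemeasurable (by fun_prop))
        (Measurable.aemeasurable (by fun_prop))).trans ?_
      rw [l2_const_mul ENNReal.ofReal_ne_top, ENNReal.ofReal_add hR (by positivity),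
        ENNReal.ofReal_mul (p := ν * (1 + T) ^ 2) (by positivity)]
      have e0 : l2 freqMeasure (fun z => ‖h s z‖ₑ) = hnorm 0 (h s) := by simp [hnorm]
      rw [e0]
      gcongr
      · exact H.force_le s hs
      · exact H.sol_le s hs
    refine (ENNReal.toReal_mono (by finiteness) hb).trans_eq ?_
    rw [ENNReal.toReal_mul, ENNReal.toReal_ofReal (by positivity)]
  have b2 : ‖transport g (a s) (F s)‖ ≤ R * R * (eLpNorm g 2 freqMeasure).toReal := by
    refine (norm_integral_le_lintegral_norm _).trans ?_
    simp_rw [ofReal_norm]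
    have hb := lintegral_enorm_transportIntegrand_le hg (H.measurable_stream s) mF
    have hb' : ∫⁻ p, ‖transportIntegrand g (a s) (F s) p‖ₑ ∂freqMeasure.prod freqMeasure ≤
        ENNReal.ofReal R * (eLpNorm g 2 freqMeasure * ENNReal.ofReal R) := by
      refine hb.trans ?_
      rw [hnorm_zero_eq_eLpNorm]
      gcongr
      · exact H.velocity_le s hs
      · exact (hnorm_mono_exp (by norm_num) _).trans (H.sol_le s hs)
    refine (ENNReal.toReal_mono (by finiteness) hb').trans_eq ?_
    rw [ENNReal.toReal_mul, ENNReal.toReal_mul, ENNReal.toReal_ofReal hR]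
    ring
  have hpi : (2 * Real.pi)⁻¹ ≤ 1 := inv_le_one_of_one_le₀ (by linarith [Real.two_le_pi])
  unfold weakRhs
  refine (abs_add_le _ _).trans ?_
  rw [add_mul, abs_mul, abs_of_pos (inv_pos.2 Real.two_pi_pos)]
  refine add_le_add ((Complex.abs_re_le_norm _).trans b1) ?_
  calc _ ≤ 1 * ‖transport g (a s) (F s)‖ := by
        gcongr
        exact Complex.abs_re_le_norm _
    _ ≤ _ := by rw [one_mul]; exact b2

/-- The energy identity for a bounded weight `W`. -/
theorem hasDerivWithinAt_energy (H : IsProfile ν T R F h a) (hν : 0 ≤ ν) (hR : 0 ≤ R)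
    (hT : 0 ≤ T) {W : Freq → ℝ} {c : ℝ} (hW : Measurable W) (hWc : ∀ z, |W z| ≤ c) :
    ∀ s ∈ Icc 0 T, HasDerivWithinAt (fun r => ∫ z, W z * ‖F r z‖ ^ 2 ∂freqMeasure)
      (2 * weakRhs ν s (h s) (a s) (F s) (wmul W (F s))) (Icc 0 T) s := by
  have hc : 0 ≤ c := (abs_nonneg _).trans (hWc 0)
  set u : ℝ → Lp ℂ 2 freqMeasure := fun r => (H.memLp_sol r).toLp _ with hu
  have hWF : ∀ {G : Freq → ℂ}, MemLp G 2 freqMeasure → MemLp (wmul W G) 2 freqMeasure := by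
    intro G hG
    refine hG.of_le_mul (c := c) ?_ (Eventually.of_forall fun z => ?_)
    · exact (Complex.measurable_ofReal.comp hW).aestronglyMeasurable.mul hG.1
    · rw [wmul, norm_mul, Complex.norm_real]
      exact mul_le_mul_of_nonneg_right (hWc z) (norm_nonneg _)
  set v : ℝ → Lp ℂ 2 freqMeasure := fun r => (hWF (H.memLp_sol r)).toLp _ with hv
  set Λ : ℝ → Lp ℂ 2 freqMeasure → ℝ := fun s g => weakRhs ν s (h s) (a s) (F s) g with hΛ
  have mg : ∀ g : Lp ℂ 2 freqMeasure, Measurable g := fun g => (Lp.stronglyMeasurable g).measurable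
  obtain ⟨hlip, hder⟩ := hasDerivWithinAt_inner_of_dense (T := T)
    (B := R + ν * (1 + T) ^ 2 * R + R * R) (by positivity) (u := u) (Λ := Λ) (S := testSet)
    (fun s hs g g' => by
      rw [hΛ]
      simp only
      rw [← H.weakRhs_add hs (mg g) (mg g') (Lp.memLp g) (Lp.memLp g')]
      exact weakRhs_congr_ae (Lp.coeFn_add g g'))
    (fun s hs r g => by
      rw [hΛ]
      simp only
      rw [← weakRhs_smul]
      exact weakRhs_congr_ae (Lp.coeFn_smul r g))
    (fun s hs g => by
      rw [Lp.norm_def]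
      exact H.abs_weakRhs_le hν hR hs (mg g) (Lp.memLp g))
    span_testSet_topologicalClosure
    (by
      rintro g ⟨k, p, hp, rfl⟩ s hs
      have h1 := H.weak_eq k p hp s hs
      have h2 : Λ s ((memLp_testFn k hp).toLp _) =
          weakRhs ν s (h s) (a s) (F s) (testFn k p) :=
        weakRhs_congr_ae (memLp_testFn k hp).coeFn_toLp
      rw [h2]
      exact h1.congr_of_mem (fun r _ => real_inner_toLp _ _) hs)
  have hmain := hasDerivWithinAt_inner_self (c := c) (v := v) hlip hder
    (fun r s => by
      rw [real_inner_toLp, real_inner_toLp]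
      congr 2
      ext z
      simp only [wmul, map_mul, Complex.conj_ofReal]
      ring)
    (fun r s => by
      rw [hv, hu]
      simp only
      rw [← MemLp.toLp_sub, ← MemLp.toLp_sub, Lp.norm_toLp, Lp.norm_toLp,
        ← ENNReal.toReal_ofReal hc,
        ← ENNReal.toReal_mul]
      have hd := (H.memLp_sol r).sub (H.memLp_sol s)
      refine ENNReal.toReal_mono (ENNReal.mul_ne_top ENNReal.ofReal_ne_top hd.2.ne) ?_
      have e : wmul W (F r) - wmul W (F s) = wmul W (F r - F s) := by
        ext z; simp [wmul, mul_sub]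
      rw [e, ← hnorm_zero_eq_eLpNorm, ← hnorm_zero_eq_eLpNorm]
      exact hnorm_wmul_le hWc 0 _)
  intro s hs
  have h3 := hmain s hs
  have h4 : Λ s (v s) = weakRhs ν s (h s) (a s) (F s) (wmul W (F s)) :=
    weakRhs_congr_ae (hWF (H.memLp_sol s)).coeFn_toLp
  rw [h4] at h3
  refine h3.congr_of_mem (fun r _ => ?_) hs
  rw [hv, hu]
  simp only
  rw [real_inner_toLp]
  have e : ∀ z, (starRingEnd ℂ) (wmul W (F r) z) * F r z = ((W z * ‖F r z‖ ^ 2 : ℝ) : ℂ) := by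
    intro z
    simp only [wmul, map_mul, Complex.conj_ofReal, mul_assoc]
    rw [← Complex.normSq_eq_conj_mul_self, Complex.normSq_eq_norm_sq]
    push_cast
    rfl
  simp_rw [e]
  rw [integral_complex_ofReal, Complex.ofReal_re]

/-- The energy estimate, free of truncations. The diffusion term has a sign, and the transport term
is bounded by the commutator estimate. -/
theorem energy_le (H : IsProfile ν T R F h a) (hν : 0 ≤ ν) (hR : 0 ≤ R) {m t κ X Y Z : ℝ}
    (hm : 2 < m) (ht : t ∈ Icc 0 T) (hκ : 0 ≤ κ) (hX : 0 ≤ X) (hY : 0 ≤ Y) (hZ : 0 ≤ Z)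
    {f : ℝ → Freq → ℂ} (hf : ∀ s, Measurable (f s))
    (hFX : ∀ s ∈ Icc 0 t, hnorm m (F s) ≤ ENNReal.ofReal X)
    (hhY : ∀ s ∈ Icc 0 t, hnorm m (h s) ≤ ENNReal.ofReal Y)
    (hfZ : ∀ s ∈ Icc 0 t, hnorm m (f s) ≤ ENNReal.ofReal Z)
    (hbound : ∀ s ∈ Icc 0 t, ∀ z, len z ^ 2 * ‖a s z‖ ≤ κ * (jap z * ‖f s z‖)) :
    hnorm m (F t) ^ 2 ≤
      hnorm m (F 0) ^ 2 + ENNReal.ofReal (t * (2 * (X * Y) + commConst m * κ * (Z * X ^ 2))) := by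
  set K : ℝ := 2 * (X * Y) + commConst m * κ * (Z * X ^ 2) with hK
  have hcc : 0 ≤ commConst m := by unfold commConst; positivity
  have hK0 : 0 ≤ K := by positivity
  have hT : 0 ≤ T := ht.1.trans ht.2
  have hsub : Icc 0 t ⊆ Icc 0 T := Icc_subset_Icc_right ht.2
  have h0t : (0 : ℝ) ∈ Icc 0 t := ⟨le_rfl, ht.1⟩
  -- the derivative of the truncated energy
  have hder : ∀ N : ℝ, 0 < N → ∀ s ∈ Icc 0 t,
      2 * weakRhs ν s (h s) (a s) (F s) (wmul (truncWeight m N) (F s)) ≤ K := by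
    intro N hN s hs
    have hsT := hsub hs
    have hW := measurable_truncWeight m N
    have hW0 := truncWeight_nonneg m hN
    have hWc := abs_truncWeight_le (m := m) (by linarith) hN
    have mF := H.measurable_sol s
    have mh := H.measurable_force s
    have hFfin := (hFX s hs).trans_lt ENNReal.ofReal_lt_top
    have hffin := (hfZ s hs).trans_lt ENNReal.ofReal_lt_top
    have htr := abs_re_transport_truncWeight_le hm hN hκ (H.measurable_stream s) (hf s) mF
      hffin hFfin ((H.velocity_le s hsT).trans_lt ENNReal.ofReal_lt_top) (H.stream_real s hsT)
      (hbound s hs)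
    have htr' : 2 * |(transport (wmul (truncWeight m N) (F s)) (a s) (F s)).re| ≤
        commConst m * κ * (Z * X ^ 2) := by
      refine htr.trans ?_
      gcongr
      · exact ENNReal.toReal_le_of_le_ofReal hZ (hfZ s hs)
      · exact ENNReal.toReal_le_of_le_ofReal hX (hFX s hs)
    have hlin : (∫ z, (starRingEnd ℂ) (wmul (truncWeight m N) (F s) z)
        * (h s z - (ν * disp s z : ℝ) * F s z) ∂freqMeasure).re ≤ X * Y := by
      have hWF : MemLp (wmul (truncWeight m N) (F s)) 2 freqMeasure := by
        refine (H.memLp_sol s).of_le_mul (c := N ^ (2 * m)) ?_ (Eventually.of_forall fun z => ?_)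
        · exact (Complex.measurable_ofReal.comp hW).aestronglyMeasurable.mul mF.aestronglyMeasurable
        · rw [wmul, norm_mul, Complex.norm_real]
          exact mul_le_mul_of_nonneg_right (hWc z) (norm_nonneg _)
      have i0 := (memLp_conj hWF).integrable_mul (H.memLp_rhs hsT)
      have i1 := (memLp_conj hWF).integrable_mul (H.memLp_force hsT)
      have hle : (∫ z, (starRingEnd ℂ) (wmul (truncWeight m N) (F s) z)
          * (h s z - (ν * disp s z : ℝ) * F s z) ∂freqMeasure).re ≤
          (∫ z, (starRingEnd ℂ) (wmul (truncWeight m N) (F s) z) * h s z ∂freqMeasure).re := by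
        have r0 := integral_re i0
        have r1 := integral_re i1
        simp only [Pi.mul_apply, RCLike.re_to_complex] at r0 r1
        rw [← r0, ← r1]
        refine integral_mono i0.re i1.re fun z => ?_
        have e : (starRingEnd ℂ) (wmul (truncWeight m N) (F s) z) *
            (((ν * disp s z : ℝ) : ℂ) * F s z) =
            ((truncWeight m N z * (ν * disp s z) * ‖F s z‖ ^ 2 : ℝ) : ℂ) := by
          simp only [wmul, map_mul, Complex.conj_ofReal]
          have : (starRingEnd ℂ) (F s z) * F s z = ((‖F s z‖ ^ 2 : ℝ) : ℂ) := by
            rw [← Complex.normSq_eq_conj_mul_self, Complex.normSq_eq_norm_sq]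
          rw [Complex.ofReal_mul (truncWeight m N z * (ν * disp s z)), ← this]
          push_cast
          ring
        simp only [mul_sub, e, Complex.sub_re,
          Complex.ofReal_re]
        have := disp_nonneg s z
        have := hW0 z
        have : 0 ≤ truncWeight m N z * (ν * disp s z) * ‖F s z‖ ^ 2 := by positivity
        linarith
      refine hle.trans ((Complex.re_le_norm _).trans ?_)
      refine (norm_integral_le_lintegral_norm _).trans ?_
      refine ENNReal.toReal_le_of_le_ofReal (by positivity) ?_
      rw [ENNReal.ofReal_mul hX]
      refine le_trans ?_ (mul_le_mul' (hFX s hs) (hhY s hs))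
      refine le_trans (lintegral_mono fun z => ?_) (lintegral_mul_le_l2
        (Measurable.aemeasurable (by fun_prop)) (Measurable.aemeasurable (by fun_prop)))
      rw [ofReal_norm, enorm_mul, enorm_conj, wmul, enorm_mul, enorm_ofReal_complex,
        abs_of_nonneg (hW0 z)]
      calc _ ≤ ENNReal.ofReal (jap z ^ m * jap z ^ m) * ‖F s z‖ₑ * ‖h s z‖ₑ := by
            gcongr
            rw [← Real.rpow_add (jap_pos z), ← two_mul]
            exact truncWeight_le_jap (by linarith) hN z
        _ = _ := by
            rw [ENNReal.ofReal_mul (Real.rpow_nonneg (jap_pos z).le m)]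
            ring
    have hpi : (2 * Real.pi)⁻¹ ≤ 1 := inv_le_one_of_one_le₀ (by linarith [Real.two_le_pi])
    have hpi0 : 0 ≤ (2 * Real.pi)⁻¹ := by positivity
    have h5 : (2 * Real.pi)⁻¹ * (transport (wmul (truncWeight m N) (F s)) (a s) (F s)).re ≤
        |(transport (wmul (truncWeight m N) (F s)) (a s) (F s)).re| :=
      (mul_le_mul_of_nonneg_left (le_abs_self _) hpi0).trans
        (mul_le_of_le_one_left (abs_nonneg _) hpi)
    unfold weakRhs
    rw [hK]
    linarith
  -- integration in time
  have hint : ∀ N : ℝ, 0 < N → ∫ z, truncWeight m N z * ‖F t z‖ ^ 2 ∂freqMeasure ≤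
      (∫ z, truncWeight m N z * ‖F 0 z‖ ^ 2 ∂freqMeasure) + t * K := by
    intro N hN
    have hW := measurable_truncWeight m N
    have hWc := abs_truncWeight_le (m := m) (by linarith) hN
    have hd := H.hasDerivWithinAt_energy hν hR hT hW hWc
    have hd' : ∀ s ∈ Icc 0 t, HasDerivWithinAt
        (fun r => ∫ z, truncWeight m N z * ‖F r z‖ ^ 2 ∂freqMeasure) _ (Icc 0 t) s :=
      fun s hs => (hd s (hsub hs)).mono hsub
    have hB : ∀ s, HasDerivAt
        (fun r => (∫ z, truncWeight m N z * ‖F 0 z‖ ^ 2 ∂freqMeasure) + r * K) K s := by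
      intro s
      simpa using ((hasDerivAt_id s).mul_const K).const_add
        (∫ z, truncWeight m N z * ‖F 0 z‖ ^ 2 ∂freqMeasure)
    refine image_le_of_deriv_right_le_deriv_boundary (a := 0) (b := t)
      (fun s hs => (hd' s hs).continuousWithinAt)
      (fun s hs => (hd' s ⟨hs.1, hs.2.le⟩).mono_of_mem_nhdsWithin ?_) (by simp)
      (fun s _ => (hB s).continuousAt.continuousWithinAt)
      (fun s _ => (hB s).hasDerivWithinAt)
      (fun s hs => hder N hN s ⟨hs.1, hs.2.le⟩) ⟨ht.1, le_rfl⟩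
    exact mem_of_superset (Ico_mem_nhdsGE hs.2) fun r hr => ⟨hs.1.trans hr.1, hr.2.le⟩
  -- removal of the truncation
  have hlint : ∀ N : ℝ, 0 < N → ∀ r ∈ Icc 0 t,
      ENNReal.ofReal (∫ z, truncWeight m N z * ‖F r z‖ ^ 2 ∂freqMeasure) =
      ∫⁻ z, ENNReal.ofReal (truncWeight m N z) * ‖F r z‖ₑ ^ 2 ∂freqMeasure := by
    intro N hN r hr
    have hW := measurable_truncWeight m N
    have hW0 := truncWeight_nonneg m hN
    have hWc := abs_truncWeight_le (m := m) (by linarith) hN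
    have hi : Integrable (fun z => truncWeight m N z * ‖F r z‖ ^ 2) freqMeasure := by
      refine (H.memLp_sol r).norm.integrable_sq.bdd_mul (c := N ^ (2 * m)) hW.aestronglyMeasurable
        (Eventually.of_forall fun z => ?_)
      exact hWc z
    rw [ofReal_integral_eq_lintegral_ofReal hi
      (Eventually.of_forall fun z => mul_nonneg (hW0 z) (by positivity))]
    refine lintegral_congr fun z => ?_
    rw [ENNReal.ofReal_mul (hW0 z), ENNReal.ofReal_pow (norm_nonneg _), ofReal_norm]
  have hsq : ∀ r, hnorm m (F r) ^ 2 =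
      ∫⁻ z, ENNReal.ofReal (jap z ^ (2 * m)) * ‖F r z‖ₑ ^ 2 ∂freqMeasure := by
    intro r
    rw [hnorm, l2_sq]
    refine lintegral_congr fun z => ?_
    rw [mul_pow, ← ENNReal.ofReal_pow (Real.rpow_nonneg (jap_pos z).le m), ← Real.rpow_natCast,
      ← Real.rpow_mul (jap_pos z).le]
    congr 3
    push_cast
    ring
  have hbd : ∀ n : ℕ,
      ∫⁻ z, ENNReal.ofReal (truncWeight m (n + 1) z) * ‖F t z‖ₑ ^ 2 ∂freqMeasure ≤
        hnorm m (F 0) ^ 2 + ENNReal.ofReal (t * K) := by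
    intro n
    have hN : (0 : ℝ) < n + 1 := by positivity
    rw [← hlint _ hN t ⟨ht.1, le_rfl⟩]
    refine (ENNReal.ofReal_le_ofReal (hint _ hN)).trans ?_
    refine ENNReal.ofReal_add_le.trans ?_
    gcongr
    rw [hlint _ hN 0 h0t, hsq]
    refine lintegral_mono fun z => ?_
    gcongr
    exact truncWeight_le_jap (by linarith) hN z
  rw [hsq t]
  have hliminf : ∀ z, ENNReal.ofReal (jap z ^ (2 * m)) * ‖F t z‖ₑ ^ 2 ≤
      liminf (fun n : ℕ => ENNReal.ofReal (truncWeight m (n + 1) z) * ‖F t z‖ₑ ^ 2) atTop := by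
    intro z
    refine le_of_eq (Tendsto.liminf_eq ?_).symm
    refine tendsto_const_nhds.congr' ?_
    obtain ⟨n₀, hn₀⟩ := exists_nat_ge (jap z)
    filter_upwards [eventually_ge_atTop n₀] with n hn
    have : jap z ≤ n + 1 := by
      have : (n₀ : ℝ) ≤ n := by exact_mod_cast hn
      linarith
    rw [truncWeight, min_eq_left this]
  have mF := H.measurable_sol t
  refine (lintegral_mono hliminf).trans ((lintegral_liminf_le fun n => ?_).trans ?_)
  · unfold truncWeight
    fun_prop
  · exact liminf_le_of_le (by isBoundedDefault) fun b hb => by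
      obtain ⟨n, hn⟩ := hb.exists
      exact hn.trans (hbd n)

/-- If the velocity is a shear flow, each mode in `x` solves the same equation. -/
theorem restrict_mode (H : IsProfile ν T R F (fun _ _ => 0) a) (k₀ : ℤ)
    (ha : ∀ s z, z.1 ≠ 0 → a s z = 0) :
    IsProfile ν T R (fun s z => if z.1 = k₀ then F s z else 0) (fun _ _ => 0) a where
  measurable_sol s := Measurable.ite (measurable_fst (measurableSet_singleton k₀))
    (H.measurable_sol s) measurable_const
  measurable_force _ := measurable_const
  measurable_stream := H.measurable_stream
  memLp_sol s := by
    refine (H.memLp_sol s).mono (Measurable.aestronglyMeasurable (Measurable.ite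
      (measurable_fst (measurableSet_singleton k₀)) (H.measurable_sol s) measurable_const))
      (Eventually.of_forall fun z => ?_)
    split_ifs <;> simp
  sol_le s hs := by
    refine le_trans (l2_mono fun z => ?_) (H.sol_le s hs)
    gcongr
    by_cases hz : z.1 = k₀ <;> simp [hz]
  force_le s hs := H.force_le s hs
  velocity_le := H.velocity_le
  stream_real := H.stream_real
  weak_eq k p hp s hs := by
    by_cases hk : k = k₀
    · subst hk
      have h1 := H.weak_eq k p hp s hs
      have e1 : ∀ r, ∫ z, (starRingEnd ℂ) (testFn k p z) * (if z.1 = k then F r z else 0)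
          ∂freqMeasure = ∫ z, (starRingEnd ℂ) (testFn k p z) * F r z ∂freqMeasure := by
        intro r
        congr 1
        ext z
        by_cases hz : z.1 = k <;> simp [testFn, hz]
      have e2 : weakRhs ν s (fun _ => 0) (a s) (fun z => if z.1 = k then F s z else 0) (testFn k p)
          = weakRhs ν s (fun _ => 0) (a s) (F s) (testFn k p) := by
        unfold weakRhs transport
        congr 3
        · ext z
          by_cases hz : z.1 = k <;> simp [testFn, hz]
        · congr 1
          ext q
          simp only [transportIntegrand]
          by_cases hq : q.1.1 = 0
          · by_cases hz : q.2.1 = k <;> simp [testFn, hz, hq]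
          · simp [ha s q.1 hq]
      rw [e2]
      simp_rw [e1]
      exact h1
    · have e1 : ∀ r, ∫ z, (starRingEnd ℂ) (testFn k p z) * (if z.1 = k₀ then F r z else 0)
          ∂freqMeasure = 0 := by
        intro r
        rw [← integral_zero Freq ℂ (μ := freqMeasure)]
        congr 1
        ext z
        by_cases hz : z.1 = k
        · simp [hz, hk]
        · simp [testFn, hz]
      have e2 : weakRhs ν s (fun _ => 0) (a s) (fun z => if z.1 = k₀ then F s z else 0) (testFn k p)
          = 0 := by
        unfold weakRhs transport
        rw [integral_eq_zero_of_ae, integral_eq_zero_of_ae]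
        · simp
        · refine Eventually.of_forall fun q => ?_
          simp only [transportIntegrand, Pi.zero_apply]
          by_cases hq : q.1.1 = 0
          · by_cases hz : q.2.1 = k
            · simp [hz, hk]
            · simp [testFn, hz, hq]
          · simp [ha s q.1 hq]
        · refine Eventually.of_forall fun z => ?_
          by_cases hz : z.1 = k
          · simp [hz, hk]
          · simp [testFn, hz]
      rw [e2]
      simp_rw [e1]
      simpa using hasDerivWithinAt_const s (Icc 0 T) (0 : ℝ)

end IsProfile

/-! ### The Fourier transform on `𝕋 × ℝ` -/

/-- `hat f` as a function on frequency space. -/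
def hatFn (f : L2) (z : Freq) : ℂ := hat f z.1 z.2

@[fun_prop]
theorem measurable_hatFn (f : L2) : Measurable (hatFn f) := by
  refine measurable_from_prod_countable_right fun k => ?_
  have h : Measurable (𝓕 ((memLp_xMode f k).toLp (xMode f k)) : Lp ℂ 2 (volume : Measure ℝ)) :=
    (Lp.stronglyMeasurable _).measurable
  exact h.comp (by fun_prop)

theorem stronglyMeasurable_L2 (f : L2) : StronglyMeasurable (f : Torus × ℝ → ℝ) :=
  Lp.stronglyMeasurable f

theorem stronglyMeasurable_xMode (f : L2) (k : ℤ) : StronglyMeasurable (xMode f k) := by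
  have hF : StronglyMeasurable
      (fun p : Torus × ℝ => (fourier (-k) p.1 : ℂ) • ((f p : ℝ) : ℂ)) :=
    ((fourier (-k)).continuous.comp continuous_fst).stronglyMeasurable.smul
      (Complex.continuous_ofReal.comp_stronglyMeasurable (stronglyMeasurable_L2 f))
  exact hF.integral_prod_left' (μ := AddCircle.haarAddCircle)

theorem measurable_xMode_uncurry (f : L2) :
    Measurable (fun z : ℤ × ℝ => xMode f z.1 z.2) :=
  measurable_from_prod_countable_right fun k => (stronglyMeasurable_xMode f k).measurable

theorem volume_torus :
    (volume : Measure Torus) = ENNReal.ofReal (2 * Real.pi) • AddCircle.haarAddCircle := rfl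

theorem integral_torus (g : Torus → ℂ) :
    ∫ x : Torus, g x = (2 * Real.pi : ℝ) * ∫ x, g x ∂AddCircle.haarAddCircle := by
  rw [volume_torus, integral_smul_measure, ENNReal.toReal_ofReal Real.two_pi_pos.le,
    Complex.real_smul]

/-- Almost every slice `f(·, y)` is square integrable. -/
theorem ae_memLp_slice (f : L2) :
    ∀ᵐ y : ℝ, MemLp (fun x : Torus => ((f (x, y) : ℝ) : ℂ)) 2 AddCircle.haarAddCircle := by
  have h1 := (Lp.memLp f).norm.integrable_sq
  have h2 : Integrable (fun p : Torus × ℝ => ‖f p‖ ^ 2)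
    ((volume : Measure Torus).prod (volume : Measure ℝ)) := h1
  filter_upwards [h2.prod_left_ae] with y hy
  rw [memLp_haarAddCircle_iff]
  have hs : AEStronglyMeasurable (fun x : Torus => ((f (x, y) : ℝ) : ℂ)) volume :=
    (Complex.continuous_ofReal.comp_stronglyMeasurable
      ((stronglyMeasurable_L2 f).comp_measurable measurable_prodMk_right)).aestronglyMeasurable
  rw [memLp_two_iff_integrable_sq_norm hs]
  simpa using hy

theorem ae_slice_of_ae {P : Torus × ℝ → Prop} (h : ∀ᵐ p, P p) :
    ∀ᵐ y : ℝ, ∀ᵐ x ∂(AddCircle.haarAddCircle : Measure Torus), P (x, y) := by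
  have h1 : ∀ᵐ p ∂((volume : Measure Torus).prod (volume : Measure ℝ)), P p := h
  have h2 : ∀ᵐ q ∂((volume : Measure ℝ).prod (volume : Measure Torus)), P q.swap :=
    (Measure.measurePreserving_swap (μ := (volume : Measure ℝ))
      (ν := (volume : Measure Torus))).quasiMeasurePreserving.ae h1
  filter_upwards [Measure.ae_ae_of_ae_prod h2] with y hy
  have hac : (AddCircle.haarAddCircle : Measure Torus) ≪ volume := by
    rw [volume_torus]
    exact Measure.absolutelyContinuous_smul (by simp [Real.pi_pos])
  exact hac.ae_le hy

/-- Parseval's formula on the torus, for a product. -/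
theorem hasSum_fourierCoeff_mul {a b : Torus → ℂ} (ha : MemLp a 2 AddCircle.haarAddCircle)
    (hb : MemLp b 2 AddCircle.haarAddCircle) (k : ℤ) :
    HasSum (fun l => fourierCoeff a l * fourierCoeff b (k - l))
      (fourierCoeff (fun x => a x * b x) k) := by
  have hx : MemLp (fun x => fourier k x * (starRingEnd ℂ) (b x)) 2 AddCircle.haarAddCircle := by
    refine (memLp_conj hb).of_le_mul (c := 1) ?_ (Eventually.of_forall fun x => ?_)
    · exact (map_continuous (fourier k)).aestronglyMeasurable.mul (memLp_conj hb).1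
    · rw [norm_mul, fourier_apply, Circle.norm_coe]
  have h := fourierBasis.hasSum_inner_mul_inner (hx.toLp _) (ha.toLp a)
  have e1 : ∀ l : ℤ, inner ℂ (fourierBasis l) (ha.toLp a) = fourierCoeff a l := by
    intro l
    rw [← HilbertBasis.repr_apply_apply, fourierBasis_repr]
    exact congrFun (fourierCoeff_congr_ae ha.coeFn_toLp) l
  have e2 : ∀ l : ℤ, inner ℂ (hx.toLp _) (fourierBasis l) = fourierCoeff b (k - l) := by
    intro l
    rw [inner_toLp hx, fourierCoeff]
    refine integral_congr_ae ?_
    rw [coe_fourierBasis]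
    filter_upwards [coeFn_fourierLp 2 l] with x h1
    rw [h1, map_mul, Complex.conj_conj, ← fourier_neg, smul_eq_mul, neg_sub, sub_eq_add_neg,
      fourier_add]
    ring
  have e3 : inner ℂ (hx.toLp _) (ha.toLp a) = fourierCoeff (fun x => a x * b x) k := by
    rw [inner_toLp hx, fourierCoeff]
    refine integral_congr_ae ?_
    filter_upwards [ha.coeFn_toLp] with x h1
    rw [h1, map_mul, Complex.conj_conj, ← fourier_neg, smul_eq_mul]
    ring
  simp only [e1, e2, e3, mul_comm (fourierCoeff b _)] at h
  exact h

theorem lintegral_sq_fourierCoeff {a : Torus → ℂ} (ha : MemLp a 2 AddCircle.haarAddCircle) :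
    ∑' l : ℤ, ‖fourierCoeff a l‖ₑ ^ 2 = ∫⁻ x, ‖a x‖ₑ ^ 2 ∂AddCircle.haarAddCircle := by
  have h := hasSum_sq_fourierCoeff (ha.toLp a)
  have e : ∀ l, fourierCoeff (ha.toLp a) l = fourierCoeff a l :=
    fun l => congrFun (fourierCoeff_congr_ae ha.coeFn_toLp) l
  simp only [e] at h
  have h2 : ∫ t, ‖(ha.toLp a) t‖ ^ 2 ∂AddCircle.haarAddCircle =
      ∫ t, ‖a t‖ ^ 2 ∂AddCircle.haarAddCircle := by
    refine integral_congr_ae ?_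
    filter_upwards [ha.coeFn_toLp] with x hx
    rw [hx]
  rw [h2] at h
  have h3 := ofReal_integral_eq_lintegral_ofReal ha.norm.integrable_sq
    (Eventually.of_forall fun x => by positivity)
  have e4 : ∀ w : ℂ, ENNReal.ofReal (‖w‖ ^ 2) = ‖w‖ₑ ^ 2 := fun w => by
    rw [ENNReal.ofReal_pow (norm_nonneg _), ofReal_norm]
  simp only [e4] at h3
  rw [← h3, ← h.tsum_eq, ENNReal.ofReal_tsum_of_nonneg (fun _ => by positivity) h.summable]
  simp only [e4]

/-- Plancherel's theorem on the torus, integrated over the line. -/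
theorem two_pi_mul_tsum_lintegral_xMode (f : L2) :
    ENNReal.ofReal (2 * Real.pi) * ∫⁻ z : ℤ × ℝ, ‖xMode f z.1 z.2‖ₑ ^ 2 ∂freqMeasure =
      eLpNorm f 2 volume ^ 2 := by
  have hm := measurable_xMode_uncurry f
  have hmf : AEMeasurable (fun p : Torus × ℝ => ‖f p‖ₑ ^ 2)
      ((volume : Measure Torus).prod (volume : Measure ℝ)) :=
    ((stronglyMeasurable_L2 f).enorm.pow_const _).aemeasurable
  have e0 : eLpNorm f 2 volume ^ 2 = ∫⁻ p : Torus × ℝ, ‖f p‖ₑ ^ 2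
      ∂((volume : Measure Torus).prod (volume : Measure ℝ)) := by
    rw [← l2_enorm_eq_eLpNorm, l2_sq]
    rfl
  rw [e0, lintegral_prod_symm _ hmf, lintegral_prod_symm _ (by fun_prop),
    ← lintegral_const_mul' _ _ ENNReal.ofReal_ne_top]
  refine lintegral_congr_ae ?_
  filter_upwards [ae_memLp_slice f] with y hy
  rw [lintegral_count, volume_torus, lintegral_smul_measure, smul_eq_mul]
  congr 1
  refine (lintegral_sq_fourierCoeff hy).trans (lintegral_congr fun x => ?_)
  rw [enorm_ofReal_complex, Real.enorm_eq_ofReal_abs]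

theorem lintegral_sq_fourier_L2 (g : Lp ℂ 2 (volume : Measure ℝ)) :
    ∫⁻ ξ, ‖(𝓕 g) ξ‖ₑ ^ 2 = ∫⁻ y, ‖g y‖ₑ ^ 2 := by
  rw [← l2_sq, ← l2_sq, l2_enorm_eq_eLpNorm, l2_enorm_eq_eLpNorm, ← Lp.enorm_def, ← Lp.enorm_def,
    ← ofReal_norm, ← ofReal_norm, Lp.norm_fourier_eq]

theorem lintegral_comp_div_two_pi {f : ℝ → ℝ≥0∞} (hf : Measurable f) :
    ∫⁻ ξ, f (ξ / (2 * Real.pi)) = ENNReal.ofReal (2 * Real.pi) * ∫⁻ ξ, f ξ := by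
  have hc : (2 * Real.pi)⁻¹ ≠ 0 := by positivity
  have h := lintegral_map (μ := (volume : Measure ℝ)) hf
    (g := fun ξ => (2 * Real.pi)⁻¹ * ξ) (by fun_prop)
  rw [Real.map_volume_mul_left hc, lintegral_smul_measure, inv_inv, abs_of_pos Real.two_pi_pos,
    smul_eq_mul] at h
  rw [h]
  simp only [div_eq_inv_mul]

/-- Plancherel's theorem on `𝕋 × ℝ`. -/
theorem hnorm_zero_hatFn (f : L2) : hnorm 0 (hatFn f) = eLpNorm f 2 volume := by
  have hm := measurable_xMode_uncurry f
  have h : hnorm 0 (hatFn f) ^ 2 = eLpNorm f 2 volume ^ 2 := by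
    rw [hnorm_zero_eq_eLpNorm, ← l2_enorm_eq_eLpNorm, l2_sq, ← two_pi_mul_tsum_lintegral_xMode,
      lintegral_freqMeasure (by fun_prop), lintegral_freqMeasure (by fun_prop),
      ← ENNReal.tsum_mul_left]
    congr 1
    ext k
    set g := (memLp_xMode f k).toLp (xMode f k)
    have hg : Measurable (𝓕 g : Lp ℂ 2 (volume : Measure ℝ)) := (Lp.stronglyMeasurable _).measurable
    rw [show (fun ξ => ‖hatFn f (k, ξ)‖ₑ ^ 2) = fun ξ =>
        ‖(𝓕 g : Lp ℂ 2 (volume : Measure ℝ)) (ξ / (2 * Real.pi))‖ₑ ^ 2 from rfl,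
      lintegral_comp_div_two_pi 
        (f := fun ξ => ‖(𝓕 g : Lp ℂ 2 (volume : Measure ℝ)) ξ‖ₑ ^ 2) (by fun_prop),
      lintegral_sq_fourier_L2]
    congr 1
    refine lintegral_congr_ae ?_
    filter_upwards [(memLp_xMode f k).coeFn_toLp] with y hy
    rw [hy]
  have := congrArg (fun x : ℝ≥0∞ => x ^ (1 / 2 : ℝ)) h
  have e : ∀ x : ℝ≥0∞, (x ^ 2) ^ (1 / 2 : ℝ) = x := fun x => by
    rw [← ENNReal.rpow_natCast, ← ENNReal.rpow_mul]; norm_num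
  simpa only [e] using this

theorem memLp_hatFn (f : L2) : MemLp (hatFn f) 2 freqMeasure :=
  memLp_of_hnorm (measurable_hatFn f) (by rw [hnorm_zero_hatFn]; exact Lp.eLpNorm_lt_top f)

theorem xMode_sub (f g : L2) (k : ℤ) : xMode (f - g) k =ᵐ[volume] xMode f k - xMode g k := by
  filter_upwards [ae_slice_of_ae (Lp.coeFn_sub f g), ae_memLp_slice f, ae_memLp_slice g]
    with y hy hf hg
  have hf1 := hf.integrable (by norm_num)
  have hg1 := hg.integrable (by norm_num)
  rw [Pi.sub_apply, xMode, xMode, xMode, fourierCoeff, fourierCoeff, fourierCoeff,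
    ← integral_sub (hf1.fourier_smul _) (hg1.fourier_smul _)]
  refine integral_congr_ae ?_
  filter_upwards [hy] with x hx
  rw [hx, Pi.sub_apply, Complex.ofReal_sub, smul_sub]

theorem hatFn_sub (f g : L2) :
    ∀ᵐ z ∂freqMeasure, hatFn (f - g) z = hatFn f z - hatFn g z := by
  refine ae_of_ae_fiber fun k => ?_
  have h1 := xMode_sub f g k
  have h2 : (memLp_xMode (f - g) k).toLp _ =
      (memLp_xMode f k).toLp _ - (memLp_xMode g k).toLp _ := by
    rw [← MemLp.toLp_sub]
    exact MemLp.toLp_congr _ _ h1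
  have h3 : (𝓕 ((memLp_xMode (f - g) k).toLp _) : Lp ℂ 2 (volume : Measure ℝ)) =
      𝓕 ((memLp_xMode f k).toLp _) - 𝓕 ((memLp_xMode g k).toLp _) := by
    rw [h2]
    exact map_sub (Lp.fourierTransformₗᵢ ℝ ℂ) _ _
  have hq : Measure.QuasiMeasurePreserving (fun ξ : ℝ => ξ / (2 * Real.pi)) := by
    simp_rw [div_eq_inv_mul]
    exact ⟨by fun_prop, by
      rw [Real.map_volume_mul_left (by positivity)]
      exact Measure.smul_absolutelyContinuous⟩
  filter_upwards [hq.ae (Lp.coeFn_sub (𝓕 ((memLp_xMode f k).toLp _) : Lp ℂ 2 (volume : Measure ℝ))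
    (𝓕 ((memLp_xMode g k).toLp _)))] with ξ hξ
  simp only [hatFn, hat, h3]
  exact hξ

/-- The Fourier transform of a real function is Hermitian. -/
theorem hatFn_neg (f : L2) :
    ∀ᵐ z ∂freqMeasure, hatFn f (-z) = (starRingEnd ℂ) (hatFn f z) := by
  refine ae_of_ae_fiber fun k => ?_
  have h1 : xMode f (-k) = fun y => (starRingEnd ℂ) (xMode f k y) := by
    ext y
    rw [xMode, xMode, fourierCoeff, fourierCoeff, ← integral_conj]
    congr 1
    ext x
    rw [smul_eq_mul, smul_eq_mul, map_mul, Complex.conj_ofReal, ← fourier_neg]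
  have h2 : (memLp_xMode f (-k)).toLp _ = (memLp_conj (memLp_xMode f k)).toLp _ :=
    MemLp.toLp_congr _ _ (Eventually.of_forall fun y => congrFun h1 y)
  have hq : Measure.QuasiMeasurePreserving (fun ξ : ℝ => (-(2 * Real.pi)⁻¹) * ξ) :=
    ⟨by fun_prop, by
      rw [Real.map_volume_mul_left (neg_ne_zero.2 (by positivity))]
      exact Measure.smul_absolutelyContinuous⟩
  filter_upwards [hq.ae (fourier_L2_conj (memLp_xMode f k))] with ξ hξ
  simp only [hatFn, hat, Prod.fst_neg, Prod.snd_neg, h2]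
  have e : -ξ / (2 * Real.pi) = -(2 * Real.pi)⁻¹ * ξ := by ring
  rw [e, hξ]
  congr 2
  ring

/-! ### Pairings with test functions -/

/-- The function `e^{-ikx} q(y)` on `𝕋 × ℝ`. -/
def wave (k : ℤ) (q : ℝ → ℂ) (z : Torus × ℝ) : ℂ := fourier (-k) z.1 * q z.2

theorem continuous_wave (k : ℤ) {q : ℝ → ℂ} (hq : Continuous q) : Continuous (wave k q) :=
  ((map_continuous (fourier (-k))).comp continuous_fst).mul (hq.comp continuous_snd)

theorem norm_wave (k : ℤ) (q : ℝ → ℂ) (z : Torus × ℝ) : ‖wave k q z‖ = ‖q z.2‖ := by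
  rw [wave, norm_mul, fourier_apply, Circle.norm_coe, one_mul]

theorem hasCompactSupport_wave (k : ℤ) {q : ℝ → ℂ} (hq : HasCompactSupport q) :
    HasCompactSupport (wave k q) := by
  refine HasCompactSupport.intro (isCompact_univ.prod hq) fun z hz => ?_
  have : z.2 ∉ tsupport q := fun h => hz ⟨mem_univ _, h⟩
  rw [wave, image_eq_zero_of_notMem_tsupport this, mul_zero]

theorem memLp_wave (k : ℤ) {q : ℝ → ℂ} (hq : Continuous q) (hq' : HasCompactSupport q)
    (r : ℝ≥0∞) : MemLp (wave k q) r :=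
  (continuous_wave k hq).memLp_of_hasCompactSupport (hasCompactSupport_wave k hq')

theorem memLp_ofReal (f : L2) : MemLp (fun z => ((f z : ℝ) : ℂ)) 2 :=
  (Lp.memLp f).ofReal

theorem integrable_mul_wave (f : L2) (k : ℤ) {q : ℝ → ℂ} (hq : Continuous q)
    (hq' : HasCompactSupport q) : Integrable (fun z => ((f z : ℝ) : ℂ) * wave k q z) :=
  (memLp_ofReal f).integrable_mul (memLp_wave k hq hq' 2)

theorem integrable_mul_mul_wave (u f : L2) (k : ℤ) {q : ℝ → ℂ} (hq : Continuous q)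
    (hq' : HasCompactSupport q) :
    Integrable (fun z => ((u z : ℝ) : ℂ) * ((f z : ℝ) : ℂ) * wave k q z) := by
  have h1 : Integrable (fun z => ((u z : ℝ) : ℂ) * ((f z : ℝ) : ℂ)) :=
    (memLp_ofReal u).integrable_mul (memLp_ofReal f)
  have h2 := memLp_wave k hq hq' ∞
  exact h1.mul_of_top_left h2

theorem integral_torus_prod {g : Torus × ℝ → ℂ} (hg : Integrable g) :
    ∫ z, g z = ∫ y : ℝ, (2 * Real.pi : ℝ) * ∫ x, g (x, y) ∂AddCircle.haarAddCircle := by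
  rw [Measure.volume_eq_prod, integral_prod_symm _ hg]
  simp_rw [integral_torus]

/-- The pairing of `f` with `e^{-ikx} p̄(y)`. -/
theorem integral_mul_wave_conj (f : L2) (k : ℤ) {p : ℝ → ℂ} (hp : IsBump p) :
    ∫ z, ((f z : ℝ) : ℂ) * wave k (fun y => (starRingEnd ℂ) (p y)) z =
      ∫ z, (starRingEnd ℂ) (testFn k p z) * hatFn f z ∂freqMeasure := by
  rw [integral_torus_prod (integrable_mul_wave f k hp.conj.continuous hp.conj.hasCompactSupport),
    integral_conj_testFn_mul]
  have e : ∀ y, ∫ x : Torus, ((f (x, y) : ℝ) : ℂ) * wave k (fun y => (starRingEnd ℂ) (p y)) (x, y)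
      ∂AddCircle.haarAddCircle = (starRingEnd ℂ) (p y) * xMode f k y := by
    intro y
    rw [xMode, fourierCoeff, ← integral_const_mul]
    congr 1
    ext x
    simp only [wave, smul_eq_mul]
    ring
  simp_rw [e]
  rw [integral_const_mul]
  have h1 : ∫ y, (starRingEnd ℂ) (p y) * xMode f k y =
      ∫ y, (starRingEnd ℂ) (p y) * (memLp_xMode f k).toLp _ y := by
    refine integral_congr_ae ?_
    filter_upwards [(memLp_xMode f k).coeFn_toLp] with y hy
    rw [hy]
  rw [h1, integral_conj_mul_eq_fourier hp.integrable (hp.memLp 2), ← integral_comp_two_pi_mul]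
  rfl

theorem integrable_testFn (k : ℤ) {p : ℝ → ℂ} (hp : IsBump p) :
    ∫⁻ z, ‖testFn k p z‖ₑ ∂freqMeasure < ∞ := by
  rw [lintegral_fiber k (fun z hz => by simp [testFn, hz])]
  have h : Integrable (fun ξ : ℝ => 𝓕 p (ξ / (2 * Real.pi))) :=
    hp.integrable_fourier.comp_div (by positivity)
  have h2 := h.2
  rw [hasFiniteIntegral_def] at h2
  simpa [testFn] using h2

/-- The integrand of the product of two functions, paired with a test function. -/
def prodIntegrand (k : ℤ) (p : ℝ → ℂ) (U F : Freq → ℂ) (q : Freq × Freq) : ℂ :=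
  (starRingEnd ℂ) (testFn k p (q.1 + q.2)) * U q.1 * F q.2

theorem integrable_prodIntegrand (k : ℤ) {p : ℝ → ℂ} (hp : IsBump p) {U F : Freq → ℂ}
    (hU : Measurable U) (hF : Measurable F) (hU' : MemLp U 2 freqMeasure)
    (hF' : MemLp F 2 freqMeasure) :
    Integrable (prodIntegrand k p U F) (freqMeasure.prod freqMeasure) := by
  have mt := measurable_testFn k hp
  refine ⟨?_, ?_⟩
  · have : Measurable fun q : Freq × Freq => (starRingEnd ℂ) (testFn k p (q.1 + q.2)) :=
      Complex.continuous_conj.measurable.comp (mt.comp (by fun_prop))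
    unfold prodIntegrand
    exact Measurable.aestronglyMeasurable (by fun_prop)
  · rw [HasFiniteIntegral]
    simp_rw [prodIntegrand, enorm_mul, enorm_conj]
    refine lt_of_le_of_lt (lintegral_trilinear_le_out (μ := freqMeasure)
      (f := fun z => ‖testFn k p z‖ₑ) (g := fun z => ‖U z‖ₑ) (h := fun z => ‖F z‖ₑ)
      (by fun_prop) (by fun_prop) (by fun_prop)) ?_
    rw [l2_enorm_eq_eLpNorm, l2_enorm_eq_eLpNorm]
    exact ENNReal.mul_lt_top (integrable_testFn k hp) (ENNReal.mul_lt_top hU'.2 hF'.2)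

theorem integral_testFn_add_mul (k : ℤ) (p : ℝ → ℂ) (F : Freq → ℂ) (l : ℤ) (ξ : ℝ) :
    ∫ w, (starRingEnd ℂ) (testFn k p ((l, ξ) + w)) * F w ∂freqMeasure =
      ∫ η, (starRingEnd ℂ) (𝓕 p ((ξ + η) / (2 * Real.pi))) * F (k - l, η) := by
  rw [integral_fiber (k - l) (fun z hz => ?_)]
  · simp [testFn]
  · have : l + z.1 ≠ k := fun h => hz (by omega)
    simp [testFn, this]

/-- The trilinear pairing of single modes on the physical and on the Fourier side. -/
theorem integral_fiber_product {p : ℝ → ℂ} (hp : IsBump p) (u f : L2) (k l : ℤ) :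
    ∫ ξ, hatFn u (l, ξ) *
        ∫ η, (starRingEnd ℂ) (𝓕 p ((ξ + η) / (2 * Real.pi))) * hatFn f (k - l, η) =
      (2 * Real.pi : ℝ) ^ 2 *
        ∫ y, xMode u l y * xMode f (k - l) y * (starRingEnd ℂ) (p y) := by
  set a := (memLp_xMode u l).toLp _ with ha
  set b := (memLp_xMode f (k - l)).toLp _ with hb
  obtain ⟨hi, he⟩ := integral_mul_conj_bump hp a b
  have e1 : ∫ y, xMode u l y * xMode f (k - l) y * (starRingEnd ℂ) (p y) =
      ∫ y, a y * b y * (starRingEnd ℂ) (p y) := by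
    refine integral_congr_ae ?_
    filter_upwards [(memLp_xMode u l).coeFn_toLp, (memLp_xMode f (k - l)).coeFn_toLp] with y h1 h2
    rw [ha, hb, h1, h2]
  rw [e1, he, Measure.volume_eq_prod, integral_prod _ hi, sq, mul_assoc]
  have e2 : ∀ ξ : ℝ, ∫ η, (starRingEnd ℂ) (𝓕 p ((ξ + η) / (2 * Real.pi))) * hatFn f (k - l, η) =
      (2 * Real.pi : ℝ) * ∫ η, (starRingEnd ℂ) (𝓕 p (ξ / (2 * Real.pi) + η)) * (𝓕 b) η := by
    intro ξ
    rw [← integral_comp_two_pi_mul]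
    simp only [add_div]
    rfl
  simp_rw [e2]
  rw [← integral_const_mul, ← integral_comp_two_pi_mul]
  congr 1
  ext ξ
  have e3 : hatFn u (l, ξ) = (𝓕 a : Lp ℂ 2 (volume : Measure ℝ)) (ξ / (2 * Real.pi)) := rfl
  rw [e3, mul_left_comm, ← integral_const_mul]
  congr 2
  ext η
  ring

theorem memLp_xMode_uncurry (f : L2) : MemLp (fun z : ℤ × ℝ => xMode f z.1 z.2) 2 freqMeasure := by
  refine ⟨(measurable_xMode_uncurry f).aestronglyMeasurable, ?_⟩
  rw [← l2_enorm_eq_eLpNorm, l2]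
  refine ENNReal.rpow_lt_top_of_nonneg (by norm_num) fun h => ?_
  have h1 := two_pi_mul_tsum_lintegral_xMode f
  rw [h, ENNReal.mul_top (by simp [Real.pi_pos])] at h1
  exact ENNReal.pow_ne_top (Lp.eLpNorm_ne_top f) h1.symm

/-- The pairing of a product `u f` with `e^{-ikx} p̄(y)` as a convolution in frequency space. -/
theorem integral_mul_mul_wave_conj (u f : L2) (k : ℤ) {p : ℝ → ℂ} (hp : IsBump p) :
    ∫ z, ((u z : ℝ) : ℂ) * ((f z : ℝ) : ℂ) * wave k (fun y => (starRingEnd ℂ) (p y)) z =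
      (2 * Real.pi : ℝ)⁻¹ *
        ∫ q, prodIntegrand k p (hatFn u) (hatFn f) q ∂freqMeasure.prod freqMeasure := by
  have hpi : ((2 * Real.pi : ℝ) : ℂ) ≠ 0 := by exact_mod_cast Real.two_pi_pos.ne'
  -- the physical side
  have hG : Integrable (fun z : ℤ × ℝ =>
      xMode u z.1 z.2 * xMode f (k - z.1) z.2 * (starRingEnd ℂ) (p z.2)) freqMeasure := by
    have hr : MeasurePreserving (fun z : ℤ × ℝ => (k - z.1, z.2)) freqMeasure freqMeasure :=
      (Measure.measurePreserving_sub_left (Measure.count : Measure ℤ) k).prod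
        (MeasurePreserving.id (volume : Measure ℝ))
    have h1 := (memLp_xMode_uncurry u).integrable_mul
      ((memLp_xMode_uncurry f).comp_measurePreserving hr)
    obtain ⟨c, hc⟩ := hp.hasCompactSupport.exists_bound_of_continuous hp.continuous
    refine Integrable.mul_bdd (c := c) h1 ?_ (Eventually.of_forall fun z => ?_)
    · exact (hp.conj.continuous.comp continuous_snd).aestronglyMeasurable
    · rw [Complex.norm_conj]; exact hc _
  have hL : ∫ z, ((u z : ℝ) : ℂ) * ((f z : ℝ) : ℂ) * wave k (fun y => (starRingEnd ℂ) (p y)) z =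
      (2 * Real.pi : ℝ) * ∫ l, (∫ y, xMode u l y * xMode f (k - l) y * (starRingEnd ℂ) (p y))
        ∂(Measure.count : Measure ℤ) := by
    rw [integral_torus_prod (integrable_mul_mul_wave u f k hp.conj.continuous
      hp.conj.hasCompactSupport), integral_const_mul, ← integral_prod _ hG,
      integral_prod_symm _ hG]
    congr 1
    refine integral_congr_ae ?_
    filter_upwards [ae_memLp_slice u, ae_memLp_slice f, hG.prod_left_ae] with y h1 h2 h3
    rw [integral_countable h3]
    have h4 := (hasSum_fourierCoeff_mul h1 h2 k).mul_right ((starRingEnd ℂ) (p y))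
    have e : ∫ x, ((u (x, y) : ℝ) : ℂ) * ((f (x, y) : ℝ) : ℂ) *
        wave k (fun y => (starRingEnd ℂ) (p y)) (x, y) ∂AddCircle.haarAddCircle =
        fourierCoeff (fun x : Torus => ((u (x, y) : ℝ) : ℂ) * ((f (x, y) : ℝ) : ℂ)) k
          * (starRingEnd ℂ) (p y) := by
      rw [fourierCoeff, ← integral_mul_const]
      congr 1
      ext x
      simp only [wave, smul_eq_mul]
      ring
    rw [e, ← h4.tsum_eq]
    refine tsum_congr fun l => ?_
    simp [xMode, measureReal_def]
  -- the Fourier side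
  have hI := integrable_prodIntegrand k hp (measurable_hatFn u) (measurable_hatFn f)
    (memLp_hatFn u) (memLp_hatFn f)
  have hR : ∫ q, prodIntegrand k p (hatFn u) (hatFn f) q ∂freqMeasure.prod freqMeasure =
      (2 * Real.pi : ℝ) ^ 2 *
        ∫ l, (∫ y, xMode u l y * xMode f (k - l) y * (starRingEnd ℂ) (p y))
          ∂(Measure.count : Measure ℤ) := by
    rw [integral_prod _ hI, integral_prod _ hI.integral_prod_left, ← integral_const_mul]
    congr 1
    ext l
    rw [← integral_fiber_product hp u f k l]
    congr 1
    ext ξ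
    rw [← integral_testFn_add_mul, ← integral_const_mul]
    congr 1
    ext w
    simp only [prodIntegrand]
    ring
  rw [hL, hR, ← mul_assoc]
  congr 1
  push_cast at hpi ⊢
  field_simp

theorem zeroMode_eq_xMode (u : L2) (y : ℝ) : ((zeroMode u y : ℝ) : ℂ) = xMode u 0 y := by
  rw [zeroMode, xMode, fourierCoeff, ← integral_complex_ofReal]
  congr 1
  ext x
  simp

/-- The part of a function on frequency space that is independent of `x`. -/
def zeroPart (F : Freq → ℂ) (z : Freq) : ℂ := if z.1 = 0 then F z else 0

theorem measurable_zeroPart {F : Freq → ℂ} (hF : Measurable F) : Measurable (zeroPart F) :=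
  Measurable.ite (measurable_fst (measurableSet_singleton 0)) hF measurable_const

theorem norm_zeroPart_le (F : Freq → ℂ) (z : Freq) : ‖zeroPart F z‖ ≤ ‖F z‖ := by
  unfold zeroPart
  split_ifs <;> simp

theorem memLp_zeroPart {F : Freq → ℂ} (hF : Measurable F) (h : MemLp F 2 freqMeasure) :
    MemLp (zeroPart F) 2 freqMeasure :=
  h.mono (measurable_zeroPart hF).aestronglyMeasurable
    (Eventually.of_forall (norm_zeroPart_le F))

theorem memLp_zeroMode (u : L2) : MemLp (fun z : Torus × ℝ => ((zeroMode u z.2 : ℝ) : ℂ)) 2 := by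
  simp_rw [zeroMode_eq_xMode]
  rw [Measure.volume_eq_prod]
  exact (memLp_xMode u 0).comp_snd _

/-- The pairing of a product `u₀ f` with `e^{-ikx} p̄(y)`. -/
theorem integral_zeroMode_mul_wave_conj (u f : L2) (k : ℤ) {p : ℝ → ℂ} (hp : IsBump p) :
    Integrable (fun z : Torus × ℝ => ((zeroMode u z.2 : ℝ) : ℂ) * ((f z : ℝ) : ℂ) *
      wave k (fun y => (starRingEnd ℂ) (p y)) z) ∧
    ∫ z : Torus × ℝ, ((zeroMode u z.2 : ℝ) : ℂ) * ((f z : ℝ) : ℂ) *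
        wave k (fun y => (starRingEnd ℂ) (p y)) z =
      (2 * Real.pi : ℝ)⁻¹ *
        ∫ q, prodIntegrand k p (zeroPart (hatFn u)) (hatFn f) q ∂freqMeasure.prod freqMeasure := by
  have hpi : ((2 * Real.pi : ℝ) : ℂ) ≠ 0 := by exact_mod_cast Real.two_pi_pos.ne'
  have hu := memLp_zeroMode u
  have hi : Integrable (fun z : Torus × ℝ => ((zeroMode u z.2 : ℝ) : ℂ) * ((f z : ℝ) : ℂ) *
      wave k (fun y => (starRingEnd ℂ) (p y)) z) := by
    have h1 : Integrable (fun z : Torus × ℝ => ((zeroMode u z.2 : ℝ) : ℂ) * ((f z : ℝ) : ℂ)) :=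
      hu.integrable_mul (memLp_ofReal f)
    exact h1.mul_of_top_left (memLp_wave k hp.conj.continuous hp.conj.hasCompactSupport ∞)
  refine ⟨hi, ?_⟩
  have hI := integrable_prodIntegrand k hp (measurable_zeroPart (measurable_hatFn u))
    (measurable_hatFn f) (memLp_zeroPart (measurable_hatFn u) (memLp_hatFn u)) (memLp_hatFn f)
  have hR : ∫ q, prodIntegrand k p (zeroPart (hatFn u)) (hatFn f) q
      ∂freqMeasure.prod freqMeasure = (2 * Real.pi : ℝ) ^ 2 *
        ∫ y, xMode u 0 y * xMode f (k - 0) y * (starRingEnd ℂ) (p y) := by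
    have e : ∀ z : Freq, ∫ w, prodIntegrand k p (zeroPart (hatFn u)) (hatFn f) (z, w) ∂freqMeasure =
        zeroPart (hatFn u) z *
          ∫ η, (starRingEnd ℂ) (𝓕 p ((z.2 + η) / (2 * Real.pi))) * hatFn f (k - z.1, η) := by
      intro z
      rw [← integral_testFn_add_mul, ← integral_const_mul]
      congr 1
      ext w
      simp only [prodIntegrand]
      ring
    rw [integral_prod _ hI, ← integral_fiber_product hp u f k 0]
    simp_rw [e]
    rw [integral_fiber 0 (fun z hz => by simp [zeroPart, hz])]
    simp [zeroPart]
  rw [integral_torus_prod hi, hR, integral_const_mul]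
  have e : ∀ y, ∫ x : Torus, ((zeroMode u (x, y).2 : ℝ) : ℂ) * ((f (x, y) : ℝ) : ℂ) *
      wave k (fun y => (starRingEnd ℂ) (p y)) (x, y) ∂AddCircle.haarAddCircle =
      xMode u 0 y * xMode f (k - 0) y * (starRingEnd ℂ) (p y) := by
    intro y
    simp only [zeroMode_eq_xMode]
    rw [sub_zero, xMode.eq_def f k, fourierCoeff, ← integral_const_mul,
      ← integral_mul_const]
    congr 1
    ext x
    simp only [wave, smul_eq_mul]
    ring
  simp_rw [e]
  rw [← mul_assoc]
  congr 1
  push_cast at hpi ⊢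
  field_simp

/-! ### Plane waves transported by the Couette flow -/

/-- Modulation of a profile in `y`; it undoes the shearing of the mode `e^{ikx}` for `c = ks`. -/
def twist (c : ℝ) (p : ℝ → ℂ) (y : ℝ) : ℂ := Complex.exp (-(c * y * Complex.I)) * p y

theorem contDiff_ofReal_complex {n : WithTop ℕ∞} : ContDiff ℝ n fun y : ℝ => (y : ℂ) :=
  Complex.ofRealCLM.contDiff

theorem IsBump.twist {p : ℝ → ℂ} (hp : IsBump p) (c : ℝ) : IsBump (twist c p) :=
  hp.smooth_mul (((contDiff_const.mul contDiff_ofReal_complex).mul contDiff_const).neg.cexp)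

theorem hasDerivAt_ofReal_complex (y : ℝ) : HasDerivAt (fun y : ℝ => (y : ℂ)) 1 y :=
  Complex.ofRealCLM.hasDerivAt

theorem deriv_twist {p : ℝ → ℂ} (hp : IsBump p) (c : ℝ) :
    deriv (twist c p) = twist c fun y => deriv p y + -(c * Complex.I) * p y := by
  ext y
  have h1 : HasDerivAt (fun y : ℝ => -((c : ℂ) * y * Complex.I)) (-((c : ℂ) * 1 * Complex.I)) y :=
    (((hasDerivAt_ofReal_complex y).const_mul (c : ℂ)).mul_const Complex.I).neg
  have h2 := h1.cexp.mul (hp.differentiable y).hasDerivAt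
  rw [show twist c p = (fun y : ℝ => Complex.exp (-((c : ℂ) * y * Complex.I))) * p from rfl,
    h2.deriv, twist]
  ring

theorem IsBump.deriv_add_mul {p : ℝ → ℂ} (hp : IsBump p) (c : ℂ) :
    IsBump fun y => _root_.deriv p y + c * p y :=
  hp.deriv.add (hp.const_mul c)

theorem testFn_twist (k : ℤ) (p : ℝ → ℂ) (s : ℝ) (z : Freq) :
    testFn k (twist (k * s) p) z = testFn k p (shear (-s) z) := by
  unfold testFn shear
  simp only
  split_ifs with hz
  · have := fourier_modulate p (k * s) (z.2 / (2 * Real.pi))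
    unfold twist
    have e : (z.2 - -s * (k : ℝ)) / (2 * Real.pi) =
        z.2 / (2 * Real.pi) + k * s / (2 * Real.pi) := by
      ring
    rw [this, hz, e]
  · rfl

theorem testFn_deriv (k : ℤ) {p : ℝ → ℂ} (hp : IsBump p) (z : Freq) :
    testFn k (deriv p) z = Complex.I * z.2 * testFn k p z := by
  unfold testFn
  split_ifs with hz
  · rw [hp.fourier_deriv]
    have : (Real.pi : ℂ) ≠ 0 := by exact_mod_cast Real.pi_ne_zero
    push_cast
    field_simp
  · simp

theorem testFn_const_mul (k : ℤ) (p : ℝ → ℂ) (c : ℂ) (z : Freq) :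
    testFn k (fun y => c * p y) z = c * testFn k p z := by
  unfold testFn
  split_ifs with hz
  · rw [Real.fourier_real_eq, Real.fourier_real_eq, ← integral_const_mul]
    congr 1
    ext y
    simp only [Circle.smul_def, smul_eq_mul]
    ring
  · simp

theorem testFn_add (k : ℤ) {p q : ℝ → ℂ} (hp : IsBump p) (hq : IsBump q) (z : Freq) :
    testFn k (fun y => p y + q y) z = testFn k p z + testFn k q z := by
  have h := VectorFourier.fourierIntegral_add (μ := volume) Real.continuous_fourierChar
    (L := innerₗ ℝ) (by exact continuous_inner) hp.integrable hq.integrable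
  unfold testFn
  split_ifs with hz
  · exact congrFun h _
  · simp

theorem fourier_torus (n : ℤ) (x : ℝ) :
    (fourier n (x : Torus) : ℂ) = Complex.exp (n * x * Complex.I) := by
  rw [fourier_coe_apply]
  congr 1
  have : (Real.pi : ℂ) ≠ 0 := by exact_mod_cast Real.pi_ne_zero
  push_cast
  field_simp

theorem fourier_add_coe (n : ℤ) (x : Torus) (h : ℝ) :
    (fourier n (x + (h : Torus)) : ℂ) = fourier n x * Complex.exp (n * h * Complex.I) := by
  rw [← fourier_torus, fourier_apply, fourier_apply, fourier_apply, smul_add,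
    AddCircle.toCircle_add, Circle.coe_mul]

/-- The real test function `Re (e^{-ikx} Q(t, y))`. -/
def reWave (k : ℤ) (Q : ℝ → ℝ → ℂ) (t : ℝ) (x : Torus) (y : ℝ) : ℝ := (wave k (Q t) (x, y)).re

theorem dx_reWave (k : ℤ) (Q : ℝ → ℝ → ℂ) :
    dx (reWave k Q) = reWave k fun t y => -(k * Complex.I) * Q t y := by
  ext t x y
  have h1 : HasDerivAt (fun h : ℝ => ((-k : ℤ) : ℂ) * h * Complex.I)
      (((-k : ℤ) : ℂ) * 1 * Complex.I) 0 :=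
    ((hasDerivAt_ofReal_complex 0).const_mul _).mul_const Complex.I
  have h2 : HasDerivAt (fun h : ℝ => wave k (Q t) (x + (h : Torus), y))
      (wave k (fun y => -(k * Complex.I) * Q t y) (x, y)) 0 := by
    have h3 := (h1.cexp.const_mul (fourier (-k) x : ℂ)).mul_const (Q t y)
    simp only [wave, fourier_add_coe]
    refine h3.congr_deriv ?_
    simp
    ring
  have h4 := Complex.reCLM.hasFDerivAt.comp_hasDerivAt (0 : ℝ) h2
  exact h4.deriv

theorem dy_reWave (k : ℤ) {Q Q' : ℝ → ℝ → ℂ} (h : ∀ t y, HasDerivAt (Q t) (Q' t y) y) :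
    dy (reWave k Q) = reWave k Q' := by
  ext t x y
  have h2 : HasDerivAt (fun y : ℝ => wave k (Q t) (x, y)) (wave k (Q' t) (x, y)) y :=
    (h t y).const_mul (fourier (-k) x : ℂ)
  exact (Complex.reCLM.hasFDerivAt.comp_hasDerivAt y h2).deriv

theorem dt_reWave (k : ℤ) {Q Q' : ℝ → ℝ → ℂ}
    (h : ∀ t y, HasDerivAt (fun s => Q s y) (Q' t y) t) :
    dt (reWave k Q) = reWave k Q' := by
  ext t x y
  have h2 : HasDerivAt (fun s : ℝ => wave k (Q s) (x, y)) (wave k (Q' t) (x, y)) t :=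
    (h t y).const_mul (fourier (-k) x : ℂ)
  exact (Complex.reCLM.hasFDerivAt.comp_hasDerivAt t h2).deriv

/-- The factor `e^{iksy} p̄(y)` of the plane wave `e^{-ik(x - sy)} p̄(y)`. -/
def profile (k : ℤ) (p : ℝ → ℂ) (s y : ℝ) : ℂ := (starRingEnd ℂ) (twist (k * s) p y)

theorem profile_eq (k : ℤ) (p : ℝ → ℂ) (s y : ℝ) :
    profile k p s y = Complex.exp (k * s * y * Complex.I) * (starRingEnd ℂ) (p y) := by
  rw [profile, twist, map_mul, ← Complex.exp_conj]
  congr 2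
  simp

theorem isTest_reWave (k : ℤ) {p : ℝ → ℂ} (hp : IsBump p) : IsTest (reWave k (profile k p)) where
  smooth := by
    have e : (fun z : ℝ × ℝ × ℝ => reWave k (profile k p) z.1 (z.2.1 : Torus) z.2.2) =
        fun z => Complex.reCLM (Complex.exp (((-k : ℤ) : ℂ) * (z.2.1 : ℝ) * Complex.I) *
          (Complex.exp (k * (z.1 : ℝ) * (z.2.2 : ℝ) * Complex.I) *
            (starRingEnd ℂ) (p z.2.2))) := by
      ext z
      simp only [reWave, wave, profile_eq, fourier_torus, Complex.reCLM_apply]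
    rw [e]
    have c1 : ContDiff ℝ ((⊤ : ℕ∞) : WithTop ℕ∞) fun z : ℝ × ℝ × ℝ => ((z.1 : ℝ) : ℂ) :=
      contDiff_ofReal_complex.comp contDiff_fst
    have c2 : ContDiff ℝ ((⊤ : ℕ∞) : WithTop ℕ∞) fun z : ℝ × ℝ × ℝ => ((z.2.1 : ℝ) : ℂ) :=
      contDiff_ofReal_complex.comp (contDiff_fst.comp contDiff_snd)
    have c3 : ContDiff ℝ ((⊤ : ℕ∞) : WithTop ℕ∞) fun z : ℝ × ℝ × ℝ => ((z.2.2 : ℝ) : ℂ) :=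
      contDiff_ofReal_complex.comp (contDiff_snd.comp contDiff_snd)
    have c4 : ContDiff ℝ ((⊤ : ℕ∞) : WithTop ℕ∞) fun z : ℝ × ℝ × ℝ => (starRingEnd ℂ) (p z.2.2) :=
      hp.conj.contDiff.comp (contDiff_snd.comp contDiff_snd)
    exact Complex.reCLM.contDiff.comp
      (((contDiff_const.mul c2).mul contDiff_const).cexp.mul
        ((((contDiff_const.mul c1).mul c3).mul contDiff_const).cexp.mul c4))
  compact := by
    obtain ⟨R, hR⟩ := hp.hasCompactSupport.isCompact.isBounded.subset_closedBall 0
    refine ⟨R, fun t x y hy => ?_⟩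
    have : p y = 0 := by
      by_contra h
      have := hR (subset_tsupport p h)
      rw [mem_closedBall_zero_iff, Real.norm_eq_abs] at this
      linarith
    simp [reWave, wave, profile, twist, this]

theorem dt_profile (k : ℤ) (p : ℝ → ℂ) (t y : ℝ) :
    HasDerivAt (fun s => profile k p s y) (k * y * Complex.I * profile k p t y) t := by
  have h1 : HasDerivAt (fun s : ℝ => (k : ℂ) * s * y * Complex.I) ((k : ℂ) * 1 * y * Complex.I) t :=
    (((hasDerivAt_ofReal_complex t).const_mul _).mul_const _).mul_const _
  simp only [profile_eq]
  exact (h1.cexp.mul_const _).congr_deriv (by ring)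

theorem dy_profile (k : ℤ) {p : ℝ → ℂ} (hp : IsBump p) (t y : ℝ) :
    HasDerivAt (profile k p t) ((starRingEnd ℂ) (deriv (twist (k * t) p) y)) y :=
  ((hp.twist (k * t)).differentiable y).hasDerivAt.star

/-- Plane waves moving with the Couette flow are constant along it. -/
theorem dt_add_mul_dx_reWave (k : ℤ) (p : ℝ → ℂ) (t : ℝ) (x : Torus) (y : ℝ) :
    dt (reWave k (profile k p)) t x y + y * dx (reWave k (profile k p)) t x y = 0 := by
  rw [dt_reWave k (dt_profile k p), dx_reWave]
  simp only [reWave]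
  rw [← Complex.re_ofReal_mul, ← Complex.add_re]
  simp only [wave]
  ring_nf
  simp

theorem dx_reWave_profile (k : ℤ) (p : ℝ → ℂ) (t : ℝ) :
    dx (reWave k (profile k p)) t = fun x y =>
      (wave k (fun y => (starRingEnd ℂ) (k * Complex.I * twist (k * t) p y)) (x, y)).re := by
  rw [dx_reWave]
  ext x y
  simp [reWave, profile]

theorem dy_reWave_profile (k : ℤ) {p : ℝ → ℂ} (hp : IsBump p) (t : ℝ) :
    dy (reWave k (profile k p)) t = fun x y =>
      (wave k (fun y => (starRingEnd ℂ) (deriv (twist (k * t) p) y)) (x, y)).re := by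
  rw [dy_reWave k (dy_profile k hp)]
  rfl

theorem lap_reWave_profile (k : ℤ) {p : ℝ → ℂ} (hp : IsBump p) (t : ℝ) :
    lap (reWave k (profile k p)) t = fun x y =>
      (wave k (fun y => (starRingEnd ℂ) (deriv (deriv (twist (k * t) p)) y +
        -(k : ℂ) ^ 2 * twist (k * t) p y)) (x, y)).re := by
  have h : ∀ t y, HasDerivAt (fun y => (starRingEnd ℂ) (deriv (twist (k * t) p) y))
      ((starRingEnd ℂ) (deriv (deriv (twist (k * t) p)) y)) y := fun t y =>
    ((hp.twist (k * t)).deriv.differentiable y).hasDerivAt.star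
  ext x y
  unfold lap
  rw [dx_reWave, dx_reWave, dy_reWave k (dy_profile k hp), dy_reWave k h]
  simp only [reWave]
  rw [← Complex.add_re]
  congr 1
  simp only [wave, profile, map_add, map_mul, map_neg, map_pow]
  have : (starRingEnd ℂ) (k : ℂ) = k := by simp
  rw [this]
  ring_nf
  rw [Complex.I_sq]
  ring

/-! ### The moving frame -/

theorem shear_add (s : ℝ) (z w : Freq) : shear s (z + w) = shear s z + shear s w := by
  ext
  · rfl
  · simp [shear]; ring

theorem shear_neg_shear (s : ℝ) (z : Freq) : shear (-s) (shear s z) = z := by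
  ext
  · rfl
  · simp [shear]

theorem cross_shear (s : ℝ) (z w : Freq) : cross (shear s z) (shear s w) = cross z w := by
  simp [cross, shear]; ring

theorem disp_eq (s : ℝ) (z : Freq) : disp s z = disp 0 (shear s z) := by simp [disp, shear]

@[fun_prop]
theorem measurable_shear (s : ℝ) : Measurable (shear s) := by
  unfold shear
  have := measurable_int_cast_fst
  fun_prop

theorem measurePreserving_shear (s : ℝ) : MeasurePreserving (shear s) freqMeasure freqMeasure := by
  refine (MeasurePreserving.id (Measure.count : Measure ℤ)).skew_product
    (g := fun (k : ℤ) (ξ : ℝ) => ξ - s * k) ?_ (Eventually.of_forall fun k => ?_)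
  · have := measurable_int_cast_fst
    unfold Function.uncurry
    fun_prop
  · exact (measurePreserving_sub_right (volume : Measure ℝ) (s * k)).map_eq

/-- The shear as a measurable equivalence. -/
def shearEquiv (s : ℝ) : Freq ≃ᵐ Freq where
  toFun := shear s
  invFun := shear (-s)
  left_inv := shear_neg_shear s
  right_inv z := by simpa using shear_neg_shear (-s) z
  measurable_toFun := measurable_shear s
  measurable_invFun := measurable_shear (-s)

theorem measurableEmbedding_shear (s : ℝ) : MeasurableEmbedding (shear s) :=
  (shearEquiv s).measurableEmbedding

theorem integral_shear (s : ℝ) (G : Freq → ℂ) :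
    ∫ z, G (shear s z) ∂freqMeasure = ∫ z, G z ∂freqMeasure :=
  (measurePreserving_shear s).integral_comp (measurableEmbedding_shear s) G

theorem transport_shear (s : ℝ) (g a F : Freq → ℂ) :
    transport (fun z => g (shear s z)) (fun z => a (shear s z)) (fun z => F (shear s z)) =
      transport g a F := by
  have h := ((measurePreserving_shear s).prod (measurePreserving_shear s)).integral_comp
    ((shearEquiv s).prodCongr (shearEquiv s)).measurableEmbedding (transportIntegrand g a F)
  rw [transport, transport, ← h]
  congr 1
  ext q
  simp only [transportIntegrand, Prod.map_fst, Prod.map_snd, ← shear_add, cross_shear]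

theorem weakRhs_shear (ν s : ℝ) (h a F g : Freq → ℂ) :
    weakRhs ν s (fun z => h (shear s z)) (fun z => a (shear s z)) (fun z => F (shear s z))
      (fun z => g (shear s z)) = weakRhs ν 0 h a F g := by
  unfold weakRhs
  rw [transport_shear, ← integral_shear s (fun z => (starRingEnd ℂ) (g z) *
    (h z - (ν * disp 0 z : ℝ) * F z))]
  simp only [← disp_eq]

/-- The Fourier transform of `f` in the frame moving with the Couette flow. -/
def movingHat (s : ℝ) (f : L2) (z : Freq) : ℂ := hatFn f (shear s z)

@[fun_prop]
theorem measurable_movingHat (s : ℝ) (f : L2) : Measurable (movingHat s f) :=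
  (measurable_hatFn f).comp (measurable_shear s)

theorem memLp_movingHat (s : ℝ) (f : L2) : MemLp (movingHat s f) 2 freqMeasure :=
  (memLp_hatFn f).comp_measurePreserving (measurePreserving_shear s)

theorem multNorm_eq {σ : ℤ → ℝ → ℝ} (hσ : Measurable fun z : Freq => σ z.1 z.2) (f : L2) :
    multNorm σ f = l2 freqMeasure fun z => ENNReal.ofReal |σ z.1 z.2| * ‖hatFn f z‖ₑ := by
  have := measurable_hatFn f
  rw [l2, lintegral_freqMeasure (by fun_prop)]
  rfl

theorem lam_eq (t b : ℝ) (z : Freq) : lam t b z.1 z.2 = jap (shear (-t) z) ^ b := by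
  rw [lam, jap, Real.sqrt_eq_rpow, ← Real.rpow_mul (by positivity)]
  simp only [shear]
  ring_nf

theorem multNorm_lam (t m : ℝ) (f : L2) : multNorm (lam t m) f = hnorm m (movingHat t f) := by
  have e : (fun z : Freq => lam t m z.1 z.2) = fun z => jap (shear (-t) z) ^ m :=
    funext (lam_eq t m)
  have hf := measurable_hatFn f
  have hl : Measurable fun z : Freq => lam t m z.1 z.2 := by rw [e]; fun_prop
  rw [multNorm_eq hl, ← l2_comp (by fun_prop) (measurePreserving_shear t)]
  simp only [lam_eq, shear_neg_shear, hnorm, movingHat]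
  congr 1
  ext z
  rw [abs_of_nonneg (Real.rpow_nonneg (jap_pos z).le m)]

theorem measurable_japX (b : ℝ) : Measurable fun z : Freq => japX b z.1 :=
  (measurable_from_top (f := fun n : ℤ => japX b n)).comp measurable_fst

theorem japX_pos (b : ℝ) (k : ℤ) : 0 < japX b k := Real.rpow_pos_of_pos (by positivity) _

theorem multNorm_japX_mul_lam (m₁ t m : ℝ) (f : L2) :
    multNorm (fun k ξ => japX m₁ k * lam t m k ξ) f =
      hnorm m fun z => (japX m₁ z.1 : ℂ) * movingHat t f z := by
  have e : (fun z : Freq => lam t m z.1 z.2) = fun z => jap (shear (-t) z) ^ m :=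
    funext (lam_eq t m)
  have hf := measurable_hatFn f
  have hj := measurable_japX m₁
  have hl : Measurable fun z : Freq => lam t m z.1 z.2 := by rw [e]; fun_prop
  rw [multNorm_eq (by fun_prop), ← l2_comp (by fun_prop) (measurePreserving_shear t)]
  simp only [lam_eq, shear_neg_shear, hnorm, movingHat]
  congr 1
  ext z
  have h1 := japX_pos m₁ z.1
  have h2 := Real.rpow_nonneg (jap_pos z).le m
  rw [show (shear t z).1 = z.1 from rfl, abs_of_nonneg (by positivity), enorm_mul,
    enorm_ofReal_complex, abs_of_pos h1, ENNReal.ofReal_mul h1.le]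
  ring

theorem sobolevNorm_eq (m : ℝ) (f : L2) : sobolevNorm m f = hnorm m (hatFn f) := by
  rw [sobolevNorm, multNorm_lam]
  congr 1
  ext z
  simp [movingHat, shear]

/-- Shearing by the time `s` costs a factor `(1 + |s|)^m` in `H^m`. -/
theorem hnorm_comp_shear_le {m : ℝ} (hm : 0 ≤ m) (s : ℝ) {F : Freq → ℂ} (hF : Measurable F) :
    hnorm m (fun z => F (shear s z)) ≤ ENNReal.ofReal ((1 + |s|) ^ m) * hnorm m F := by
  rw [hnorm, hnorm, ← l2_const_mul ENNReal.ofReal_ne_top, ← l2_comp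
    (f := fun z => ENNReal.ofReal ((1 + |s|) ^ m) * (ENNReal.ofReal (jap z ^ m) * ‖F z‖ₑ))
    (by fun_prop) (measurePreserving_shear s)]
  refine l2_mono fun z => ?_
  rw [← mul_assoc, ← ENNReal.ofReal_mul (by positivity),
    ← Real.mul_rpow (by positivity) (jap_pos _).le]
  gcongr
  · exact (jap_pos z).le
  have := jap_shear_le (-s) (shear s z)
  rwa [shear_neg_shear, abs_neg] at this

theorem hnorm_movingHat_le {m : ℝ} (hm : 0 ≤ m) (s : ℝ) (f : L2) :
    hnorm m (movingHat s f) ≤ ENNReal.ofReal ((1 + |s|) ^ m) * sobolevNorm m f := by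
  rw [sobolevNorm_eq]
  exact hnorm_comp_shear_le hm s (measurable_hatFn f)

theorem movingHat_sub (s : ℝ) (f g : L2) :
    ∀ᵐ z ∂freqMeasure, movingHat s (f - g) z = movingHat s f z - movingHat s g z :=
  (measurePreserving_shear s).quasiMeasurePreserving.ae (hatFn_sub f g)

theorem hnorm_congr_ae {m : ℝ} {F G : Freq → ℂ} (h : ∀ᵐ z ∂freqMeasure, F z = G z) :
    hnorm m F = hnorm m G :=
  l2_congr_ae (h.mono fun z hz => by rw [hz])

theorem hnorm_add_le {m : ℝ} {F G : Freq → ℂ} (hF : Measurable F) (hG : Measurable G) :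
    hnorm m (fun z => F z + G z) ≤ hnorm m F + hnorm m G := by
  refine le_trans (l2_mono fun z => ?_) (l2_add_le (Measurable.aemeasurable (by fun_prop))
    (Measurable.aemeasurable (by fun_prop)))
  rw [← mul_add]
  gcongr
  exact enorm_add_le _ _

theorem enorm_L2_le {m : ℝ} (hm : 0 ≤ m) (f : L2) : ‖f‖ₑ ≤ sobolevNorm m f := by
  rw [Lp.enorm_def, ← hnorm_zero_hatFn, sobolevNorm_eq]
  exact hnorm_mono_exp hm _

/-! ### Continuity in time -/

theorem ContinuousInSobolev.continuousOn {m T : ℝ} (hm : 0 ≤ m) {f : ℝ → L2}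
    (h : ContinuousInSobolev m T f) : ContinuousOn f (Icc 0 T) := by
  intro t ht
  rw [ContinuousWithinAt, tendsto_iff_edist_tendsto_0]
  refine tendsto_of_tendsto_of_tendsto_of_le_of_le tendsto_const_nhds (h.2 t ht)
    (fun _ => zero_le) fun r => ?_
  simp only
  rw [edist_eq_enorm_sub]
  exact enorm_L2_le hm _

theorem sobolevNorm_add_le (m : ℝ) (f g : L2) :
    sobolevNorm m f ≤ sobolevNorm m (f - g) + sobolevNorm m g := by
  rw [sobolevNorm_eq, sobolevNorm_eq, sobolevNorm_eq]
  have h : ∀ᵐ z ∂freqMeasure, hatFn f z = hatFn (f - g) z + hatFn g z := by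
    filter_upwards [hatFn_sub f g] with z hz
    rw [hz, sub_add_cancel]
  rw [hnorm_congr_ae h]
  exact hnorm_add_le (measurable_hatFn _) (measurable_hatFn _)

theorem exists_bound_of_locally_bounded {T : ℝ} {N : ℝ → ℝ≥0∞}
    (h : ∀ t ∈ Icc 0 T, ∃ c : ℝ, ∀ᶠ r in 𝓝[Icc 0 T] t, N r ≤ ENNReal.ofReal c) :
    ∃ c : ℝ, 0 ≤ c ∧ ∀ t ∈ Icc 0 T, N t ≤ ENNReal.ofReal c := by
  refine isCompact_Icc.induction_on (p := fun S => ∃ c : ℝ, 0 ≤ c ∧ ∀ t ∈ S, N t ≤ ENNReal.ofReal c)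
    ⟨0, le_rfl, by simp⟩ ?_ ?_ ?_
  · rintro s t hst ⟨c, hc0, hc⟩
    exact ⟨c, hc0, fun r hr => hc r (hst hr)⟩
  · rintro s t ⟨c, hc0, hc⟩ ⟨d, hd0, hd⟩
    refine ⟨max c d, hc0.trans (le_max_left _ _), fun r hr => ?_⟩
    rcases hr with hr | hr
    · exact (hc r hr).trans (ENNReal.ofReal_le_ofReal (le_max_left _ _))
    · exact (hd r hr).trans (ENNReal.ofReal_le_ofReal (le_max_right _ _))
  · intro t ht
    obtain ⟨c, hc⟩ := h t ht
    exact ⟨_, hc, max c 0, le_max_right _ _, fun r hr =>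
      hr.trans (ENNReal.ofReal_le_ofReal (le_max_left _ _))⟩

theorem ContinuousInSobolev.exists_bound {m T : ℝ} {f : ℝ → L2} (h : ContinuousInSobolev m T f) :
    ∃ c : ℝ, 0 ≤ c ∧ ∀ t ∈ Icc 0 T, sobolevNorm m (f t) ≤ ENNReal.ofReal c := by
  refine exists_bound_of_locally_bounded fun t ht =>
    ⟨1 + (sobolevNorm m (f t)).toReal, ?_⟩
  filter_upwards [(h.2 t ht).eventually_lt_const (u := 1) (by simp)] with r hr
  refine (sobolevNorm_add_le m (f r) (f t)).trans ?_
  rw [ENNReal.ofReal_add (by simp) (by simp), ENNReal.ofReal_toReal (h.1 t ht).ne,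
    ENNReal.ofReal_one]
  gcongr

theorem continuousOn_mul_L1 {S : Set ℝ} {u f : ℝ → L2} (hu : ContinuousOn u S)
    (hf : ContinuousOn f S) : ∃ g : ℝ → Lp ℝ 1 (volume : Measure (Torus × ℝ)),
      ContinuousOn g S ∧ ∀ s, g s =ᵐ[volume] fun z => u s z * f s z := by
  let B := (ContinuousLinearMap.mul ℝ ℝ).holderL (volume : Measure (Torus × ℝ)) 2 2 1
  refine ⟨fun s => B (u s) (f s), (B.continuous.comp_continuousOn hu).clm_apply hf, fun s => ?_⟩
  exact (ContinuousLinearMap.mul ℝ ℝ).coeFn_holder (u s) (f s)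

theorem continuousOn_integral_mul {S : Set ℝ} {g : ℝ → Lp ℝ 1 (volume : Measure (Torus × ℝ))}
    (hg : ContinuousOn g S) {ψ : ℝ → Torus × ℝ → ℝ} (hψ : Continuous (Function.uncurry ψ)) {c : ℝ}
    (hc : ∀ s ∈ S, ∀ z, |ψ s z| ≤ c) : ContinuousOn (fun s => ∫ z, g s z * ψ s z) S := by
  have mψ : ∀ s, AEStronglyMeasurable (ψ s) volume := fun s =>
    (hψ.comp (by fun_prop : Continuous fun z => (s, z))).aestronglyMeasurable
  have hi : ∀ s ∈ S, ∀ v : Lp ℝ 1 (volume : Measure (Torus × ℝ)),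
      Integrable (fun z => v z * ψ s z) := fun s hs v =>
    (L1.integrable_coeFn v).mul_bdd (c := c) (mψ s) (Eventually.of_forall (hc s hs))
  intro r hr
  have hc0 : ContinuousWithinAt (fun s => ∫ z, g r z * ψ s z) S r := by
    refine continuousWithinAt_of_dominated (bound := fun z => ‖g r z‖ * c) ?_ ?_ ?_ ?_
    · exact Eventually.of_forall fun s => (Lp.aestronglyMeasurable _).mul (mψ s)
    · filter_upwards [self_mem_nhdsWithin] with s hs
      refine Eventually.of_forall fun z => ?_
      rw [norm_mul]
      gcongr
      exact hc s hs z
    · exact (L1.integrable_coeFn (g r)).norm.mul_const c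
    · refine Eventually.of_forall fun z => Continuous.continuousWithinAt ?_
      exact continuous_const.mul (hψ.comp (by fun_prop : Continuous fun s => (s, z)))
  have hd : Tendsto (fun s => ∫ z, (g s - g r : Lp ℝ 1 (volume : Measure (Torus × ℝ))) z * ψ s z)
      (𝓝[S] r) (𝓝 0) := by
    have h1 : Tendsto (fun s => ‖g s - g r‖ * c) (𝓝[S] r) (𝓝 0) := by
      have := ((hg r hr).sub_const (g r)).norm.mul_const c
      simpa using this
    refine squeeze_zero_norm' ?_ h1
    filter_upwards [self_mem_nhdsWithin] with s hs
    refine (norm_integral_le_integral_norm _).trans ?_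
    rw [L1.norm_eq_integral_norm, ← integral_mul_const]
    refine integral_mono_of_nonneg (Eventually.of_forall fun z => norm_nonneg _)
      ((L1.integrable_coeFn _).norm.mul_const c) (Eventually.of_forall fun z => ?_)
    simp only [norm_mul]
    gcongr
    exact hc s hs z
  have h := hd.add hc0
  rw [zero_add] at h
  refine h.congr' ?_
  filter_upwards [self_mem_nhdsWithin] with s hs
  rw [← integral_add (hi s hs _) (hi s hs _)]
  refine integral_congr_ae ?_
  filter_upwards [Lp.coeFn_sub (g s) (g r)] with z hz
  rw [hz, Pi.sub_apply]
  ring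

theorem continuousOn_integral_mul_mul {S : Set ℝ} {u f : ℝ → L2}
    (hu : ContinuousOn u S) (hf : ContinuousOn f S) {ψ : ℝ → Torus × ℝ → ℝ}
    (hψ : Continuous (Function.uncurry ψ)) {c : ℝ} (hc : ∀ s ∈ S, ∀ z, |ψ s z| ≤ c) :
    ContinuousOn (fun s => ∫ z, u s z * f s z * ψ s z) S := by
  obtain ⟨g, hg, he⟩ := continuousOn_mul_L1 hu hf
  refine (continuousOn_integral_mul hg hψ hc).congr fun s _ => integral_congr_ae ?_
  filter_upwards [he s] with z hz
  rw [hz]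

theorem continuousOn_integral_mul_L2 {S : Set ℝ} {f : ℝ → L2} (hf : ContinuousOn f S)
    {ψ : ℝ → Torus × ℝ → ℝ} (hψ : Continuous (Function.uncurry ψ)) {c : ℝ}
    (hc : ∀ s ∈ S, ∀ z, |ψ s z| ≤ c) {K : Set ℝ} (hK : IsCompact K)
    (h0 : ∀ s z, z.2 ∉ K → ψ s z = 0) :
    ContinuousOn (fun s => ∫ z, f s z * ψ s z) S := by
  have hms : MeasurableSet ((univ : Set Torus) ×ˢ K) := MeasurableSet.univ.prod hK.measurableSet
  have hfin : (volume : Measure (Torus × ℝ)) (univ ×ˢ K) ≠ ∞ :=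
    (isCompact_univ.prod hK).measure_lt_top.ne
  let χ : L2 := indicatorConstLp 2 hms hfin 1
  refine (continuousOn_integral_mul_mul (u := fun _ => χ) continuousOn_const hf hψ hc).congr
    fun s _ => integral_congr_ae ?_
  filter_upwards [indicatorConstLp_coeFn (p := 2) (hs := hms) (hμs := hfin) (c := (1 : ℝ))]
    with z hz
  by_cases hzK : z.2 ∈ K
  · rw [hz, indicator_of_mem (by simpa using hzK), one_mul]
  · rw [h0 s z hzK, mul_zero, mul_zero]

/-! ### The weak formulation in frequency space -/

section

variable (k : ℤ) {p : ℝ → ℂ}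

theorem integrable_mul_re_wave (hp : IsBump p) (f : L2) :
    Integrable fun z => f z * (wave k (fun y => (starRingEnd ℂ) (p y)) z).re := by
  refine (integrable_mul_wave f k hp.conj.continuous hp.conj.hasCompactSupport).re.congr
    (Eventually.of_forall fun z => ?_)
  exact Complex.re_ofReal_mul _ _

theorem integral_mul_re_wave (hp : IsBump p) (f : L2) :
    ∫ z, f z * (wave k (fun y => (starRingEnd ℂ) (p y)) z).re =
      (∫ z, (starRingEnd ℂ) (testFn k p z) * hatFn f z ∂freqMeasure).re := by
  rw [← integral_mul_wave_conj f k hp]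
  refine Eq.trans ?_
    (integral_re (integrable_mul_wave f k hp.conj.continuous hp.conj.hasCompactSupport))
  refine integral_congr_ae (Eventually.of_forall fun z => ?_)
  exact (Complex.re_ofReal_mul _ _).symm

theorem integrable_mul_mul_re_wave (hp : IsBump p) (u f : L2) :
    Integrable fun z => u z * f z * (wave k (fun y => (starRingEnd ℂ) (p y)) z).re := by
  refine (integrable_mul_mul_wave u f k hp.conj.continuous hp.conj.hasCompactSupport).re.congr
    (Eventually.of_forall fun z => ?_)
  simp only
  rw [← Complex.ofReal_mul]
  exact Complex.re_ofReal_mul _ _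

theorem integral_mul_mul_re_wave (hp : IsBump p) (u f : L2) :
    ∫ z, u z * f z * (wave k (fun y => (starRingEnd ℂ) (p y)) z).re =
      (2 * Real.pi)⁻¹ *
        (∫ q, prodIntegrand k p (hatFn u) (hatFn f) q ∂freqMeasure.prod freqMeasure).re := by
  have h := integral_mul_mul_wave_conj u f k hp
  rw [← Complex.re_ofReal_mul, ← h]
  refine Eq.trans ?_
    (integral_re (integrable_mul_mul_wave u f k hp.conj.continuous hp.conj.hasCompactSupport))
  refine integral_congr_ae (Eventually.of_forall fun z => ?_)
  simp only
  rw [← Complex.ofReal_mul]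
  exact (Complex.re_ofReal_mul _ _).symm

theorem integrable_zeroMode_mul_re_wave (hp : IsBump p) (u f : L2) :
    Integrable fun z : Torus × ℝ =>
      zeroMode u z.2 * f z * (wave k (fun y => (starRingEnd ℂ) (p y)) z).re := by
  refine (integral_zeroMode_mul_wave_conj u f k hp).1.re.congr (Eventually.of_forall fun z => ?_)
  simp only
  rw [← Complex.ofReal_mul]
  exact Complex.re_ofReal_mul _ _

theorem integral_zeroMode_mul_re_wave (hp : IsBump p) (u f : L2) :
    ∫ z : Torus × ℝ, zeroMode u z.2 * f z * (wave k (fun y => (starRingEnd ℂ) (p y)) z).re =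
      (2 * Real.pi)⁻¹ * (∫ q, prodIntegrand k p (zeroPart (hatFn u)) (hatFn f) q
        ∂freqMeasure.prod freqMeasure).re := by
  obtain ⟨hi, h⟩ := integral_zeroMode_mul_wave_conj u f k hp
  rw [← Complex.re_ofReal_mul, ← h]
  refine Eq.trans ?_ (integral_re hi)
  refine integral_congr_ae (Eventually.of_forall fun z => ?_)
  simp only
  rw [← Complex.ofReal_mul]
  exact (Complex.re_ofReal_mul _ _).symm

theorem testFn_dx (p : ℝ → ℂ) (z : Freq) :
    testFn k (fun y => k * Complex.I * p y) z = z.1 * Complex.I * testFn k p z := by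
  rw [testFn_const_mul]
  by_cases hz : z.1 = k
  · rw [hz]
  · simp [testFn, hz]

theorem testFn_lap (hp : IsBump p) (z : Freq) :
    testFn k (fun y => deriv (deriv p) y + -(k : ℂ) ^ 2 * p y) z = -(disp 0 z) * testFn k p z := by
  rw [testFn_add k hp.deriv.deriv (hp.const_mul _), testFn_deriv k hp.deriv, testFn_deriv k hp,
    testFn_const_mul]
  by_cases hz : z.1 = k
  · rw [← hz]
    simp only [disp, zero_mul, sub_zero]
    push_cast
    linear_combination ((z.2 : ℂ) ^ 2 * testFn z.1 p z) * Complex.I_sq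
  · simp [testFn, hz]

end

/-- The Biot-Savart law for the Fourier transforms, almost everywhere in frequency space. -/
theorem IsBiotSavart.ae {ω u₁ u₂ : L2} (h : IsBiotSavart ω u₁ u₂) :
    ∀ᵐ z ∂freqMeasure, hatFn u₁ z = Complex.I * z.2 * (hatFn ω z / disp 0 z) ∧
      hatFn u₂ z = -(Complex.I * z.1) * (hatFn ω z / disp 0 z) := by
  refine ae_of_ae_fiber fun k => ?_
  filter_upwards [h k] with ξ hξ
  simp only [hatFn, disp, zero_mul, sub_zero]
  push_cast
  rw [hξ.1, hξ.2]
  constructor <;> ring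

theorem ae_fst_of_ae {P : Freq → Prop} (h : ∀ᵐ z ∂freqMeasure, P z) :
    ∀ᵐ q ∂freqMeasure.prod freqMeasure, P q.1 :=
  Measure.quasiMeasurePreserving_fst.ae h

theorem transport_of_biotSavart (k : ℤ) {p : ℝ → ℂ} (hp : IsBump p) {ω u₁ u₂ : L2}
    (h : IsBiotSavart ω u₁ u₂) (f : L2) :
    (∫ q, prodIntegrand k (fun y => k * Complex.I * p y) (hatFn u₁) (hatFn f) q
        ∂freqMeasure.prod freqMeasure) +
      ∫ q, prodIntegrand k (deriv p) (hatFn u₂) (hatFn f) q ∂freqMeasure.prod freqMeasure =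
    transport (testFn k p) (fun z => hatFn ω z / disp 0 z) (hatFn f) := by
  rw [← integral_add (integrable_prodIntegrand k (hp.const_mul _) (measurable_hatFn _)
    (measurable_hatFn _) (memLp_hatFn _) (memLp_hatFn _)) (integrable_prodIntegrand k hp.deriv
    (measurable_hatFn _) (measurable_hatFn _) (memLp_hatFn _) (memLp_hatFn _)), transport]
  refine integral_congr_ae ?_
  filter_upwards [ae_fst_of_ae h.ae] with q hq
  simp only [prodIntegrand, transportIntegrand, hq.1, hq.2, testFn_dx, testFn_deriv k hp, map_mul,
    Complex.conj_I, Complex.conj_ofReal, cross, Prod.fst_add, Prod.snd_add]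
  push_cast
  simp only [map_add, map_intCast]
  linear_combination (-(starRingEnd ℂ) (testFn k p (q.1 + q.2)) * (hatFn ω q.1 / disp 0 q.1) *
    hatFn f q.2 * ((q.1.1 + q.2.1) * q.1.2 - (q.1.2 + q.2.2) * q.1.1)) * Complex.I_sq

theorem transport_of_biotSavart_zeroPart (k : ℤ) (p : ℝ → ℂ) {ω u₁ u₂ : L2}
    (h : IsBiotSavart ω u₁ u₂) (f : L2) :
    ∫ q, prodIntegrand k (fun y => k * Complex.I * p y) (zeroPart (hatFn u₁)) (hatFn f) q
        ∂freqMeasure.prod freqMeasure =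
    transport (testFn k p) (fun z => zeroPart (fun z => hatFn ω z / disp 0 z) z) (hatFn f) := by
  rw [transport]
  refine integral_congr_ae ?_
  filter_upwards [ae_fst_of_ae h.ae] with q hq
  simp only [prodIntegrand, transportIntegrand, zeroPart]
  split_ifs with h0
  · simp only [hq.1, testFn_dx, map_mul, Complex.conj_I, cross, Prod.fst_add, h0]
    simp only [zero_add, map_intCast, Int.cast_zero, zero_mul, sub_zero]
    push_cast
    linear_combination (-(starRingEnd ℂ) (testFn k p (q.1 + q.2)) * (hatFn ω q.1 / disp 0 q.1) *
      hatFn f q.2 * (q.2.1 * q.1.2)) * Complex.I_sq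
  · simp

theorem integrable_conj_testFn_mul (k : ℤ) {p : ℝ → ℂ} (hp : IsBump p) (f : L2) :
    Integrable (fun z => (starRingEnd ℂ) (testFn k p z) * hatFn f z) freqMeasure :=
  (memLp_conj (memLp_testFn k hp)).integrable_mul (memLp_hatFn f)

theorem IsBump.lap {p : ℝ → ℂ} (hp : IsBump p) (k : ℤ) :
    IsBump fun y => _root_.deriv (_root_.deriv p) y + -(k : ℂ) ^ 2 * p y :=
  hp.deriv.deriv.add (hp.const_mul _)

/-- The linear terms of the equation, tested with a plane wave. -/
theorem linear_terms_eq (ν : ℝ) (k : ℤ) {p : ℝ → ℂ} (hp : IsBump p) (f g : L2) :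
    ν * (∫ z, f z * (wave k (fun y => (starRingEnd ℂ) (deriv (deriv p) y + -(k : ℂ) ^ 2 * p y))
        z).re) -
      ∫ z, g z * (wave k (fun y => (starRingEnd ℂ) (k * Complex.I * p y)) z).re =
    (∫ z, (starRingEnd ℂ) (testFn k p z) * (Complex.I * z.1 * hatFn g z -
      (ν * disp 0 z : ℝ) * hatFn f z) ∂freqMeasure).re := by
  rw [integral_mul_re_wave k (hp.lap k), integral_mul_re_wave k (hp.const_mul _),
    ← Complex.re_ofReal_mul, ← Complex.sub_re, ← integral_const_mul,
    ← integral_sub ((integrable_conj_testFn_mul k (hp.lap k) f).const_mul _)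
      (integrable_conj_testFn_mul k (hp.const_mul _) g)]
  congr 2
  ext z
  rw [testFn_lap k hp, testFn_dx]
  simp only [map_mul, map_neg, Complex.conj_I, Complex.conj_ofReal, map_intCast]
  push_cast
  ring

theorem vorticity_terms_eq (ν : ℝ) (k : ℤ) {p : ℝ → ℂ} (hp : IsBump p) {ω u₁ u₂ : L2}
    (h : IsBiotSavart ω u₁ u₂) (θ : L2) :
    ν * (∫ z, ω z * (wave k (fun y => (starRingEnd ℂ) (deriv (deriv p) y + -(k : ℂ) ^ 2 * p y))
        z).re) -
      (∫ z, θ z * (wave k (fun y => (starRingEnd ℂ) (k * Complex.I * p y)) z).re) +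
      ((∫ z, u₁ z * ω z * (wave k (fun y => (starRingEnd ℂ) (k * Complex.I * p y)) z).re) +
      ∫ z, u₂ z * ω z * (wave k (fun y => (starRingEnd ℂ) (deriv p y)) z).re) =
    weakRhs ν 0 (fun z => Complex.I * z.1 * hatFn θ z) (fun z => hatFn ω z / disp 0 z) (hatFn ω)
      (testFn k p) := by
  rw [linear_terms_eq ν k hp, integral_mul_mul_re_wave k (hp.const_mul _),
    integral_mul_mul_re_wave k hp.deriv, ← mul_add, ← Complex.add_re,
    transport_of_biotSavart k hp h, weakRhs]

theorem temperature_terms_eq (ν : ℝ) (k : ℤ) {p : ℝ → ℂ} (hp : IsBump p) {ω u₁ u₂ : L2}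
    (h : IsBiotSavart ω u₁ u₂) (θ : L2) :
    ν * (∫ z, θ z * (wave k (fun y => (starRingEnd ℂ) (deriv (deriv p) y + -(k : ℂ) ^ 2 * p y))
        z).re) +
      (∫ z : Torus × ℝ, zeroMode u₁ z.2 * θ z *
        (wave k (fun y => (starRingEnd ℂ) (k * Complex.I * p y)) z).re) =
    weakRhs ν 0 (fun _ => 0) (zeroPart fun z => hatFn ω z / disp 0 z) (hatFn θ) (testFn k p) := by
  obtain ⟨o, ho⟩ : ∃ o : L2, o = 0 := ⟨0, rfl⟩
  have h1 := linear_terms_eq ν k hp θ o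
  have h2 : ∫ z, o z * (wave k (fun y => (starRingEnd ℂ) (k * Complex.I * p y)) z).re = 0 := by
    refine integral_eq_zero_of_ae ?_
    rw [ho]
    filter_upwards [Lp.coeFn_zero ℝ 2 (volume : Measure (Torus × ℝ))] with z hz
    rw [hz]
    simp
  have h3 : ∀ᵐ z ∂freqMeasure, hatFn o z = 0 := by
    filter_upwards [hatFn_sub o o] with z hz
    rw [sub_self, sub_self, ← ho] at hz
    exact hz
  rw [h2, sub_zero] at h1
  rw [h1, integral_zeroMode_mul_re_wave k (hp.const_mul _), transport_of_biotSavart_zeroPart k p h,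
    weakRhs]
  congr 2
  refine integral_congr_ae ?_
  filter_upwards [h3] with z hz
  rw [hz, mul_zero]

/-! ### Differentiability in time of the tested equations -/

theorem deriv_deriv_twist {p : ℝ → ℂ} (hp : IsBump p) (c : ℝ) :
    deriv (deriv (twist c p)) = twist c fun y =>
      (deriv (deriv p) y + -(c * Complex.I) * deriv p y) +
        -(c * Complex.I) * (deriv p y + -(c * Complex.I) * p y) := by
  rw [deriv_twist hp, deriv_twist (hp.deriv_add_mul _)]
  congr 1
  ext y
  have := ((hp.deriv.differentiable y).hasDerivAt.add
    ((hp.differentiable y).hasDerivAt.const_mul (-(c * Complex.I)))).deriv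
  congr 1

/-- Profiles in `y`, depending continuously on a time, with a common compact support. -/
structure IsProfileFamily (Q : ℝ → ℝ → ℂ) : Prop where
  continuous : Continuous (Function.uncurry Q)
  compact : ∃ K : Set ℝ, IsCompact K ∧ ∀ s, ∀ y ∉ K, Q s y = 0

namespace IsProfileFamily

variable {Q : ℝ → ℝ → ℂ}

theorem exists_bound (h : IsProfileFamily Q) (T : ℝ) :
    ∃ c : ℝ, ∀ s ∈ Icc 0 T, ∀ y, ‖Q s y‖ ≤ c := by
  obtain ⟨K, hK, h0⟩ := h.compact
  obtain ⟨c, hc⟩ := ((isCompact_Icc (a := 0) (b := T)).prod hK).exists_bound_of_continuousOn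
    h.continuous.continuousOn
  refine ⟨max c 0, fun s hs y => ?_⟩
  by_cases hy : y ∈ K
  · exact (hc (s, y) ⟨hs, hy⟩).trans (le_max_left _ _)
  · rw [h0 s y hy, norm_zero]
    exact le_max_right _ _

theorem continuous_re_wave (h : IsProfileFamily Q) (k : ℤ) :
    Continuous (Function.uncurry fun s z => (wave k (Q s) z).re) := by
  unfold wave Function.uncurry
  have h1 : Continuous fun q : ℝ × (Torus × ℝ) => Q q.1 q.2.2 :=
    h.continuous.comp (by fun_prop : Continuous fun q : ℝ × (Torus × ℝ) => (q.1, q.2.2))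
  have h2 : Continuous fun q : ℝ × (Torus × ℝ) => (fourier (-k) q.2.1 : ℂ) :=
    (map_continuous (fourier (-k))).comp (by fun_prop)
  exact Complex.continuous_re.comp (h2.mul h1)

theorem abs_re_wave_le {c T : ℝ} (hc : ∀ s ∈ Icc 0 T, ∀ y, ‖Q s y‖ ≤ c) (k : ℤ) :
    ∀ s ∈ Icc 0 T, ∀ z, |(wave k (Q s) z).re| ≤ c := fun s hs z =>
  (Complex.abs_re_le_norm _).trans (by rw [norm_wave]; exact hc s hs _)

theorem continuousOn_integral (h : IsProfileFamily Q) (k : ℤ) {T : ℝ} {f : ℝ → L2}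
    (hf : ContinuousOn f (Icc 0 T)) :
    ContinuousOn (fun s => ∫ z, f s z * (wave k (Q s) z).re) (Icc 0 T) := by
  obtain ⟨c, hc⟩ := h.exists_bound T
  obtain ⟨K, hK, h0⟩ := h.compact
  exact continuousOn_integral_mul_L2 hf (h.continuous_re_wave k) (abs_re_wave_le hc k) hK
    fun s z hz => by simp [wave, h0 s _ hz]

theorem continuousOn_integral_mul (h : IsProfileFamily Q) (k : ℤ) {T : ℝ} {u f : ℝ → L2}
    (hu : ContinuousOn u (Icc 0 T)) (hf : ContinuousOn f (Icc 0 T)) :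
    ContinuousOn (fun s => ∫ z, u s z * f s z * (wave k (Q s) z).re) (Icc 0 T) := by
  obtain ⟨c, hc⟩ := h.exists_bound T
  exact continuousOn_integral_mul_mul hu hf (h.continuous_re_wave k) (abs_re_wave_le hc k)

theorem of_twist {P : ℝ → ℝ → ℂ} (hP : Continuous (Function.uncurry P))
    (h0 : ∃ K : Set ℝ, IsCompact K ∧ ∀ s, ∀ y ∉ K, P s y = 0) (k : ℤ) :
    IsProfileFamily fun s y => (starRingEnd ℂ) (twist (k * s) (P s) y) where
  continuous := by
    refine Complex.continuous_conj.comp ?_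
    unfold twist
    refine Continuous.mul ?_ hP
    fun_prop
  compact := by
    obtain ⟨K, hK, h⟩ := h0
    exact ⟨K, hK, fun s y hy => by simp [twist, h s y hy]⟩

end IsProfileFamily

section

variable (k : ℤ) {p : ℝ → ℂ}

theorem isProfileFamily_dx (hp : IsBump p) :
    IsProfileFamily fun s y => (starRingEnd ℂ) (k * Complex.I * twist (k * s) p y) := by
  have hc := hp.continuous
  have := IsProfileFamily.of_twist (P := fun _ y => k * Complex.I * p y)
    (by unfold Function.uncurry; fun_prop)
    ⟨_, hp.hasCompactSupport, fun s y hy => by simp [image_eq_zero_of_notMem_tsupport hy]⟩ k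
  convert this using 4
  simp only [twist]
  ring

theorem eq_zero_of_notMem_tsupport (p : ℝ → ℂ) {y : ℝ} (hy : y ∉ tsupport p) :
    p y = 0 ∧ deriv p y = 0 ∧ deriv (deriv p) y = 0 := by
  have h1 : y ∉ tsupport (deriv p) := fun h => hy (tsupport_deriv_subset h)
  have h2 : y ∉ tsupport (deriv (deriv p)) := fun h => h1 (tsupport_deriv_subset h)
  exact ⟨image_eq_zero_of_notMem_tsupport hy, image_eq_zero_of_notMem_tsupport h1,
    image_eq_zero_of_notMem_tsupport h2⟩

theorem isProfileFamily_dy (hp : IsBump p) :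
    IsProfileFamily fun s y => (starRingEnd ℂ) (deriv (twist (k * s) p) y) := by
  have hc := hp.continuous
  have hc' := hp.deriv.continuous
  simp_rw [deriv_twist hp]
  refine IsProfileFamily.of_twist (P := fun s y => deriv p y + -((k * s : ℝ) * Complex.I) * p y)
    ?_ ⟨_, hp.hasCompactSupport, fun s y hy => ?_⟩ k
  · unfold Function.uncurry
    fun_prop
  · obtain ⟨h0, h1, -⟩ := eq_zero_of_notMem_tsupport p hy
    simp [h0, h1]

theorem isProfileFamily_lap (hp : IsBump p) :
    IsProfileFamily fun s y => (starRingEnd ℂ) (deriv (deriv (twist (k * s) p)) y +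
        -(k : ℂ) ^ 2 * twist (k * s) p y) := by
  have hc := hp.continuous
  have hc' := hp.deriv.continuous
  have hc'' := hp.deriv.deriv.continuous
  simp_rw [deriv_deriv_twist hp]
  have := IsProfileFamily.of_twist (P := fun s y =>
    ((deriv (deriv p) y + -((k * s : ℝ) * Complex.I) * deriv p y) +
        -((k * s : ℝ) * Complex.I) * (deriv p y + -((k * s : ℝ) * Complex.I) * p y)) +
      -(k : ℂ) ^ 2 * p y) ?_ ⟨_, hp.hasCompactSupport, fun s y hy => ?_⟩ k
  · convert this using 4
    simp only [twist]
    ring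
  · unfold Function.uncurry
    fun_prop
  · obtain ⟨h0, h1, h2⟩ := eq_zero_of_notMem_tsupport p hy
    simp [h0, h1, h2]

end

theorem hasDerivWithinAt_of_integral_eq {T : ℝ} {P J : ℝ → ℝ} (hJ : ContinuousOn J (Icc 0 T))
    (h : ∀ t ∈ Icc 0 T, P t - P 0 = ∫ s in (0 : ℝ)..t, J s) :
    ∀ s ∈ Icc 0 T, HasDerivWithinAt P (J s) (Icc 0 T) s := by
  intro s hs
  have hT : 0 ≤ T := hs.1.trans hs.2
  have hc : Continuous (IccExtend hT ((Icc 0 T).domRestrict J)) :=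
    (continuousOn_iff_continuous_domRestrict.1 hJ).Icc_extend'
  have he : ∀ r ∈ Icc 0 T, IccExtend hT ((Icc 0 T).domRestrict J) r = J r := fun r hr => by
    rw [IccExtend_of_mem hT _ hr]
    rfl
  have h1 := ((hc.integral_hasStrictDerivAt 0 s).hasDerivAt.const_add (P 0)).hasDerivWithinAt
    (s := Icc 0 T)
  rw [he s hs] at h1
  refine h1.congr_of_mem (fun r hr => ?_) hs
  have h2 := h r hr
  have h3 : ∫ s in (0 : ℝ)..r, IccExtend hT ((Icc 0 T).domRestrict J) s =
      ∫ s in (0 : ℝ)..r, J s := by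
    refine intervalIntegral.integral_congr fun x hx => ?_
    rw [uIcc_of_le hr.1] at hx
    exact he x ⟨hx.1, hx.2.trans hr.2⟩
  rw [h3]
  linarith

theorem integral_mul_reWave (k : ℤ) {p : ℝ → ℂ} (hp : IsBump p) (s : ℝ) (f : L2) :
    ∫ z : Torus × ℝ, f z * reWave k (profile k p) s z.1 z.2 =
      (∫ z, (starRingEnd ℂ) (testFn k p z) * movingHat s f z ∂freqMeasure).re := by
  have h := integral_mul_re_wave k (hp.twist (k * s)) f
  refine Eq.trans h ?_
  rw [← integral_shear s]
  simp_rw [testFn_twist, shear_neg_shear]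
  rfl

theorem weakRhs_twist (ν s : ℝ) (k : ℤ) (p : ℝ → ℂ) (h a F : Freq → ℂ) :
    weakRhs ν 0 h a F (testFn k (twist (k * s) p)) =
      weakRhs ν s (fun z => h (shear s z)) (fun z => a (shear s z)) (fun z => F (shear s z))
        (testFn k p) := by
  rw [← weakRhs_shear ν s]
  congr 1
  ext z
  rw [testFn_twist, shear_neg_shear]

/-! ### Continuity in time of the mean shear flow -/

theorem eLpNorm_zeroMode_le (u : L2) :
    eLpNorm (fun z : Torus × ℝ => ((zeroMode u z.2 : ℝ) : ℂ)) 2 volume ≤ eLpNorm u 2 volume := by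
  refine (ENNReal.pow_le_pow_left_iff two_ne_zero).1 ?_
  have hm := measurable_xMode_uncurry u
  have hm0 : Measurable (xMode u 0) := (stronglyMeasurable_xMode u 0).measurable
  rw [← two_pi_mul_tsum_lintegral_xMode, ← l2_enorm_eq_eLpNorm, l2_sq]
  simp_rw [zeroMode_eq_xMode]
  rw [Measure.volume_eq_prod, lintegral_prod_symm _ (Measurable.aemeasurable (by fun_prop)),
    lintegral_freqMeasure (by fun_prop), ← ENNReal.tsum_mul_left]
  refine le_trans (le_of_eq ?_) (ENNReal.le_tsum (0 : ℤ))
  rw [← lintegral_const_mul _ (by fun_prop)]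
  refine lintegral_congr fun y => ?_
  dsimp only
  rw [lintegral_const, mul_comm]
  congr 1
  rw [volume_torus]
  simp

theorem exists_zeroMode_continuousOn {S : Set ℝ} {u : ℝ → L2} (hu : ContinuousOn u S) :
    ∃ v : ℝ → L2, ContinuousOn v S ∧
      ∀ s, v s =ᵐ[volume] fun z : Torus × ℝ => zeroMode (u s) z.2 := by
  have hm : ∀ w : L2, MemLp (fun z : Torus × ℝ => zeroMode w z.2) 2 := fun w => by
    simpa using (memLp_zeroMode w).re
  refine ⟨fun s => (hm (u s)).toLp _, fun s hs => ?_, fun s => (hm (u s)).coeFn_toLp⟩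
  rw [ContinuousWithinAt, tendsto_iff_edist_tendsto_0]
  refine tendsto_of_tendsto_of_tendsto_of_le_of_le tendsto_const_nhds
    (tendsto_iff_edist_tendsto_0.1 (hu s hs)) (fun _ => zero_le) fun r => ?_
  simp only
  rw [Lp.edist_toLp_toLp, edist_eq_enorm_sub, Lp.enorm_def]
  refine le_trans (le_of_eq ?_) (eLpNorm_zeroMode_le (u r - u s))
  refine eLpNorm_congr_norm_ae ?_
  have h : ∀ᵐ z : Torus × ℝ ∂(volume : Measure Torus).prod (volume : Measure ℝ),
      xMode (u r - u s) 0 z.2 = xMode (u r) 0 z.2 - xMode (u s) 0 z.2 :=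
    Measure.quasiMeasurePreserving_snd.ae (xMode_sub (u r) (u s) 0)
  filter_upwards [h] with z hz
  rw [zeroMode_eq_xMode, hz, ← zeroMode_eq_xMode, ← zeroMode_eq_xMode, ← Complex.ofReal_sub,
    Complex.norm_real]
  rfl

/-! ### Bounds for the stream function -/

theorem one_le_disp (s : ℝ) {z : Freq} (hz : z.1 ≠ 0) : 1 ≤ disp s z := by
  have h1 : (1 : ℝ) ≤ |(z.1 : ℝ)| := by
    rw [← Int.cast_abs]
    exact_mod_cast Int.one_le_abs hz
  have h2 := sq_abs (z.1 : ℝ)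
  unfold disp
  nlinarith [sq_nonneg (z.2 - s * z.1)]

/-- For `k ≠ 0` the symbol of `-Δ` in the moving frame degenerates at most like `(1 + s)⁻²`. -/
theorem len_sq_div_disp_le {s : ℝ} (hs : 0 ≤ s) (z : Freq) (x : ℂ) :
    len z ^ 2 * ‖x / disp s z‖ ≤ 2 * (1 + s) * (jap z * ‖x‖) := by
  have hj := one_le_jap z
  rw [norm_div, Complex.norm_real, Real.norm_eq_abs, abs_of_nonneg (disp_nonneg s z)]
  rcases (disp_nonneg s z).eq_or_lt with h0 | h0
  · rw [← h0]
    simp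
    positivity
  rw [← mul_div_assoc, div_le_iff₀ h0]
  suffices h : len z ^ 2 ≤ 2 * (1 + s) * jap z * disp s z by
    nlinarith [mul_le_mul_of_nonneg_right h (norm_nonneg x)]
  by_cases hz : z.1 = 0
  · have : disp s z = len z ^ 2 := by simp [disp, len_sq, hz]
    rw [this]
    refine le_mul_of_one_le_left (sq_nonneg _) ?_
    nlinarith
  · have hd1 := one_le_disp s hz
    have h2 : len z ≤ 2 * (1 + s) * disp s z := by
      refine abs_le_of_sq_le_sq' ?_ (by positivity) |>.2
      have h3 : len z ^ 2 ≤ (2 * (1 + s)) ^ 2 * disp s z := by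
        rw [len_sq, disp]
        set η := z.2 - s * z.1 with hη
        have : z.2 = η + s * z.1 := by rw [hη]; ring
        rw [this]
        nlinarith [sq_nonneg (η - s * z.1), sq_nonneg η, sq_nonneg (z.1 : ℝ),
          mul_nonneg hs (sq_nonneg (z.1 : ℝ)), mul_nonneg hs (sq_nonneg η),
          mul_nonneg (sq_nonneg s) (sq_nonneg η)]
      refine h3.trans ?_
      rw [mul_pow (2 * (1 + s)) (disp s z)]
      exact mul_le_mul_of_nonneg_left (by nlinarith) (by positivity)
    have h4 := len_le_jap z
    have h5 := len_nonneg z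
    calc len z ^ 2 = len z * len z := sq _
      _ ≤ jap z * (2 * (1 + s) * disp s z) := by gcongr
      _ = _ := by ring

theorem len_sq_zeroPart_le (s : ℝ) (F : Freq → ℂ) (z : Freq) :
    len z ^ 2 * ‖zeroPart (fun z => F z / disp s z) z‖ ≤ 1 * (jap z * ‖F z‖) := by
  unfold zeroPart
  split_ifs with hz
  · have : disp s z = len z ^ 2 := by simp [disp, len_sq, hz]
    rw [norm_div, Complex.norm_real, this, Real.norm_eq_abs, abs_of_nonneg (sq_nonneg _), one_mul]
    refine le_trans ?_ (le_mul_of_one_le_left (norm_nonneg _) (one_le_jap z))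
    rcases eq_or_ne (len z ^ 2) 0 with h0 | h0
    · simp [h0]
    · exact (mul_div_cancel₀ _ h0).le
  · have := jap_pos z
    simp
    positivity

/-- The low frequencies of the mean flow, which are not controlled by the vorticity. -/
def lowSet : Set Freq := {0} ×ˢ Icc (-1) 1

theorem measurableSet_lowSet : MeasurableSet lowSet :=
  (measurableSet_singleton 0).prod measurableSet_Icc

theorem lowSet_lt_top : freqMeasure lowSet < ∞ := by
  unfold lowSet
  rw [Measure.prod_prod, Measure.count_singleton, one_mul, Real.volume_Icc]
  exact ENNReal.ofReal_lt_top

theorem len_mul_stream_le {ω u₁ u₂ : L2} (h : IsBiotSavart ω u₁ u₂) (s : ℝ) :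
    ∀ᵐ z ∂freqMeasure, ENNReal.ofReal (len z) * ‖movingHat s ω z / disp s z‖ₑ ≤
      ENNReal.ofReal (jap z) * ‖movingHat s ω z‖ₑ +
        lowSet.indicator (fun _ => 1) z * ‖movingHat s u₁ z‖ₑ := by
  filter_upwards [(measurePreserving_shear s).quasiMeasurePreserving.ae h.ae] with z hz
  by_cases hlow : z ∈ lowSet
  · -- on the low modes of the mean flow the left-hand side is the velocity itself
    refine le_add_left ?_
    have h0 : z.1 = 0 := hlow.1
    rw [indicator_of_mem hlow, one_mul]
    have e : len z = |z.2| := by simp [len, h0, Real.sqrt_sq_eq_abs]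
    have h1 := hz.1
    rw [← disp_eq] at h1
    have h2 : (shear s z).2 = z.2 := by simp [shear, h0]
    rw [h2] at h1
    rw [movingHat, movingHat, h1, enorm_mul, enorm_mul, e, enorm_ofReal_complex]
    have : ‖Complex.I‖ₑ = 1 := by rw [← ofReal_norm]; simp
    rw [this, one_mul]
  · refine le_add_right ?_
    rw [← ofReal_norm, ← ofReal_norm, ← ENNReal.ofReal_mul (len_nonneg z),
      ← ENNReal.ofReal_mul (jap_pos z).le]
    refine ENNReal.ofReal_le_ofReal ?_
    have hd1 : len z ≤ jap z * disp s z := by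
      by_cases h0 : z.1 = 0
      · have hz2 : 1 < |z.2| := by
          by_contra hc
          exact hlow ⟨h0, abs_le.1 (not_lt.1 hc)⟩
        have e : len z = |z.2| := by simp [len, h0, Real.sqrt_sq_eq_abs]
        have e2 : disp s z = |z.2| ^ 2 := by simp [disp, h0]
        rw [e, e2]
        have := one_le_jap z
        have h3 : |z.2| ≤ |z.2| ^ 2 := by nlinarith
        nlinarith [sq_nonneg |z.2|]
      · exact (len_le_jap z).trans (le_mul_of_one_le_right (jap_pos z).le (one_le_disp s h0))
    rw [norm_div, Complex.norm_real, Real.norm_eq_abs, abs_of_nonneg (disp_nonneg s z)]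
    rcases (disp_nonneg s z).eq_or_lt with h0 | h0
    · rw [← h0, div_zero, mul_zero]
      exact mul_nonneg (jap_pos z).le (norm_nonneg _)
    rw [← mul_div_assoc, div_le_iff₀ h0]
    nlinarith [mul_le_mul_of_nonneg_right hd1 (norm_nonneg (movingHat s ω z))]

theorem lintegral_len_mul_stream_le {ω u₁ u₂ : L2} (h : IsBiotSavart ω u₁ u₂) (s m : ℝ) :
    ∫⁻ z, ENNReal.ofReal (len z) * ‖movingHat s ω z / disp s z‖ₑ ∂freqMeasure ≤
      embConst m * hnorm m (movingHat s ω) +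
        l2 freqMeasure (lowSet.indicator fun _ => 1) * ‖u₁‖ₑ := by
  have hi : Measurable (lowSet.indicator fun _ => (1 : ℝ≥0∞)) :=
    measurable_const.indicator measurableSet_lowSet
  refine (lintegral_mono_ae (len_mul_stream_le h s)).trans ?_
  rw [lintegral_add_left (by fun_prop)]
  gcongr
  · exact lintegral_jap_mul_le m (measurable_movingHat s ω)
  · refine (lintegral_mul_le_l2 hi.aemeasurable (Measurable.aemeasurable (by fun_prop))).trans ?_
    gcongr
    rw [Lp.enorm_def, ← hnorm_zero_hatFn, hnorm_zero_eq_eLpNorm, l2_enorm_eq_eLpNorm]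
    exact (eLpNorm_comp_measurePreserving (memLp_hatFn u₁).1 (measurePreserving_shear s)).le

theorem l2_lowSet_lt_top : l2 freqMeasure (lowSet.indicator fun _ => 1) < ∞ := by
  unfold l2
  refine ENNReal.rpow_lt_top_of_nonneg (by norm_num) (ne_of_lt ?_)
  have e : ∀ z, (lowSet.indicator (fun _ => (1 : ℝ≥0∞)) z) ^ 2 = lowSet.indicator 1 z := by
    intro z
    by_cases hz : z ∈ lowSet <;> simp [hz]
  simp_rw [e]
  rw [lintegral_indicator_one measurableSet_lowSet]
  exact lowSet_lt_top

/-! ### Solutions as profiles in the moving frame -/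

theorem vorticity_integral_eq (ν s : ℝ) (k : ℤ) {p : ℝ → ℂ} (hp : IsBump p) (ω θ u₁ u₂ : L2)
    {φ : ℝ → Torus → ℝ → ℝ} (hφ : φ = reWave k (profile k p)) :
    ∫ z : Torus × ℝ, (ω z * (dt φ s z.1 z.2 + z.2 * dx φ s z.1 z.2 + ν * lap φ s z.1 z.2
            + u₁ z * dx φ s z.1 z.2 + u₂ z * dy φ s z.1 z.2)
          - θ z * dx φ s z.1 z.2) =
      ν * (∫ z, ω z * (wave k (fun y => (starRingEnd ℂ) (deriv (deriv (twist (k * s) p)) y +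
        -(k : ℂ) ^ 2 * twist (k * s) p y)) z).re) -
      (∫ z, θ z * (wave k (fun y => (starRingEnd ℂ) (k * Complex.I * twist (k * s) p y)) z).re) +
      ((∫ z, u₁ z * ω z *
        (wave k (fun y => (starRingEnd ℂ) (k * Complex.I * twist (k * s) p y)) z).re) +
      ∫ z, u₂ z * ω z * (wave k (fun y => (starRingEnd ℂ) (deriv (twist (k * s) p) y)) z).re) := by
  have hw := hp.twist (k * s)
  have i1 := (integrable_mul_re_wave k (hw.lap k) ω).const_mul ν
  have i2 := integrable_mul_re_wave k (hw.const_mul (k * Complex.I)) θ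
  have i3 := integrable_mul_mul_re_wave k (hw.const_mul (k * Complex.I)) u₁ ω
  have i4 := integrable_mul_mul_re_wave k hw.deriv u₂ ω
  rw [← integral_const_mul, ← integral_add i3 i4, ← integral_sub i1 i2]
  refine Eq.trans ?_ (integral_add (i1.sub i2) (i3.add i4))
  congr 1
  ext z
  have h := dt_add_mul_dx_reWave k p s z.1 z.2
  rw [← hφ] at h
  have e1 := congrFun (congrFun (dx_reWave_profile k p s) z.1) z.2
  have e2 := congrFun (congrFun (dy_reWave_profile k hp s) z.1) z.2
  have e3 := congrFun (congrFun (lap_reWave_profile k hp s) z.1) z.2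
  rw [← hφ] at e1 e2 e3
  simp only [Prod.mk.eta] at e1 e2 e3
  rw [← e1, ← e2, ← e3]
  linear_combination ω z * h

theorem temperature_integral_eq (ν s : ℝ) (k : ℤ) {p : ℝ → ℂ} (hp : IsBump p) (θ u₁ : L2)
    {φ : ℝ → Torus → ℝ → ℝ} (hφ : φ = reWave k (profile k p)) :
    ∫ z : Torus × ℝ, θ z * (dt φ s z.1 z.2 + z.2 * dx φ s z.1 z.2
          + zeroMode u₁ z.2 * dx φ s z.1 z.2 + ν * lap φ s z.1 z.2) =
      ν * (∫ z, θ z * (wave k (fun y => (starRingEnd ℂ) (deriv (deriv (twist (k * s) p)) y +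
        -(k : ℂ) ^ 2 * twist (k * s) p y)) z).re) +
      ∫ z : Torus × ℝ, zeroMode u₁ z.2 * θ z *
        (wave k (fun y => (starRingEnd ℂ) (k * Complex.I * twist (k * s) p y)) z).re := by
  have hw := hp.twist (k * s)
  have i1 := (integrable_mul_re_wave k (hw.lap k) θ).const_mul ν
  have i3 := integrable_zeroMode_mul_re_wave k (hw.const_mul (k * Complex.I)) u₁ θ
  rw [← integral_const_mul, ← integral_add i1 i3]
  congr 1
  ext z
  have h := dt_add_mul_dx_reWave k p s z.1 z.2
  rw [← hφ] at h
  have e1 := congrFun (congrFun (dx_reWave_profile k p s) z.1) z.2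
  have e3 := congrFun (congrFun (lap_reWave_profile k hp s) z.1) z.2
  rw [← hφ] at e1 e3
  simp only [Prod.mk.eta] at e1 e3
  rw [← e1, ← e3]
  linear_combination θ z * h

namespace IsSolution

variable {m ν T : ℝ} {ω_in θ_in : L2} {ω θ u₁ u₂ : ℝ → L2}

theorem hasDerivWithinAt_vorticity (H : IsSolution m ν T ω_in θ_in ω θ u₁ u₂) (hm : 0 ≤ m)
    (k : ℤ) {p : ℝ → ℂ} (hp : IsBump p) : ∀ s ∈ Icc 0 T, HasDerivWithinAt
      (fun r => (∫ z, (starRingEnd ℂ) (testFn k p z) * movingHat r (ω r) z ∂freqMeasure).re)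
      (weakRhs ν s (fun z => Complex.I * z.1 * movingHat s (θ s) z)
        (fun z => movingHat s (ω s) z / disp s z) (movingHat s (ω s)) (testFn k p))
      (Icc 0 T) s := by
  obtain ⟨φ, hφ⟩ : ∃ φ, φ = reWave k (profile k p) := ⟨_, rfl⟩
  have hT : IsTest φ := hφ ▸ isTest_reWave k hp
  have hω := H.cont_vorticity.continuousOn hm
  have hθ := H.cont_temperature.continuousOn hm
  have c1 := (isProfileFamily_lap k hp).continuousOn_integral k hω
  have c2 := (isProfileFamily_dx k hp).continuousOn_integral k hθ
  have c3 := (isProfileFamily_dx k hp).continuousOn_integral_mul k H.cont_velocity₁ hω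
  have c4 := (isProfileFamily_dy k hp).continuousOn_integral_mul k H.cont_velocity₂ hω
  have key := hasDerivWithinAt_of_integral_eq (T := T)
    (P := fun r => (∫ z, (starRingEnd ℂ) (testFn k p z) * movingHat r (ω r) z ∂freqMeasure).re)
    (((continuousOn_const.mul c1).sub c2).add (c3.add c4)) (fun t ht => by
      have h := H.vorticity_eq φ hT t ht
      simp_rw [vorticity_integral_eq ν _ k hp _ _ _ _ hφ] at h
      rw [← H.init_vorticity, hφ, integral_mul_reWave k hp, integral_mul_reWave k hp] at h
      exact h)
  intro s hs
  refine (key s hs).congr_deriv ?_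
  simp only [Pi.add_apply, Pi.sub_apply, Pi.mul_apply]
  rw [vorticity_terms_eq ν k (hp.twist (k * s)) (H.biotSavart s hs), weakRhs_twist]
  simp only [← disp_eq]
  rfl

theorem hasDerivWithinAt_temperature (H : IsSolution m ν T ω_in θ_in ω θ u₁ u₂) (hm : 0 ≤ m)
    (k : ℤ) {p : ℝ → ℂ} (hp : IsBump p) : ∀ s ∈ Icc 0 T, HasDerivWithinAt
      (fun r => (∫ z, (starRingEnd ℂ) (testFn k p z) * movingHat r (θ r) z ∂freqMeasure).re)
      (weakRhs ν s (fun _ => 0) (zeroPart fun z => movingHat s (ω s) z / disp s z)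
        (movingHat s (θ s)) (testFn k p)) (Icc 0 T) s := by
  obtain ⟨φ, hφ⟩ : ∃ φ, φ = reWave k (profile k p) := ⟨_, rfl⟩
  have hT : IsTest φ := hφ ▸ isTest_reWave k hp
  have hθ := H.cont_temperature.continuousOn hm
  obtain ⟨v, hv, hve⟩ := exists_zeroMode_continuousOn H.cont_velocity₁
  have c1 := (isProfileFamily_lap k hp).continuousOn_integral k hθ
  have c3 := (isProfileFamily_dx k hp).continuousOn_integral_mul k hv hθ
  have c3' : ContinuousOn (fun s => ∫ z : Torus × ℝ, zeroMode (u₁ s) z.2 * θ s z *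
      (wave k (fun y => (starRingEnd ℂ) (k * Complex.I * twist (k * s) p y)) z).re) (Icc 0 T) := by
    refine c3.congr fun s _ => integral_congr_ae ?_
    filter_upwards [hve s] with z hz
    rw [hz]
  have key := hasDerivWithinAt_of_integral_eq (T := T)
    (P := fun r => (∫ z, (starRingEnd ℂ) (testFn k p z) * movingHat r (θ r) z ∂freqMeasure).re)
    ((continuousOn_const.mul c1).add c3') (fun t ht => by
      have h := H.temperature_eq φ hT t ht
      simp_rw [temperature_integral_eq ν _ k hp _ _ hφ] at h
      rw [← H.init_temperature, hφ, integral_mul_reWave k hp, integral_mul_reWave k hp] at h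
      exact h)
  intro s hs
  refine (key s hs).congr_deriv ?_
  simp only [Pi.add_apply, Pi.mul_apply]
  rw [temperature_terms_eq ν k (hp.twist (k * s)) (H.biotSavart s hs), weakRhs_twist]
  simp only [zeroPart, disp_eq s]
  rfl

theorem movingHat_neg (s : ℝ) (f : L2) :
    ∀ᵐ z ∂freqMeasure, movingHat s f (-z) = (starRingEnd ℂ) (movingHat s f z) := by
  filter_upwards [(measurePreserving_shear s).quasiMeasurePreserving.ae (hatFn_neg f)] with z hz
  rw [movingHat, movingHat, ← hz]
  congr 1
  ext
  · rfl
  · simp [shear]; ring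

theorem stream_neg (s : ℝ) (f : L2) : ∀ᵐ z ∂freqMeasure, movingHat s f (-z) / disp s (-z) =
    (starRingEnd ℂ) (movingHat s f z / disp s z) := by
  filter_upwards [movingHat_neg s f] with z hz
  have : disp s (-z) = disp s z := by simp [disp]; ring
  rw [hz, this, map_div₀, Complex.conj_ofReal]

theorem exists_bound_movingHat {f : ℝ → L2} (hm : 0 ≤ m) (hf : ContinuousInSobolev m T f) :
    ∃ c : ℝ, 0 ≤ c ∧ ∀ s ∈ Icc 0 T, hnorm m (movingHat s (f s)) ≤ ENNReal.ofReal c := by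
  obtain ⟨c, hc0, hc⟩ := hf.exists_bound
  refine ⟨(1 + |T|) ^ m * c, by positivity, fun s hs => (hnorm_movingHat_le hm s _).trans ?_⟩
  rw [ENNReal.ofReal_mul (by positivity)]
  have : |s| ≤ |T| := abs_le_abs_of_nonneg hs.1 hs.2
  exact mul_le_mul' (ENNReal.ofReal_le_ofReal (by gcongr)) (hc s hs)

theorem exists_bound_stream (H : IsSolution m ν T ω_in θ_in ω θ u₁ u₂) (hm : 2 < m) :
    ∃ c : ℝ, 0 ≤ c ∧ ∀ s ∈ Icc 0 T, ∫⁻ z, ENNReal.ofReal (len z) *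
      ‖movingHat s (ω s) z / disp s z‖ₑ ∂freqMeasure ≤ ENNReal.ofReal c := by
  obtain ⟨c, hc0, hc⟩ := exists_bound_movingHat (by linarith) H.cont_vorticity
  obtain ⟨d, hd⟩ := isCompact_Icc.exists_bound_of_continuousOn H.cont_velocity₁
  have hE := embConst_lt_top hm
  have hl := l2_lowSet_lt_top
  refine ⟨(embConst m).toReal * c + (l2 freqMeasure (lowSet.indicator fun _ => 1)).toReal * max d 0,
    by positivity, fun s hs => ?_⟩
  refine (lintegral_len_mul_stream_le (H.biotSavart s hs) s m).trans ?_
  rw [ENNReal.ofReal_add (by positivity) (by positivity), ENNReal.ofReal_mul (by simp),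
    ENNReal.ofReal_mul (by simp), ENNReal.ofReal_toReal hE.ne, ENNReal.ofReal_toReal hl.ne]
  gcongr
  · exact hc s hs
  · rw [← ofReal_norm]
    exact ENNReal.ofReal_le_ofReal ((hd s hs).trans (le_max_left _ _))

/-- The vorticity is a profile, forced by `∂ₓθ` and transported by its own velocity. The quotient by
the symbol `disp s z` has the value `0` at `z = 0`, which is a null set. -/
theorem isProfile_vorticity (H : IsSolution m ν T ω_in θ_in ω θ u₁ u₂) (hm : 2 < m) :
    ∃ R : ℝ, 0 ≤ R ∧ IsProfile ν T R (fun s => movingHat s (ω s))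
      (fun s z => Complex.I * z.1 * movingHat s (θ s) z)
      (fun s z => movingHat s (ω s) z / disp s z) := by
  obtain ⟨c, hc0, hc⟩ := exists_bound_movingHat (by linarith) H.cont_vorticity
  obtain ⟨d, hd0, hd⟩ := exists_bound_movingHat (by linarith) H.cont_temperature
  obtain ⟨e, he0, he⟩ := H.exists_bound_stream hm
  have mi : Measurable fun z : Freq => (z.1 : ℂ) := by
    simpa [Function.comp_def] using Complex.measurable_ofReal.comp measurable_int_cast_fst
  have md : ∀ s, Measurable fun z : Freq => (disp s z : ℂ) := fun s =>
    Complex.measurable_ofReal.comp (measurable_disp s)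
  refine ⟨c + d + e, by positivity, ⟨fun s => measurable_movingHat s _,
    fun s => (measurable_const.mul mi).mul (measurable_movingHat s _),
    fun s => (measurable_movingHat s _).div (md s), fun s => memLp_movingHat s _, fun s hs => ?_,
    fun s hs => ?_, fun s hs => ?_, fun s hs => stream_neg s _, fun k p hp s hs =>
    H.hasDerivWithinAt_vorticity (by linarith) k hp s hs⟩⟩
  · exact (hnorm_mono_exp hm.le _).trans ((hc s hs).trans (ENNReal.ofReal_le_ofReal (by linarith)))
  · refine le_trans (l2_mono fun z => ?_) ((hnorm_mono_exp (show (1 : ℝ) ≤ m by linarith) _).trans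
      ((hd s hs).trans (ENNReal.ofReal_le_ofReal (by linarith))))
    rw [Real.rpow_zero, Real.rpow_one, ENNReal.ofReal_one, one_mul, enorm_mul]
    gcongr
    rw [← ofReal_norm]
    refine ENNReal.ofReal_le_ofReal ?_
    rw [norm_mul, Complex.norm_I, one_mul, Complex.norm_intCast]
    refine abs_le_of_sq_le_sq ?_ (jap_pos z).le
    rw [jap_sq]
    nlinarith [sq_nonneg z.2]
  · exact (he s hs).trans (ENNReal.ofReal_le_ofReal (by linarith))

/-- The temperature is a profile, transported by the mean flow only. -/
theorem isProfile_temperature (H : IsSolution m ν T ω_in θ_in ω θ u₁ u₂) (hm : 2 < m) :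
    ∃ R : ℝ, 0 ≤ R ∧ IsProfile ν T R (fun s => movingHat s (θ s)) (fun _ _ => 0)
      (fun s => zeroPart fun z => movingHat s (ω s) z / disp s z) := by
  obtain ⟨d, hd0, hd⟩ := exists_bound_movingHat (by linarith) H.cont_temperature
  obtain ⟨e, he0, he⟩ := H.exists_bound_stream hm
  have md : ∀ s, Measurable fun z : Freq => (disp s z : ℂ) := fun s =>
    Complex.measurable_ofReal.comp (measurable_disp s)
  refine ⟨d + e, by positivity, ⟨fun s => measurable_movingHat s _, fun s => measurable_const,
    fun s => measurable_zeroPart ((measurable_movingHat s _).div (md s)),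
    fun s => memLp_movingHat s _, fun s hs => ?_,
    fun s hs => ?_, fun s hs => ?_, fun s hs => ?_, fun k p hp s hs =>
    H.hasDerivWithinAt_temperature (by linarith) k hp s hs⟩⟩
  · exact (hnorm_mono_exp hm.le _).trans ((hd s hs).trans (ENNReal.ofReal_le_ofReal (by linarith)))
  · simp [hnorm, l2]
  · refine (lintegral_mono fun z => ?_).trans
      ((he s hs).trans (ENNReal.ofReal_le_ofReal (by linarith)))
    gcongr
    exact enorm_le_iff_norm_le.2 (norm_zeroPart_le (fun z => movingHat s (ω s) z / disp s z) z)
  · filter_upwards [stream_neg s (ω s)] with z hz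
    simp only [zeroPart, Prod.fst_neg, neg_eq_zero]
    split_ifs
    · exact hz
    · simp

end IsSolution

/-! ### The bootstrap -/

theorem commConst_nonneg {m : ℝ} (hm : 2 < m) : 0 ≤ commConst m := by unfold commConst; positivity

/-- The continuity method: a continuous function that is strictly below `L` as long as it has not
exceeded `L` never reaches `L`. -/
theorem le_of_bootstrap {b L : ℝ} {x : ℝ → ℝ} (hx : ContinuousOn x (Icc 0 b)) (h0 : x 0 < L)
    (h : ∀ t ∈ Icc 0 b, (∀ s ∈ Icc 0 t, x s ≤ L) → x t < L) : ∀ t ∈ Icc 0 b, x t < L := by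
  by_contra! hc
  obtain ⟨t₁, ht₁, hL⟩ := hc
  have hcl : IsClosed {t ∈ Icc 0 b | L ≤ x t} :=
    isClosed_Icc.isClosed_le continuousOn_const hx
  have hcomp : IsCompact {t ∈ Icc 0 b | L ≤ x t} :=
    isCompact_Icc.of_isClosed_subset hcl fun _ h => h.1
  obtain ⟨t₀, ⟨ht₀, hL₀⟩, hmin⟩ := hcomp.exists_isLeast ⟨t₁, ht₁, hL⟩
  have hlt : ∀ s ∈ Icc 0 b, s < t₀ → x s < L := fun s hs hst => by
    by_contra! hc
    exact absurd (hmin ⟨hs, hc⟩) (not_le.2 hst)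
  have hpos : 0 < t₀ := by
    rcases ht₀.1.eq_or_lt with h1 | h1
    · rw [← h1] at hL₀
      exact absurd h0 (not_lt.2 hL₀)
    · exact h1
  have hsub : Ioo 0 t₀ ⊆ Icc 0 b := fun s hs => ⟨hs.1.le, hs.2.le.trans ht₀.2⟩
  have hle : x t₀ ≤ L := by
    have hcw := (hx t₀ ht₀).mono hsub
    have : (𝓝[Ioo 0 t₀] t₀).NeBot := by
      rw [nhdsWithin_Ioo_eq_nhdsLT hpos]
      infer_instance
    refine le_of_tendsto hcw ?_
    filter_upwards [self_mem_nhdsWithin] with s hs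
    exact (hlt s (hsub hs) hs.2).le
  refine absurd (h t₀ ht₀ fun s hs => ?_) (not_lt.2 hL₀)
  rcases hs.2.eq_or_lt with h1 | h1
  · rwa [h1]
  · exact (hlt s ⟨hs.1, hs.2.trans ht₀.2⟩ h1).le

theorem movingHat_eq_shear (r t : ℝ) (f : L2) (z : Freq) :
    movingHat r f z = movingHat t f (shear (r - t) z) := by
  rw [movingHat, movingHat]
  congr 1
  ext
  · rfl
  · simp [shear]; ring

theorem hnorm_movingHat_le_of_near {m T : ℝ} (hm : 0 ≤ m) {f g : L2} {r : ℝ}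
    (hr : r ∈ Icc 0 T) (t : ℝ) :
    hnorm m (movingHat r f) ≤ ENNReal.ofReal ((1 + T) ^ m) * sobolevNorm m (f - g) +
      ENNReal.ofReal ((1 + |r - t|) ^ m) * hnorm m (movingHat t g) := by
  have h : ∀ᵐ z ∂freqMeasure, movingHat r f z = movingHat r (f - g) z + movingHat r g z := by
    filter_upwards [movingHat_sub r f g] with z hz
    rw [hz, sub_add_cancel]
  rw [hnorm_congr_ae h]
  refine (hnorm_add_le (measurable_movingHat _ _) (measurable_movingHat _ _)).trans ?_
  refine add_le_add ((hnorm_movingHat_le hm r _).trans ?_) ?_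
  · have h0 := hr.1
    rw [abs_of_nonneg h0]
    gcongr
    exact hr.2
  · have e : movingHat r g = fun z => movingHat t g (shear (r - t) z) :=
      funext (movingHat_eq_shear r t g)
    rw [e]
    exact hnorm_comp_shear_le hm _ (measurable_movingHat t g)

theorem continuousOn_hnorm_movingHat {m T : ℝ} (hm : 0 ≤ m) {f : ℝ → L2}
    (hf : ContinuousInSobolev m T f) :
    ContinuousOn (fun s => (hnorm m (movingHat s (f s))).toReal) (Icc 0 T) := by
  intro t ht
  have hT : 0 ≤ T := ht.1.trans ht.2
  have hfin : ∀ s ∈ Icc 0 T, hnorm m (movingHat s (f s)) ≠ ∞ := fun s hs =>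
    ((hnorm_movingHat_le hm s _).trans_lt
      (ENNReal.mul_lt_top ENNReal.ofReal_lt_top (hf.1 s hs))).ne
  set A : ℝ := (1 + T) ^ m with hA
  have hA0 : 0 ≤ A := by positivity
  have hσ : Tendsto (fun r => (sobolevNorm m (f r - f t)).toReal) (𝓝[Icc 0 T] t) (𝓝 0) := by
    simpa [Function.comp_def] using (ENNReal.tendsto_toReal ENNReal.zero_ne_top).comp (hf.2 t ht)
  have hone : Tendsto (fun r => (1 + |r - t|) ^ m) (𝓝[Icc 0 T] t) (𝓝 1) := by
    have hc : Continuous fun r : ℝ => (1 + |r - t|) ^ m :=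
      Continuous.rpow_const (by fun_prop) fun _ => Or.inr hm
    have := (hc.tendsto t).mono_left (nhdsWithin_le_nhds (s := Icc 0 T))
    simpa using this
  have hup : Tendsto (fun r => A * (sobolevNorm m (f r - f t)).toReal +
      (1 + |r - t|) ^ m * (hnorm m (movingHat t (f t))).toReal) (𝓝[Icc 0 T] t)
      (𝓝 (hnorm m (movingHat t (f t))).toReal) := by
    simpa using (hσ.const_mul A).add (hone.mul_const (hnorm m (movingHat t (f t))).toReal)
  have hlow : Tendsto (fun r => ((hnorm m (movingHat t (f t))).toReal -
      A * (sobolevNorm m (f r - f t)).toReal) / (1 + |r - t|) ^ m) (𝓝[Icc 0 T] t)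
      (𝓝 (hnorm m (movingHat t (f t))).toReal) := by
    have := ((hσ.const_mul A).const_sub (hnorm m (movingHat t (f t))).toReal).div hone one_ne_zero
    rw [mul_zero, sub_zero, div_one] at this
    exact this
  have hsfin : ∀ᶠ r in 𝓝[Icc 0 T] t, sobolevNorm m (f r - f t) < 1 :=
    (hf.2 t ht).eventually_lt_const (by simp)
  have hreal : ∀ {a b c : ℝ≥0∞} {u v : ℝ}, b ≠ ∞ → c ≠ ∞ → 0 ≤ u → 0 ≤ v →
      a ≤ ENNReal.ofReal u * b + ENNReal.ofReal v * c → a.toReal ≤ u * b.toReal + v * c.toReal := by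
    intro a b c u v hb hc hu hv h
    have h1 := ENNReal.toReal_mono (by finiteness) h
    rwa [ENNReal.toReal_add (by finiteness) (by finiteness), ENNReal.toReal_mul,
      ENNReal.toReal_mul, ENNReal.toReal_ofReal hu, ENNReal.toReal_ofReal hv] at h1
  refine tendsto_of_tendsto_of_tendsto_of_le_of_le' hlow hup ?_ ?_
  · filter_upwards [hsfin, self_mem_nhdsWithin] with r hr hrI
    have hpos : 0 < (1 + |r - t|) ^ m := by positivity
    rw [div_le_iff₀ hpos]
    have hsymm : sobolevNorm m (f t - f r) = sobolevNorm m (f r - f t) := by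
      rw [sobolevNorm_eq, sobolevNorm_eq]
      refine l2_congr_ae ?_
      filter_upwards [hatFn_sub (f t) (f r), hatFn_sub (f r) (f t)] with z h1 h2
      rw [h1, h2, ← ofReal_norm, ← ofReal_norm, norm_sub_rev]
    have h1 := hnorm_movingHat_le_of_near hm (f := f t) (g := f r) ht r
    rw [hsymm, abs_sub_comm] at h1
    have := hreal (hr.trans ENNReal.one_lt_top).ne (hfin r hrI) hA0 hpos.le h1
    linarith
  · filter_upwards [hsfin, self_mem_nhdsWithin] with r hr hrI
    exact hreal (hr.trans ENNReal.one_lt_top).ne (hfin t ht) hA0 (by positivity)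
      (hnorm_movingHat_le_of_near hm hrI t)

/-- A weight depending on `k` only acts on each mode by a constant. -/
theorem hnorm_japX_mul_sq (m m₁ : ℝ) {F : Freq → ℂ} (hF : Measurable F) :
    hnorm m (fun z => (japX m₁ z.1 : ℂ) * F z) ^ 2 =
      ∑' k : ℤ, ENNReal.ofReal (japX m₁ k) ^ 2 *
        hnorm m (fun z => if z.1 = k then F z else 0) ^ 2 := by
  have hj : Measurable fun z : Freq => (japX m₁ z.1 : ℂ) :=
    Complex.measurable_ofReal.comp (measurable_japX m₁)
  rw [hnorm, l2_sq, lintegral_freqMeasure (by fun_prop)]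
  refine tsum_congr fun k => ?_
  rw [hnorm, l2_sq, lintegral_fiber k (fun z hz => by simp [hz])]
  simp only [↓reduceIte]
  rw [← lintegral_const_mul _ (by fun_prop)]
  refine lintegral_congr fun ξ => ?_
  have h1 := japX_pos m₁ k
  rw [enorm_mul, enorm_ofReal_complex, abs_of_pos h1]
  ring

namespace IsSolution

variable {m ν T : ℝ} {ω_in θ_in : L2} {ω θ u₁ u₂ : ℝ → L2}

/-- As long as the vorticity is small, each mode in `x` of the temperature at most doubles its
energy. -/
theorem hnorm_temperature_mode_sq_le (H : IsSolution m ν T ω_in θ_in ω θ u₁ u₂) (hm : 2 < m)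
    (hν : 0 ≤ ν) {L b : ℝ} (hL : 0 ≤ L) (hb : b ∈ Icc 0 T)
    (hX : ∀ s ∈ Icc 0 b, hnorm m (movingHat s (ω s)) ≤ ENNReal.ofReal L)
    (hq : b * (commConst m * L) ≤ 1 / 2) (k : ℤ) :
    ∀ s ∈ Icc 0 b, hnorm m (fun z => if z.1 = k then movingHat s (θ s) z else 0) ^ 2 ≤
      2 * hnorm m (fun z => if z.1 = k then movingHat 0 (θ 0) z else 0) ^ 2 := by
  obtain ⟨R, hR, hprof⟩ := H.isProfile_temperature hm
  have hmode := hprof.restrict_mode k fun s z hz => by simp [zeroPart, hz]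
  obtain ⟨d, hd0, hd⟩ := exists_bound_movingHat (by linarith) H.cont_temperature
  set Y : ℝ → ℝ≥0∞ := fun s => hnorm m (fun z => if z.1 = k then movingHat s (θ s) z else 0) with hY
  have hYd : ∀ s ∈ Icc 0 b, Y s ≤ ENNReal.ofReal d := fun s hs => by
    refine le_trans (l2_mono fun z => ?_) (hd s ⟨hs.1, hs.2.trans hb.2⟩)
    gcongr
    dsimp only
    split_ifs <;> simp
  -- the largest value of the energy, which is finite, absorbs the transport term
  set S : ℝ≥0∞ := ⨆ s ∈ Icc 0 b, Y s with hS
  have hSfin : S ≠ ∞ := ((iSup₂_le hYd).trans_lt ENNReal.ofReal_lt_top).ne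
  have hYS : ∀ s ∈ Icc 0 b, Y s ≤ S := fun s hs => le_iSup₂ (f := fun s _ => Y s) s hs
  have h0b : (0 : ℝ) ∈ Icc 0 b := ⟨le_rfl, hb.1⟩
  have hstep : ∀ s ∈ Icc 0 b, Y s ^ 2 ≤ Y 0 ^ 2 + ENNReal.ofReal (1 / 2) * S ^ 2 := by
    intro s hs
    have hsub : ∀ r ∈ Icc 0 s, r ∈ Icc 0 b := fun r hr => ⟨hr.1, hr.2.trans hs.2⟩
    have h := hmode.energy_le hν hR (m := m) (t := s) (κ := 1) (X := S.toReal) (Y := 0) (Z := L) hm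
      ⟨hs.1, hs.2.trans hb.2⟩ zero_le_one ENNReal.toReal_nonneg le_rfl hL
      (f := fun r => movingHat r (ω r)) (fun r => measurable_movingHat r _)
      (fun r hr => by rw [ENNReal.ofReal_toReal hSfin]; exact hYS r (hsub r hr))
      (fun r hr => by simp [hnorm, l2])
      (fun r hr => hX r (hsub r hr))
      (fun r _ z => len_sq_zeroPart_le r _ z)
    refine h.trans ?_
    gcongr
    rw [mul_zero, mul_zero, zero_add, mul_one]
    calc ENNReal.ofReal (s * (commConst m * (L * S.toReal ^ 2)))
        ≤ ENNReal.ofReal (1 / 2 * S.toReal ^ 2) := by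
          refine ENNReal.ofReal_le_ofReal ?_
          have h1 : s * (commConst m * L) ≤ 1 / 2 :=
            (mul_le_mul_of_nonneg_right hs.2 (mul_nonneg (commConst_nonneg hm) hL)).trans hq
          calc s * (commConst m * (L * S.toReal ^ 2)) =
              s * (commConst m * L) * S.toReal ^ 2 := by ring
            _ ≤ _ := by gcongr
      _ = _ := by
          rw [ENNReal.ofReal_mul (by norm_num), ENNReal.ofReal_pow ENNReal.toReal_nonneg,
            ENNReal.ofReal_toReal hSfin]
  have hY0 : Y 0 ≠ ∞ := ((hYd 0 h0b).trans_lt ENNReal.ofReal_lt_top).ne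
  -- in real numbers
  have hstep' : ∀ s ∈ Icc 0 b, (Y s).toReal ^ 2 ≤ (Y 0).toReal ^ 2 + 1 / 2 * S.toReal ^ 2 := by
    intro s hs
    have h := ENNReal.toReal_mono (by finiteness) (hstep s hs)
    rwa [ENNReal.toReal_add (by finiteness) (by finiteness), ENNReal.toReal_mul, ENNReal.toReal_pow,
      ENNReal.toReal_pow, ENNReal.toReal_pow, ENNReal.toReal_ofReal (by norm_num)] at h
  have hSle : S.toReal ^ 2 ≤ (Y 0).toReal ^ 2 + 1 / 2 * S.toReal ^ 2 := by
    have h1 : S ≤ ENNReal.ofReal (√((Y 0).toReal ^ 2 + 1 / 2 * S.toReal ^ 2)) := by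
      refine iSup₂_le fun s hs => ?_
      rw [← ENNReal.ofReal_toReal ((hYd s hs).trans_lt ENNReal.ofReal_lt_top).ne]
      exact ENNReal.ofReal_le_ofReal (Real.le_sqrt_of_sq_le (hstep' s hs))
    have h2 := ENNReal.toReal_le_of_le_ofReal (Real.sqrt_nonneg _) h1
    exact (Real.le_sqrt ENNReal.toReal_nonneg (by positivity)).1 h2
  intro s hs
  have h3 : (Y s).toReal ^ 2 ≤ 2 * (Y 0).toReal ^ 2 := by linarith [hstep' s hs]
  have hYs : Y s ≠ ∞ := ((hYd s hs).trans_lt ENNReal.ofReal_lt_top).ne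
  have h4 := ENNReal.ofReal_le_ofReal h3
  rwa [ENNReal.ofReal_mul (by norm_num), ENNReal.ofReal_pow ENNReal.toReal_nonneg,
    ENNReal.ofReal_pow ENNReal.toReal_nonneg, ENNReal.ofReal_toReal hYs,
    ENNReal.ofReal_toReal hY0, ENNReal.ofReal_ofNat] at h4

theorem hnorm_temperature_le (H : IsSolution m ν T ω_in θ_in ω θ u₁ u₂) (hm : 2 < m)
    (hν : 0 ≤ ν) {L b N m₁ : ℝ} (hL : 0 ≤ L) (hb : b ∈ Icc 0 T)
    (hX : ∀ s ∈ Icc 0 b, hnorm m (movingHat s (ω s)) ≤ ENNReal.ofReal L)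
    (hq : b * (commConst m * L) ≤ 1 / 2) (hN : 0 ≤ N)
    (h0 : hnorm m (fun z => (japX m₁ z.1 : ℂ) * movingHat 0 (θ 0) z) ≤ ENNReal.ofReal N) :
    ∀ s ∈ Icc 0 b, hnorm m (fun z => (japX m₁ z.1 : ℂ) * movingHat s (θ s) z) ≤
      ENNReal.ofReal (3 / 2 * N) := by
  intro s hs
  refine (ENNReal.pow_le_pow_left_iff two_ne_zero).1 ?_
  have h1 : hnorm m (fun z => (japX m₁ z.1 : ℂ) * movingHat s (θ s) z) ^ 2 ≤
      2 * hnorm m (fun z => (japX m₁ z.1 : ℂ) * movingHat 0 (θ 0) z) ^ 2 := by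
    rw [hnorm_japX_mul_sq m m₁ (measurable_movingHat _ _),
      hnorm_japX_mul_sq m m₁ (measurable_movingHat _ _), ← ENNReal.tsum_mul_left]
    refine ENNReal.tsum_le_tsum fun k => ?_
    rw [mul_left_comm]
    gcongr
    exact H.hnorm_temperature_mode_sq_le hm hν hL hb hX hq k s hs
  refine h1.trans ?_
  calc 2 * hnorm m (fun z => (japX m₁ z.1 : ℂ) * movingHat 0 (θ 0) z) ^ 2
      ≤ 2 * ENNReal.ofReal N ^ 2 := by gcongr
    _ = ENNReal.ofReal (2 * N ^ 2) := by
      rw [ENNReal.ofReal_mul (by norm_num), ENNReal.ofReal_pow hN, ENNReal.ofReal_ofNat]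
    _ ≤ _ := by
      -- `2 ≤ (3 / 2)²`
      rw [← ENNReal.ofReal_pow (by positivity)]
      refine ENNReal.ofReal_le_ofReal ?_
      nlinarith [sq_nonneg N]

theorem abs_le_japX {m₁ : ℝ} (hm₁ : 1 ≤ m₁) (k : ℤ) : |(k : ℝ)| ≤ japX m₁ k := by
  have h1 : (1 : ℝ) ≤ 1 + (k : ℝ) ^ 2 := by nlinarith [sq_nonneg (k : ℝ)]
  calc |(k : ℝ)| ≤ √(1 + (k : ℝ) ^ 2) := Real.abs_le_sqrt (by linarith)
    _ = (1 + (k : ℝ) ^ 2) ^ (1 / 2 : ℝ) := Real.sqrt_eq_rpow _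
    _ ≤ _ := Real.rpow_le_rpow_of_exponent_le h1 (by linarith)

/-- The growth of the vorticity, as long as it stays below `L`. -/
theorem hnorm_vorticity_sq_le (H : IsSolution m ν T ω_in θ_in ω θ u₁ u₂) (hm : 2 < m)
    (hν : 0 ≤ ν) {L b N m₁ : ℝ} (hm₁ : 1 ≤ m₁) (hL : 0 ≤ L) (hb : b ∈ Icc 0 T)
    (hX : ∀ s ∈ Icc 0 b, hnorm m (movingHat s (ω s)) ≤ ENNReal.ofReal L)
    (hq : b * (commConst m * L) ≤ 1 / 2) (hN : 0 ≤ N)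
    (h0 : hnorm m (fun z => (japX m₁ z.1 : ℂ) * movingHat 0 (θ 0) z) ≤ ENNReal.ofReal N) :
    hnorm m (movingHat b (ω b)) ^ 2 ≤ hnorm m (movingHat 0 (ω 0)) ^ 2 +
      ENNReal.ofReal (b * (3 * (L * N) + commConst m * (2 * (1 + b)) * L ^ 3)) := by
  obtain ⟨R, hR, hprof⟩ := H.isProfile_vorticity hm
  have hθ := H.hnorm_temperature_le hm hν hL hb hX hq hN h0
  have hb0 := hb.1
  have h := hprof.energy_le hν hR (m := m) (t := b) (κ := 2 * (1 + b)) (X := L) (Y := 3 / 2 * N)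
    (Z := L) hm hb (by positivity) hL (by positivity) hL (f := fun r => movingHat r (ω r))
    (fun r => measurable_movingHat r _) hX (fun s hs => ?_) hX (fun s hs z => ?_)
  · refine h.trans (le_of_eq ?_)
    congr 2
    ring
  · refine le_trans (l2_mono fun z => ?_) (hθ s hs)
    have h1 := japX_pos m₁ z.1
    dsimp only
    rw [enorm_mul, enorm_mul, enorm_mul, enorm_ofReal_complex, abs_of_pos h1]
    gcongr
    rw [← enorm_mul, ← ofReal_norm, norm_mul, Complex.norm_I, one_mul, Complex.norm_intCast]
    exact ENNReal.ofReal_le_ofReal (abs_le_japX hm₁ z.1)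
  · refine (len_sq_div_disp_le hs.1 z _).trans ?_
    have := jap_pos z
    gcongr
    exact hs.2

/-- The vorticity stays below four times its initial bound `M`, as long as the nonlinear term (`hq`)
and the buoyancy (`hbN`) are weak on the time scale `b`. -/
theorem hnorm_vorticity_le (H : IsSolution m ν T ω_in θ_in ω θ u₁ u₂) (hm : 2 < m)
    (hν : 0 ≤ ν) {M b N m₁ : ℝ} (hm₁ : 1 ≤ m₁) (hM : 0 < M) (hb : b ∈ Icc 0 T)
    (hω : hnorm m (movingHat 0 (ω 0)) ≤ ENNReal.ofReal M) (hN : 0 ≤ N)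
    (h0 : hnorm m (fun z => (japX m₁ z.1 : ℂ) * movingHat 0 (θ 0) z) ≤ ENNReal.ofReal N)
    (hq : b * (1 + b) * (128 * (commConst m * M)) ≤ 1) (hbN : b * N ≤ M) :
    ∀ s ∈ Icc 0 b, hnorm m (movingHat s (ω s)) ≤ ENNReal.ofReal (4 * M) := by
  have hm0 : 0 ≤ m := by linarith
  have hC := commConst_nonneg hm
  have hsub : Icc 0 b ⊆ Icc 0 T := Icc_subset_Icc_right hb.2
  have hfin : ∀ s ∈ Icc 0 b, hnorm m (movingHat s (ω s)) ≠ ∞ := fun s hs =>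
    ((hnorm_movingHat_le hm0 s _).trans_lt
      (ENNReal.mul_lt_top ENNReal.ofReal_lt_top (H.cont_vorticity.1 s (hsub hs)))).ne
  have h0b : (0 : ℝ) ∈ Icc 0 b := ⟨le_rfl, hb.1⟩
  have hx0 : (hnorm m (movingHat 0 (ω 0))).toReal ≤ M := ENNReal.toReal_le_of_le_ofReal hM.le hω
  have hboot := le_of_bootstrap (L := 4 * M)
    ((continuousOn_hnorm_movingHat hm0 H.cont_vorticity).mono hsub) (by linarith) ?_
  · intro s hs
    rw [← ENNReal.ofReal_toReal (hfin s hs)]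
    exact ENNReal.ofReal_le_ofReal (hboot s hs).le
  intro t ht hle
  have ht0 := ht.1
  have hsub' : ∀ s ∈ Icc 0 t, s ∈ Icc 0 b := fun s hs => ⟨hs.1, hs.2.trans ht.2⟩
  have hqt : t * (1 + t) * (128 * (commConst m * M)) ≤ 1 := by
    refine le_trans ?_ hq
    have := ht.2
    have := hb.1
    gcongr
  have hqt' : t * (commConst m * (4 * M)) ≤ 1 / 2 := by
    have h1 : 0 ≤ t * t * (commConst m * M) := by positivity
    have h2 : 0 ≤ t * (commConst m * M) := by positivity
    linarith
  have hNt : t * N ≤ M := (mul_le_mul_of_nonneg_right ht.2 hN).trans hbN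
  have h1 := H.hnorm_vorticity_sq_le hm hν (L := 4 * M) (b := t) hm₁ (by positivity) (hsub ht)
    (fun s hs => by
      rw [← ENNReal.ofReal_toReal (hfin s (hsub' s hs))]
      exact ENNReal.ofReal_le_ofReal (hle s hs)) (by linarith) hN h0
  have hnn : 0 ≤ t * (3 * (4 * M * N) + commConst m * (2 * (1 + t)) * (4 * M) ^ 3) := by positivity
  have h2 := ENNReal.toReal_mono (by have := hfin 0 h0b; finiteness) h1
  rw [ENNReal.toReal_add (by have := hfin 0 h0b; finiteness) (by finiteness), ENNReal.toReal_pow,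
    ENNReal.toReal_pow, ENNReal.toReal_ofReal hnn] at h2
  -- with `X(0) ≤ M` this gives `X² ≤ 14 M² < (4 M)²`
  have h3 : t * (3 * (4 * M * N) + commConst m * (2 * (1 + t)) * (4 * M) ^ 3) ≤ 13 * M ^ 2 := by
    have e : t * (3 * (4 * M * N) + commConst m * (2 * (1 + t)) * (4 * M) ^ 3) =
        12 * M * (t * N) + M ^ 2 * (t * (1 + t) * (128 * (commConst m * M))) := by ring
    rw [e]
    nlinarith [mul_le_mul_of_nonneg_left hNt (by positivity : 0 ≤ 12 * M),
      mul_le_mul_of_nonneg_left hqt (sq_nonneg M)]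
  refine abs_lt_of_sq_lt_sq' ?_ (by positivity) |>.2
  have h4 := pow_le_pow_left₀ ENNReal.toReal_nonneg hx0 2
  nlinarith [sq_pos_of_pos hM]

end IsSolution

end Couette

end

theorem proposition3p1 (m m₁ : ℝ) (hm : 2 < m) (hm₁ : 1 ≤ m₁) :
    ∃ ε₁ : ℝ, 0 < ε₁ ∧ ∃ C : ℝ, 0 < C ∧
      ∀ ε₀ : ℝ, 0 < ε₀ → ε₀ ≤ ε₁ →
      ∀ ν : ℝ, 0 < ν → ν ≤ 1 →
      ∀ T : ℝ, 0 < T →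
      ∀ (ω_in θ_in : Couette.L2) (ω θ u₁ u₂ : ℝ → Couette.L2),
        Couette.IsSolution m ν T ω_in θ_in ω θ u₁ u₂ →
        Couette.sobolevNorm m ω_in ≤ ENNReal.ofReal (ε₀ * ν ^ (1 / 3 : ℝ)) →
        Couette.multNorm (fun k ξ => Couette.japX m₁ k * Couette.lam 0 m k ξ) θ_in
          ≤ ENNReal.ofReal (ε₀ * ν ^ (2 / 3 : ℝ)) →
        ∀ t : ℝ, 0 ≤ t → t ≤ T → t ≤ ν ^ (-(1 / 6) : ℝ) →
          Couette.multNorm (Couette.lam t m) (ω t)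
            + ENNReal.ofReal (ν ^ (-(1 / 3) : ℝ))
              * Couette.multNorm (fun k ξ => Couette.japX m₁ k * Couette.lam t m k ξ) (θ t)
            ≤ ENNReal.ofReal (C * ε₀ * ν ^ (1 / 3 : ℝ)) := by
  have hC := Couette.commConst_nonneg hm
  refine ⟨1 / (256 * (Couette.commConst m + 1)), by positivity, 6, by norm_num, ?_⟩
  intro ε₀ hε hε₁ ν hν hν1 T hT ω_in θ_in ω θ u₁ u₂ H hω hθ t ht htT htν
  rw [← H.init_vorticity, Couette.sobolevNorm, Couette.multNorm_lam] at hω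
  rw [← H.init_temperature, Couette.multNorm_japX_mul_lam] at hθ
  rw [Couette.multNorm_lam, Couette.multNorm_japX_mul_lam]
  -- the powers of `ν`
  have hp : ∀ a : ℝ, 0 < ν ^ a := fun a => Real.rpow_pos_of_pos hν a
  have hmono : ∀ {a b : ℝ}, a ≤ b → ν ^ b ≤ ν ^ a := fun h =>
    Real.rpow_le_rpow_of_exponent_ge hν hν1 h
  have hM : 0 < ε₀ * ν ^ (1 / 3 : ℝ) := mul_pos hε (hp _)
  have hN : 0 ≤ ε₀ * ν ^ (2 / 3 : ℝ) := (mul_pos hε (hp _)).le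
  have e1 : ν ^ (-(1 / 6) : ℝ) * ν ^ (-(1 / 6) : ℝ) * ν ^ (1 / 3 : ℝ) = 1 := by
    rw [← Real.rpow_add hν, ← Real.rpow_add hν]; norm_num
  have e2 : ν ^ (-(1 / 6) : ℝ) * ν ^ (2 / 3 : ℝ) ≤ ν ^ (1 / 3 : ℝ) := by
    rw [← Real.rpow_add hν]; exact hmono (by norm_num)
  have e3 : ν ^ (-(1 / 3) : ℝ) * ν ^ (2 / 3 : ℝ) = ν ^ (1 / 3 : ℝ) := by
    rw [← Real.rpow_add hν]; norm_num
  have hone : 1 ≤ ν ^ (-(1 / 6) : ℝ) :=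
    Real.one_le_rpow_of_pos_of_le_one_of_nonpos hν hν1 (by norm_num)
  have htt : t * (1 + t) * ν ^ (1 / 3 : ℝ) ≤ 2 := by
    calc t * (1 + t) * ν ^ (1 / 3 : ℝ)
        ≤ ν ^ (-(1 / 6) : ℝ) * (2 * ν ^ (-(1 / 6) : ℝ)) * ν ^ (1 / 3 : ℝ) := by
          have := hp (1 / 3)
          gcongr
          linarith
      _ = 2 * (ν ^ (-(1 / 6) : ℝ) * ν ^ (-(1 / 6) : ℝ) * ν ^ (1 / 3 : ℝ)) := by ring
      _ = 2 := by rw [e1, mul_one]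
  have hsmall : 256 * (Couette.commConst m * ε₀) ≤ 1 := by
    rw [le_div_iff₀ (by positivity)] at hε₁
    nlinarith
  have hq : t * (1 + t) * (128 * (Couette.commConst m * (ε₀ * ν ^ (1 / 3 : ℝ)))) ≤ 1 := by
    calc t * (1 + t) * (128 * (Couette.commConst m * (ε₀ * ν ^ (1 / 3 : ℝ))))
        = 128 * (Couette.commConst m * ε₀) * (t * (1 + t) * ν ^ (1 / 3 : ℝ)) := by ring
      _ ≤ 128 * (Couette.commConst m * ε₀) * 2 := by gcongr
      _ ≤ 1 := by linarith
  have hbN : t * (ε₀ * ν ^ (2 / 3 : ℝ)) ≤ ε₀ * ν ^ (1 / 3 : ℝ) := by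
    calc t * (ε₀ * ν ^ (2 / 3 : ℝ)) = ε₀ * (t * ν ^ (2 / 3 : ℝ)) := by ring
      _ ≤ ε₀ * (ν ^ (-(1 / 6) : ℝ) * ν ^ (2 / 3 : ℝ)) := by
          have := hp (2 / 3)
          gcongr
      _ ≤ _ := by gcongr
  have hX := H.hnorm_vorticity_le hm hν.le hm₁ hM ⟨ht, htT⟩ hω hN hθ hq hbN
  have hY := H.hnorm_temperature_le hm hν.le (by positivity) ⟨ht, htT⟩ hX
    (by nlinarith [mul_nonneg hC hM.le, mul_nonneg ht (mul_nonneg hC hM.le),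
      mul_nonneg (mul_nonneg ht ht) (mul_nonneg hC hM.le)]) hN hθ t ⟨ht, le_rfl⟩
  calc _ ≤ ENNReal.ofReal (4 * (ε₀ * ν ^ (1 / 3 : ℝ))) + ENNReal.ofReal (ν ^ (-(1 / 3) : ℝ)) *
        ENNReal.ofReal (3 / 2 * (ε₀ * ν ^ (2 / 3 : ℝ))) :=
        add_le_add (hX t ⟨ht, le_rfl⟩) (mul_le_mul_right hY _)
    _ = ENNReal.ofReal (4 * (ε₀ * ν ^ (1 / 3 : ℝ)) +
        3 / 2 * ε₀ * (ν ^ (-(1 / 3) : ℝ) * ν ^ (2 / 3 : ℝ))) := by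
        rw [← ENNReal.ofReal_mul (hp _).le, ← ENNReal.ofReal_add (by positivity)
          (mul_nonneg (hp _).le (by positivity))]
        congr 1
        ring
    _ ≤ _ := by
        rw [e3]
        refine ENNReal.ofReal_le_ofReal ?_
        linarith
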